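/- **Setting.** A hypergraphic preference system $(H,\succ)$ consists of a finite non-empty vertex set $V$, a set $E$ of subsets of $V$ that contains every singleton $\{i\}$, and for every $i\in V$ a strict linear order $\succ_i$ on $\delta(i)=\{e\in E: i\in e\}$ whose worst element is $\{i\}$. A stable matching is a vector $x\in\{0,1\}^E$ such that every $e\in E$ has a vertex $i\in e$ with $\sum_{e'\in\delta(i),\,e'\succeq_i e}x_{e'}=1$. $H$ is an arborescence hypergraph if there is an arborescence $\mathcal T$ (a directed tree in which every vertex is reached from the root by a directed path) with arc set $V$ such that every $e\in E$ is the set of arcs of a non-empty directed path of $\mathcal T$; let $a_e$ be the arc from the first to the last vertex of this path. The instance is given by $\mathcal T$, the arcs $a_e$ and the preference lists. Let $n=|V|$, $m=|E|$. A depth-first ordering numbers the vertices of $\mathcal T$ by $v_1,\dots,v_{n+1}$ and its arcs (the elements of $V$) by $1,\dots,n$ such that $k\ge l$ whenever the directed path from the root to $v_l$ passes through $v_k$, and such that arc $i$ has head $v_i$. The block $S_i$ consists of the hyperedges other than $\{i\}$ whose largest element is $i$. Order $E$ as $e_1,\dots,e_m$ by putting first $\{1\},\dots,\{n\}$ and then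 $S_1,\dots,S_n$, each $S_i$ in decreasing order of $\succ_i$. Let $A$ be the $V\times E$ incidence matrix and let $C\in\mathbb R^{V\times E}$ satisfy: $c_{i,e}=|\delta(i)|-\ell$ if $e$ is the $\ell$-th best element of $\delta(i)$; the other entries of row $i$ are at least $|\delta(i)|$ and strictly decrease from left to right. Add a row and a column with index $0$: $$A'=\begin{pmatrix}1&0\\0&A\end{pmatrix},\quad b'=(1,\dots,1)^T,\quad C'=\begin{pmatrix}0&(m,m-1,\dots,1)\\(M,\dots,M)^T&C\end{pmatrix},\quad M>\max_{i,e} c_{i,e}.$$ Scarf's algorithm on $(A',b',C')$ starts with $B=\{0,\dots,n\}$, $O=\{1,\dots,n+1\}$ (with $O=B$ if $m=n$). While $B\ne O$ it performs an iteration. First a cardinal pivot: the column $j_t$ of $O\setminus B$ enters $B$, and a leaving candidate $j_\ell\in B$ leaves, that is, with $x$ the extreme point $A'_Bx_B=b'$ and $y=(A'_B)^{-1}A'_{j_t}$, a column with $y_{j_\ell}>0$ that minimizes $x_j/y_j$ over all $j\in B$ with $y_j>0$; a pivoting rule selects one leaving candidate for every feasible cardinal basis $B$ and every $j_t\notin B$.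 Then an ordinal pivot: the column $j_\ell$ leaves $O$. With $u^Q_i=\min_{j\in Q}c'_{i,j}$, let $i_\ell$ be the row with $u^O_{i_\ell}=c'_{i_\ell,j_\ell}$, let $j_r\in O\setminus\{j_\ell\}$ be the column with $u^{O\setminus\{j_\ell\}}_{i_\ell}=c'_{i_\ell,j_r}$, and let $i_r$ be the row with $u^O_{i_r}=c'_{i_r,j_r}$; the column that enters $O$ maximizes $c'_{i_r,k}$ over all $k\notin O$ with $c'_{i,k}>u^{O\setminus\{j_\ell\}}_i$ for all $i\ne i_r$. When $B=O$, the algorithm stops and outputs the extreme point of $B$, restricted to $E$. The first-forward-arc-leaving (FFL) rule: let $B$ be a feasible cardinal basis with extreme point $x$, let $e\notin B$ be the entering column with $a_e=(v,v')$, and consider the undirected path from $v$ to $v'$ in the tree formed by the arcs $a_j$, $j\in B\setminus\{0\}$. The leaving arc is the first forward arc $a_j$ on the path with $x_j=0$ if there is one; otherwise all forward arcs have $x_j=1$ and the first forward arc leaves. **Theorem.** Let $(H,\succ)$ be a hypergraphic preference system on an arborescence hypergraph, given as above. 1. For every depth-first ordering and every choice of $C$ and $M$ as above, the FFL rule uniquely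 determines a leaving column and is a pivoting rule for $(A',b')$. Scarf's algorithm on $(A',b',C')$ with this rule terminates after at most $|V|$ iterations with a dominating basis (a feasible cardinal basis $B$ such that every column $j$ has a row $i$ with $c'_{i,j}\le u^B_i$), and its output is a stable matching (in particular integral). 2. There are a program for a random access machine (unit cost for addition, truncated subtraction, comparison and memory access on natural numbers; no multiplication) and a constant $K$ such that on every instance, under any names of its vertices, arcs and hyperedges, the program halts after at most $K\,|V|\,|E|$ steps, having computed the sequence of pivots and the output of a run as in part 1 for some depth-first ordering. -/

import Mathlib

/-! ## Scarf's algorithm for a cardinal matrix `A`, a right-hand side `b` and an ordinal matrix `C` -/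

namespace Scarf

open Matrix

variable {ι κ : Type*} [Fintype ι] [Fintype κ]

/-- `B` is a cardinal basis: as many columns as rows, and `A_B` has full row rank. -/
def IsCardinalBasis (A : Matrix ι κ ℝ) (B : Finset κ) : Prop :=
  B.card = Fintype.card ι ∧
    (A.submatrix id (Subtype.val : {j // j ∈ B} → κ)).rank = Fintype.card ι

/-- `x = (x_B, 0)` with `A_B x_B = b`. -/
def IsBasicSolution (A : Matrix ι κ ℝ) (b : ι → ℝ) (B : Finset κ) (x : κ → ℝ) : Prop :=
  A *ᵥ x = b ∧ ∀ j, j ∉ B → x j = 0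

/-- `B` is a feasible cardinal basis and `x` is the extreme point of
`{x ≥ 0 : A x = b}` corresponding to `B`. -/
def IsExtremePoint (A : Matrix ι κ ℝ) (b : ι → ℝ) (B : Finset κ) (x : κ → ℝ) : Prop :=
  IsCardinalBasis A B ∧ IsBasicSolution A b B x ∧ ∀ j, 0 ≤ x j

def IsFeasibleBasis (A : Matrix ι κ ℝ) (b : ι → ℝ) (B : Finset κ) : Prop :=
  ∃ x, IsExtremePoint A b B x

/-- The utility `u_i^O`, the minimum of the entries of row `i` over the columns in `O`. -/
noncomputable def utility (C : Matrix ι κ ℝ) (O : Finset κ) (i : ι) : ℝ :=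
  sInf ((fun j => C i j) '' (O : Set κ))

def IsOrdinalBasis (C : Matrix ι κ ℝ) (O : Finset κ) : Prop :=
  O.card = Fintype.card ι ∧ ∀ j, ∃ i, C i j ≤ utility C O i

def IsDominatingBasis (A : Matrix ι κ ℝ) (b : ι → ℝ) (C : Matrix ι κ ℝ) (B : Finset κ) : Prop :=
  IsFeasibleBasis A b B ∧ IsOrdinalBasis C B

/-- `jl` is a leaving candidate of the cardinal pivot from `B` with entering column `jt`;
here `x` is the extreme point of `B` and `y = A_B⁻¹ A_jt`, extended by `0` outside `B`. -/
def IsLeavingCandidate (A : Matrix ι κ ℝ) (b : ι → ℝ) (B : Finset κ) (jt jl : κ) : Prop :=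
  jl ∈ B ∧ ∃ x y : κ → ℝ, IsExtremePoint A b B x ∧
    IsBasicSolution A (fun i => A i jt) B y ∧
    0 < y jl ∧ ∀ j ∈ B, 0 < y j → x jl / y jl ≤ x j / y j

/-- A pivoting rule picks one leaving candidate for every feasible cardinal basis `B` and
every entering column outside `B`. -/
def IsPivotingRule (A : Matrix ι κ ℝ) (b : ι → ℝ) (ρ : Finset κ → κ → κ) : Prop :=
  ∀ B jt, IsFeasibleBasis A b B → jt ∉ B → IsLeavingCandidate A b B jt (ρ B jt)

/-- Column `j` is `i`-disliked with respect to `O`. -/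
def IsDisliked (C : Matrix ι κ ℝ) (O : Finset κ) (i : ι) (j : κ) : Prop :=
  j ∈ O ∧ utility C O i = C i j

variable [DecidableEq κ]

/-- The set `K` of candidate entering columns of an ordinal pivot with reference row `ir`. -/
def ordinalCandidates (C : Matrix ι κ ℝ) (O : Finset κ) (jl : κ) (ir : ι) : Set κ :=
  {k | k ∉ O ∧ ∀ i, i ≠ ir → utility C (O.erase jl) i < C i k}

/-- `O'` results from the ordinal pivot from `O` with leaving column `jl`. -/
def IsOrdinalPivot (C : Matrix ι κ ℝ) (O : Finset κ) (jl : κ) (O' : Finset κ) : Prop :=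
  ∃ (il ir : ι) (jr js : κ),
    IsDisliked C O il jl ∧
    (jr ∈ O.erase jl ∧ utility C (O.erase jl) il = C il jr) ∧
    IsDisliked C O ir jr ∧
    js ∈ ordinalCandidates C O jl ir ∧
    (∀ k ∈ ordinalCandidates C O jl ir, C ir k ≤ C ir js) ∧
    O' = insert js (O.erase jl)

/-- One iteration `(B, O) → (B', O) → (B', O')` of Scarf's algorithm: a cardinal pivot with
entering column `O \ B` and leaving column given by the rule `ρ`, then an ordinal pivot with
leaving column `O \ B'`. -/
def IsIteration (C : Matrix ι κ ℝ) (ρ : Finset κ → κ → κ) (B O B' O' : Finset κ) : Prop :=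
  ∃ jt jl, O \ B = {jt} ∧ B' = insert jt (B.erase (ρ B jt)) ∧
    O \ B' = {jl} ∧ IsOrdinalPivot C O jl O'

/-- A complete run of Scarf's algorithm from the pair `(B₀, O₀)` with rule `ρ`:
it makes exactly `T` iterations and then stops, because its two bases coincide. (A run that would
stop in the middle of an iteration does not occur below: column `none` is always in `B`, and it
enters `O` only in an ordinal pivot.) -/
def IsRun (C : Matrix ι κ ℝ) (ρ : Finset κ → κ → κ) (B₀ O₀ : Finset κ)
    (T : ℕ) (B O : ℕ → Finset κ) : Prop :=
  B 0 = B₀ ∧ O 0 = O₀ ∧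
  (∀ k < T, B k ≠ O k ∧ IsIteration C ρ (B k) (O k) (B (k + 1)) (O (k + 1))) ∧
  B T = O T

end Scarf

/-! ## Hypergraphic preference systems -/

structure HypergraphicPreferenceSystem (V : Type*) where
  edges : Finset (Finset V)
  /-- `pref i e e'` says that `i` strictly prefers `e` to `e'`; it is only meaningful for
  hyperedges `e`, `e'` that contain `i`. -/
  pref : V → {e // e ∈ edges} → {e // e ∈ edges} → Prop
  pref_irrefl : ∀ i e, i ∈ e.1 → ¬ pref i e e
  pref_trans : ∀ i e e' e'', i ∈ e.1 → i ∈ e'.1 → i ∈ e''.1 →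
    pref i e e' → pref i e' e'' → pref i e e''
  pref_total : ∀ i e e', i ∈ e.1 → i ∈ e'.1 → e ≠ e' → pref i e e' ∨ pref i e' e
  singleton_mem : ∀ i, {i} ∈ edges
  singleton_worst : ∀ i e, i ∈ e.1 → e.1 ≠ {i} → pref i e ⟨{i}, singleton_mem i⟩

namespace HypergraphicPreferenceSystem

variable {V : Type*} (P : HypergraphicPreferenceSystem V)

abbrev Edge : Type _ := {e // e ∈ P.edges}

/-- The singleton hyperedge `e_i = {i}`. -/
def single (i : V) : P.Edge := ⟨{i}, P.singleton_mem i⟩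

open scoped Classical in
/-- The number of hyperedges at `i`, that is, `|δ(i)|`. -/
noncomputable def degree (i : V) : ℕ :=
  (Finset.univ.filter fun e : P.Edge => i ∈ e.1).card

open scoped Classical in
/-- The number of hyperedges at `i` that `i` strictly prefers to `e`. -/
noncomputable def numBetter (i : V) (e : P.Edge) : ℕ :=
  (Finset.univ.filter fun e' : P.Edge => i ∈ e'.1 ∧ P.pref i e' e).card

open scoped Classical in
/-- A stable matching: a `0/1`-vector such that every hyperedge `e` has a vertex `i ∈ e` with
`∑_{e' ∈ δ(i), e' ⪰_i e} x_{e'} = 1`. -/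
def IsStableMatching (x : P.Edge → ℝ) : Prop :=
  (∀ e, x e = 0 ∨ x e = 1) ∧
  ∀ e : P.Edge, ∃ i ∈ e.1,
    ∑ e' ∈ Finset.univ.filter (fun e' : P.Edge => i ∈ e'.1 ∧ (P.pref i e' e ∨ e' = e)), x e' = 1

end HypergraphicPreferenceSystem

/-! ## Paths in directed graphs, arborescences, arborescence hypergraphs -/

namespace ArcPath

variable {U α : Type*}

/-- `IsWalk tl hd u p w`: in the directed graph whose arcs are `a : α` with tail `tl a` and head
`hd a`, the list `p` is an undirected walk from `u` to `w`. An entry `(a, true)` traverses the arc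
`a` forward, an entry `(a, false)` traverses it backward. -/
def IsWalk (tl hd : α → U) : U → List (α × Bool) → U → Prop
  | u, [], w => u = w
  | u, (a, true) :: p, w => tl a = u ∧ IsWalk tl hd (hd a) p w
  | u, (a, false) :: p, w => hd a = u ∧ IsWalk tl hd (tl a) p w

/-- The vertices visited by a walk starting at `u`. -/
def vertices (tl hd : α → U) (u : U) (p : List (α × Bool)) : List U :=
  u :: p.map fun s => if s.2 then hd s.1 else tl s.1

/-- An (undirected) path: a walk that visits no vertex twice. -/
def IsPath (tl hd : α → U) (u : U) (p : List (α × Bool)) (w : U) : Prop :=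
  IsWalk tl hd u p w ∧ (vertices tl hd u p).Nodup

/-- A directed path: a path all of whose arcs are forward. -/
def IsDirectedPath (tl hd : α → U) (u : U) (l : List α) (w : U) : Prop :=
  IsPath tl hd u (l.map fun a => (a, true)) w

end ArcPath

/-- An arborescence on the vertex set `U` with set of arcs `V`: the underlying undirected graph
is a tree (without loops or parallel edges), and every vertex is reached from the root by a
directed path. -/
structure Arborescence (U V : Type*) where
  tail : V → U
  head : V → U
  root : U
  tail_ne_head : ∀ f, tail f ≠ head f
  arcs_injective : Function.Injective fun f => s(tail f, head f)
  isTree : (SimpleGraph.fromRel fun u w => ∃ f, tail f = u ∧ head f = w).IsTree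
  directed : ∀ w, ∃ l, ArcPath.IsDirectedPath tail head root l w

/-- The relation `u ≥ w`: the directed path from the root to `w` passes through `u`. -/
def Arborescence.Above {U V : Type*} (T : Arborescence U V) (u w : U) : Prop :=
  ∃ l, ArcPath.IsDirectedPath T.tail T.head T.root l w ∧
    u ∈ ArcPath.vertices T.tail T.head T.root (l.map fun a => (a, true))

/-- The hypergraph of `P` is an arborescence hypergraph, given by a principal tree `T` whose arcs
are the vertices of the hypergraph, and by an arc `(src e, tgt e)` for every hyperedge `e`:
`e` is the set of arcs of a directed path of `T` from `src e` to `tgt e`. -/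
structure ArborescenceNetwork {V : Type*} (P : HypergraphicPreferenceSystem V) (U : Type*) where
  T : Arborescence U V
  src : P.Edge → U
  tgt : P.Edge → U
  isPath : ∀ e : P.Edge, ∃ l : List V, l ≠ [] ∧
    ArcPath.IsDirectedPath T.tail T.head (src e) l (tgt e) ∧ ∀ f, f ∈ e.1 ↔ f ∈ l

/-! ## Block-partitioned matrices and the first-forward-arc-leaving rule -/

namespace ArborescenceNetwork

variable {V U : Type*} [Fintype V] {P : HypergraphicPreferenceSystem V}

/-- `e` belongs to the block `S_i`: `e` is not `{i}` and `i` is its last vertex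
in the order `σ`. -/
def InBlock (σ : V ≃ Fin (Fintype.card V)) (i : V) (e : P.Edge) : Prop :=
  i ∈ e.1 ∧ (∀ k ∈ e.1, σ k ≤ σ i) ∧ e.1 ≠ {i}

/-- A depth-first ordering of the principal tree, with block-partitioned matrices for the induced
order of the vertices of the hypergraph. Positions are counted from `0`. -/
structure BlockPartition (N : ArborescenceNetwork P U) where
  /-- the order of the vertices of the principal tree -/
  ν : U ≃ Fin (Fintype.card V + 1)
  /-- the order of the arcs of the principal tree -/
  σ : V ≃ Fin (Fintype.card V)
  depthFirst : ∀ u w, N.T.Above u w → ν w ≤ ν u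
  ν_head : ∀ f, ν (N.T.head f) = (σ f).castSucc
  /-- the order of the columns -/
  pos : P.Edge ≃ Fin P.edges.card
  pos_single : ∀ i, (pos (P.single i)).val = (σ i).val
  pos_block : ∀ i i' e e', InBlock σ i e → InBlock σ i' e' → σ i < σ i' → pos e < pos e'
  pos_pref : ∀ i e e', InBlock σ i e → InBlock σ i e' → P.pref i e e' → pos e < pos e'
  /-- the ordinal matrix -/
  C : Matrix V P.Edge ℝ
  /-- the `ℓ`-th best hyperedge at `i` has the entry `|δ(i)| - ℓ` -/
  C_incident : ∀ i e, i ∈ e.1 → C i e = (P.degree i : ℝ) - (P.numBetter i e + 1)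
  C_other_ge : ∀ i e, i ∉ e.1 → (P.degree i : ℝ) ≤ C i e
  C_other_anti : ∀ i e e', i ∉ e.1 → i ∉ e'.1 → pos e < pos e' → C i e' < C i e
  /-- the entries of the additional column of the ordinal matrix -/
  M : ℝ
  lt_M : ∀ i e, C i e < M

namespace BlockPartition

variable {N : ArborescenceNetwork P U} (S : BlockPartition N)

open scoped Classical in
/-- The incidence matrix of the hypergraph with an additional row and column `none`. -/
noncomputable def matA (_S : BlockPartition N) : Matrix (Option V) (Option P.Edge) ℝ
  | none, none => 1
  | none, some _ => 0
  | some _, none => 0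
  | some i, some e => if i ∈ e.1 then 1 else 0

/-- The all-ones right-hand side. -/
def vecb (_S : BlockPartition N) : Option V → ℝ := fun _ => 1

/-- The ordinal matrix with an additional row `(0, m, m - 1, …, 1)` and an additional column
`(0, M, …, M)`. -/
def matC : Matrix (Option V) (Option P.Edge) ℝ
  | none, none => 0
  | none, some e => (P.edges.card : ℝ) - ((S.pos e).val : ℝ)
  | some _, none => S.M
  | some i, some e => S.C i e

open scoped Classical in
/-- `B₀ = {0, 1, …, n}`: the additional column and the singletons. -/
noncomputable def initB : Finset (Option P.Edge) :=
  insert none ((Finset.univ.filter fun e : P.Edge => (S.pos e).val < Fintype.card V).image some)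

open scoped Classical in
/-- `O₀ = {1, …, n + 1}`: the singletons and the first column of the first block. If all
hyperedges are singletons, then there is no column `n + 1`, and `O₀ = B₀`, which is already a
dominating basis. -/
noncomputable def initO : Finset (Option P.Edge) :=
  if Fintype.card V < P.edges.card then
    (Finset.univ.filter fun e : P.Edge => (S.pos e).val ≤ Fintype.card V).image some
  else S.initB

end BlockPartition

/-- The first-forward-arc-leaving rule: `x` is the extreme point of `B`, `p` is the path in the
tree of the arcs of `B` from the tail to the head of the entering arc; the leaving arc `a` is the
first forward arc of `p` with `x_a = 0`, or the first forward arc of `p` if all forward arcs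
have value `1`. -/
def IsFFLLeaving (N : ArborescenceNetwork P U) (x : Option P.Edge → ℝ)
    (B : Finset (Option P.Edge)) (jt jl : Option P.Edge) : Prop :=
  ∃ (e a : P.Edge) (p q r : List (P.Edge × Bool)), jt = some e ∧ jl = some a ∧
    ArcPath.IsPath N.src N.tgt (N.src e) p (N.tgt e) ∧
    (∀ s ∈ p, some s.1 ∈ B) ∧
    p = q ++ (a, true) :: r ∧
    ((x (some a) = 0 ∧ ∀ s ∈ q, s.2 = true → x (some s.1) ≠ 0) ∨
     ((∀ s ∈ p, s.2 = true → x (some s.1) = 1) ∧ ∀ s ∈ q, s.2 = false))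

/-- `ρ` is the first-forward-arc-leaving rule, which in addition determines its leaving column
uniquely. -/
def BlockPartition.IsFFLRule {N : ArborescenceNetwork P U} (S : BlockPartition N)
    (ρ : Finset (Option P.Edge) → Option P.Edge → Option P.Edge) : Prop :=
  ∀ B x jt, Scarf.IsExtremePoint S.matA S.vecb B x → jt ∉ B →
    ∀ jl, IsFFLLeaving N x B jt jl ↔ jl = ρ B jt

end ArborescenceNetwork

/-! ## A random access machine with structured programs and unit costs

The memory consists of natural-number registers and of two-dimensional arrays of natural numbers.
There is no multiplication. Every operation costs one step. -/

namespace RAM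

structure Store where
  reg : ℕ → ℕ
  arr : ℕ → ℕ → ℕ → ℕ

inductive Expr where
  | const (k : ℕ)
  | reg (r : ℕ)
  | get (a : ℕ) (i j : Expr)
  | add (e₁ e₂ : Expr)
  | sub (e₁ e₂ : Expr)
  | lt (e₁ e₂ : Expr)
  | eq (e₁ e₂ : Expr)

def Expr.eval (s : Store) : Expr → ℕ
  | const k => k
  | reg r => s.reg r
  | get a i j => s.arr a (i.eval s) (j.eval s)
  | add e₁ e₂ => e₁.eval s + e₂.eval s
  | sub e₁ e₂ => e₁.eval s - e₂.eval s
  | lt e₁ e₂ => if e₁.eval s < e₂.eval s then 1 else 0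
  | eq e₁ e₂ => if e₁.eval s = e₂.eval s then 1 else 0

/-- The number of operations in an expression. -/
def Expr.cost : Expr → ℕ
  | const _ => 1
  | reg _ => 1
  | get _ i j => i.cost + j.cost + 1
  | add e₁ e₂ => e₁.cost + e₂.cost + 1
  | sub e₁ e₂ => e₁.cost + e₂.cost + 1
  | lt e₁ e₂ => e₁.cost + e₂.cost + 1
  | eq e₁ e₂ => e₁.cost + e₂.cost + 1

inductive Program where
  | skip
  | assign (r : ℕ) (e : Expr)
  | put (a : ℕ) (i j e : Expr)
  | seq (c₁ c₂ : Program)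
  | cond (e : Expr) (c₁ c₂ : Program)
  | loop (e : Expr) (c : Program)

def Store.setReg (s : Store) (r v : ℕ) : Store :=
  { s with reg := Function.update s.reg r v }

def Store.setArr (s : Store) (a i j v : ℕ) : Store :=
  { s with arr := fun a' i' j' => if a' = a ∧ i' = i ∧ j' = j then v else s.arr a' i' j' }

/-- `Exec c s t s'`: the program `c`, started in the store `s`, halts after exactly `t` steps in
the store `s'`. A condition holds if its value is not `0`. -/
inductive Exec : Program → Store → ℕ → Store → Prop
  | skip (s) : Exec .skip s 1 s
  | assign (s r e) : Exec (.assign r e) s (e.cost + 1) (s.setReg r (e.eval s))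
  | put (s a i j e) : Exec (.put a i j e) s (i.cost + j.cost + e.cost + 1)
      (s.setArr a (i.eval s) (j.eval s) (e.eval s))
  | seq {c₁ c₂ s s₁ s₂ t₁ t₂} : Exec c₁ s t₁ s₁ → Exec c₂ s₁ t₂ s₂ →
      Exec (.seq c₁ c₂) s (t₁ + t₂) s₂
  | cond_true {e c₁ c₂ s s' t} : e.eval s ≠ 0 → Exec c₁ s t s' →
      Exec (.cond e c₁ c₂) s (e.cost + 1 + t) s'
  | cond_false {e c₁ c₂ s s' t} : e.eval s = 0 → Exec c₂ s t s' →
      Exec (.cond e c₁ c₂) s (e.cost + 1 + t) s'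
  | loop_true {e c s s₁ s₂ t₁ t₂} : e.eval s ≠ 0 → Exec c s t₁ s₁ → Exec (.loop e c) s₁ t₂ s₂ →
      Exec (.loop e c) s (e.cost + 1 + t₁ + t₂) s₂
  | loop_false {e c s} : e.eval s = 0 → Exec (.loop e c) s (e.cost + 1) s

end RAM

/-! ## Input and output of a program for stable matchings on arborescence hypergraphs -/

namespace ArborescenceNetwork

variable {V U : Type*} [Fintype V] [Fintype U] {P : HypergraphicPreferenceSystem V}

/-- Arbitrary names `0, 1, 2, …` for the vertices of the hypergraph, for the vertices of the
principal tree and for the hyperedges. -/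
structure Labeling (N : ArborescenceNetwork P U) where
  vert : V ≃ Fin (Fintype.card V)
  node : U ≃ Fin (Fintype.card U)
  edge : P.Edge ≃ Fin P.edges.card

variable {N : ArborescenceNetwork P U} (L : Labeling N)

/-- The name of a column of the matrices: `0` for the additional column. -/
def Labeling.column : Option P.Edge → ℕ
  | none => 0
  | some e => (L.edge e).val + 1

/-- The input: registers `0` and `1` hold `|V|` and `|E|`; arrays `0` and `1` hold the tails and
heads of the arcs of the principal tree, arrays `2` and `3` those of the arcs that stand for the
hyperedges; array `4` holds the lengths of the preference lists and array `5` the lists, best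
hyperedge first. All other registers and arrays are zero. -/
structure Labeling.IsInput (s : RAM.Store) : Prop where
  numVert : s.reg 0 = Fintype.card V
  numEdge : s.reg 1 = P.edges.card
  tail : ∀ f, s.arr 0 (L.vert f) 0 = L.node (N.T.tail f)
  head : ∀ f, s.arr 1 (L.vert f) 0 = L.node (N.T.head f)
  src : ∀ e, s.arr 2 (L.edge e) 0 = L.node (N.src e)
  tgt : ∀ e, s.arr 3 (L.edge e) 0 = L.node (N.tgt e)
  degree : ∀ i, s.arr 4 (L.vert i) 0 = P.degree i
  pref : ∀ i e, i ∈ e.1 → s.arr 5 (L.vert i) (P.numBetter i e) = L.edge e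
  reg_zero : ∀ r, 2 ≤ r → s.reg r = 0
  arr_zero : ∀ a i j, 6 ≤ a → s.arr a i j = 0

/-- The output describes a run of Scarf's algorithm: register `2` holds the number of iterations,
array `6` the columns that leave in the cardinal pivots, array `7` the columns that enter in the
ordinal pivots, and array `8` the resulting vector. -/
structure Labeling.IsOutput [DecidableEq V] (s : RAM.Store) (T : ℕ)
    (B O : ℕ → Finset (Option P.Edge)) (x : Option P.Edge → ℝ) : Prop where
  iterations : s.reg 2 = T
  leaving : ∀ k < T, ∃ j, B k \ B (k + 1) = {j} ∧ s.arr 6 k 0 = L.column j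
  entering : ∀ k < T, ∃ j, O (k + 1) \ O k = {j} ∧ s.arr 7 k 0 = L.column j
  vector : ∀ e, (s.arr 8 (L.edge e) 0 : ℝ) = x (some e)

end ArborescenceNetwork

/-! Every hyperedge is a directed path of the arborescence, so the entry of row `f` in its column is
the difference, along `a_e`, of the indicator of the nodes below `f` (`potential_tgt_sub_src`). Thus
`A` is a network matrix. The arcs of a cardinal basis connect all nodes, and the entering column is
the ±1 combination of the basis arcs on the path between its ends (`isBasicSolution_signs`). The
right-hand side is column `none` plus the singleton columns, so extreme points are integral, hence
0/1. In the ratio test only forward arcs count, with ratios equal to their values; the FFL arc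
therefore passes it.

The run is predicted by a greedy assignment. Going through the arcs from the bottom to the root, let
`D i` be the hyperedge that `i` likes best among those with first arc `i` whose other vertices `k`
(all lower, hence already treated) prefer it to `D k` (`IsGreedy`). The algorithm visits the blocks
in order, skips those with `D i = {i}`, and in each remaining block makes one iteration, in which `D
i` replaces `{i}`. All cardinal bases are then triangular: apart from column `none` they contain
exactly one hyperedge for each first arc. Triangular bases are feasible, because paths through a
common arc are nested upwards (`exists_isExtremePoint_basisOf`).

Two facts make the prediction correct. First, when `D i` enters, all arcs from `i` on still hold
their singletons. The arc of `{i}` has the same tail as that of `D i`, so it is the first arc of the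
tree path, and it is forward. If its value is 0, the FFL rule takes it. If its value is 1, the
exchanged basis is again triangular, hence feasible, which forces the value 1 on every forward arc,
and the rule takes it as the first one (`isFFLLeaving_single`). Second, the ordinal pivot has row
`none` as reference row, so the entering column is the leftmost hyperedge whose entry in every other
row exceeds the utility there. By the choice of `D` this is `D i'` for the next non-trivial block
(`isNext_stage`), or column `none` if nothing is left, and then the two bases coincide. Every step
is forced, there is at most one iteration per vertex, and in the end no hyperedge is acceptable, so
the basis is dominating and its extreme point stable.

The program computes `D` without pivoting: it scans the list of `i` up to the first unmarked
hyperedge with first arc `i` and marks the rest of the list. This costs a constant times `|E|` per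
vertex. The extreme point is then found from the root downwards: `D i` is matched if and only if no
matched hyperedge with a higher first arc contains `i` (`eq_one_iff_of_isExtremePoint`). -/

set_option linter.unusedSectionVars false

/-! ### Walks and paths in a directed graph. -/

namespace ArcPath

variable {U α : Type*} {tl hd : α → U}

/-- The sum telescopes; a backward step counts its arc with the opposite sign. With indicator
potentials this turns a path into a linear combination of columns. -/
theorem IsWalk.sum_sub {u w : U} {p : List (α × Bool)} (h : IsWalk tl hd u p w) (φ : U → ℝ) :
    (p.map fun s => (if s.2 then 1 else -1) * (φ (hd s.1) - φ (tl s.1))).sum = φ w - φ u := by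
  induction p generalizing u with
  | nil => cases h; simp
  | cons s p ih =>
    obtain ⟨a, b⟩ := s
    cases b
    · obtain ⟨h1, h2⟩ := h
      simp only [List.map_cons, List.sum_cons, ih h2, ← h1]
      simp
    · obtain ⟨h1, h2⟩ := h
      simp only [List.map_cons, List.sum_cons, ih h2, ← h1]
      simp

theorem IsWalk.endpoints_mem {u w : U} {p : List (α × Bool)} (h : IsWalk tl hd u p w)
    {s : α × Bool} (hs : s ∈ p) :
    tl s.1 ∈ vertices tl hd u p ∧ hd s.1 ∈ vertices tl hd u p := by
  induction p generalizing u with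
  | nil => simp at hs
  | cons t p ih =>
    obtain ⟨a, b⟩ := t
    rcases List.mem_cons.1 hs with rfl | hs
    · cases b
      · obtain ⟨h1, h2⟩ := h
        simp [vertices, h1]
      · obtain ⟨h1, h2⟩ := h
        simp [vertices, h1]
    · cases b
      · obtain ⟨h1, h2⟩ := h
        have := ih h2 ‹s ∈ p›
        simp only [vertices, List.map_cons, List.mem_cons] at this ⊢
        exact ⟨Or.inr this.1, Or.inr this.2⟩
      · obtain ⟨h1, h2⟩ := h
        have := ih h2 ‹s ∈ p›
        simp only [vertices, List.map_cons, List.mem_cons] at this ⊢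
        exact ⟨Or.inr this.1, Or.inr this.2⟩

/-- The vertex reached by a step. -/
def stepEnd (tl hd : α → U) (s : α × Bool) : U := if s.2 then hd s.1 else tl s.1

/-- The vertex left by a step. -/
def stepStart (tl hd : α → U) (s : α × Bool) : U := if s.2 then tl s.1 else hd s.1

theorem isWalk_cons {u w : U} {s : α × Bool} {p : List (α × Bool)} :
    IsWalk tl hd u (s :: p) w ↔ stepStart tl hd s = u ∧ IsWalk tl hd (stepEnd tl hd s) p w := by
  obtain ⟨a, b⟩ := s
  cases b <;> simp [IsWalk, stepStart, stepEnd]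

theorem vertices_cons {u : U} {s : α × Bool} {p : List (α × Bool)} :
    vertices tl hd u (s :: p) = u :: vertices tl hd (stepEnd tl hd s) p := rfl

theorem isPath_cons {u w : U} {s : α × Bool} {p : List (α × Bool)} :
    IsPath tl hd u (s :: p) w ↔ stepStart tl hd s = u ∧
      u ∉ vertices tl hd (stepEnd tl hd s) p ∧ IsPath tl hd (stepEnd tl hd s) p w := by
  rw [IsPath, IsPath, isWalk_cons, vertices_cons, List.nodup_cons]
  tauto

theorem IsWalk.stepStart_mem {u w : U} {p : List (α × Bool)} (h : IsWalk tl hd u p w)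
    {s : α × Bool} (hs : s ∈ p) : stepStart tl hd s ∈ vertices tl hd u p := by
  have := h.endpoints_mem hs
  unfold stepStart
  split_ifs
  exacts [this.1, this.2]

/-- A second use of an arc would bring the path back to the vertex that it left with the first use.
-/
theorem IsPath.arcs_nodup {u w : U} {p : List (α × Bool)} (h : IsPath tl hd u p w) :
    (p.map Prod.fst).Nodup := by
  induction p generalizing u with
  | nil => simp
  | cons s p ih =>
    obtain ⟨h1, h2, h3⟩ := isPath_cons.1 h
    rw [List.map_cons, List.nodup_cons]
    refine ⟨fun hm => h2 ?_, ih h3⟩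
    obtain ⟨t, ht, hts⟩ := List.mem_map.1 hm
    have := h3.1.endpoints_mem ht
    rw [hts] at this
    rw [← h1]
    unfold stepStart
    split_ifs
    exacts [this.1, this.2]

/-- A step of a path that starts at the first vertex is the first step. -/
theorem IsPath.eq_cons_of_stepStart {u w : U} {p : List (α × Bool)} (h : IsPath tl hd u p w)
    {s : α × Bool} (hs : s ∈ p) (hsu : stepStart tl hd s = u) : ∃ r, p = s :: r := by
  cases p with
  | nil => simp at hs
  | cons t p =>
    obtain ⟨h1, h2, h3⟩ := isPath_cons.1 h
    rcases List.mem_cons.1 hs with rfl | hs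
    · exact ⟨p, rfl⟩
    · exact absurd (hsu ▸ h3.1.stepStart_mem hs) h2

/-- Only the first step of a path starts at its first vertex, so the set of steps determines their
order. This is needed because paths in a basis are compared through their sign vectors, which forget
the order. -/
theorem IsPath.eq_of_mem_iff {u w w' : U} {p p' : List (α × Bool)} (h : IsPath tl hd u p w)
    (h' : IsPath tl hd u p' w') (hpp : ∀ s, s ∈ p ↔ s ∈ p') : p = p' := by
  induction p generalizing u p' with
  | nil =>
    cases p' with
    | nil => rfl
    | cons t p' => simpa using (hpp t).2 (by simp)
  | cons s p ih =>
    have h1 := isPath_cons.1 h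
    obtain ⟨r, rfl⟩ := h'.eq_cons_of_stepStart ((hpp s).1 (by simp)) h1.1
    have h2 := isPath_cons.1 h'
    congr 1
    have hn := h.arcs_nodup.of_map
    have hn' := h'.arcs_nodup.of_map
    rw [List.nodup_cons] at hn hn'
    refine ih h1.2.2 h2.2.2 fun t => ?_
    have := hpp t
    simp only [List.mem_cons] at this
    constructor
    · intro ht
      exact (this.1 (Or.inr ht)).resolve_left fun h => hn.1 (h ▸ ht)
    · intro ht
      exact (this.2 (Or.inr ht)).resolve_left fun h => hn'.1 (h ▸ ht)

theorem IsPath.exists_suffix {u u' w : U} {p : List (α × Bool)} (h : IsPath tl hd u p w)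
    (hu : u' ∈ vertices tl hd u p) : ∃ q, q <:+ p ∧ IsPath tl hd u' q w := by
  induction p generalizing u with
  | nil =>
    obtain rfl : u' = u := by simpa [vertices] using hu
    exact ⟨[], List.suffix_refl _, h⟩
  | cons s p ih =>
    rw [vertices_cons] at hu
    rcases List.mem_cons.1 hu with rfl | hu
    · exact ⟨_, List.suffix_refl _, h⟩
    · obtain ⟨q, hq, hq'⟩ := ih (isPath_cons.1 h).2.2 hu
      exact ⟨q, hq.trans (List.suffix_cons _ _), hq'⟩

/-- If `w` can be reached from `u` by traversing arcs of `Q`, then there is a path. -/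
theorem exists_isPath {Q : α → Prop} {u w : U}
    (h : Relation.ReflTransGen
      (fun u v => ∃ s : α × Bool, Q s.1 ∧ stepStart tl hd s = u ∧ stepEnd tl hd s = v) u w) :
    ∃ p, IsPath tl hd u p w ∧ ∀ s ∈ p, Q s.1 := by
  induction h using Relation.ReflTransGen.head_induction_on with
  | refl => exact ⟨[], ⟨rfl, by simp [vertices]⟩, by simp⟩
  | @head u v huv _ ih =>
    obtain ⟨p, hp, hQ⟩ := ih
    obtain ⟨s, hs, rfl, rfl⟩ := huv
    by_cases hm : stepStart tl hd s ∈ vertices tl hd (stepEnd tl hd s) p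
    · obtain ⟨q, hq, hq'⟩ := hp.exists_suffix hm
      exact ⟨q, hq', fun t ht => hQ t (hq.subset ht)⟩
    · refine ⟨s :: p, isPath_cons.2 ⟨rfl, hm, hp⟩, fun t ht => ?_⟩
      rcases List.mem_cons.1 ht with rfl | ht
      exacts [hs, hQ t ht]

theorem isWalk_forward_cons {u w : U} {a : α} {l : List α} :
    IsWalk tl hd u ((a :: l).map fun a => (a, true)) w ↔
      tl a = u ∧ IsWalk tl hd (hd a) (l.map fun a => (a, true)) w := Iff.rfl

theorem IsDirectedPath.nodup {u w : U} {l : List α} (h : IsDirectedPath tl hd u l w) :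
    l.Nodup := by
  have := IsPath.arcs_nodup h
  rwa [List.map_map, show (Prod.fst ∘ fun a : α => (a, true)) = id from rfl, List.map_id] at this

theorem IsWalk.forward_sum_sub {u w : U} {l : List α}
    (h : IsWalk tl hd u (l.map fun a => (a, true)) w) (φ : U → ℝ) :
    (l.map fun a => φ (hd a) - φ (tl a)).sum = φ w - φ u := by
  simpa [List.map_map, Function.comp_def] using h.sum_sub φ

/-- In a directed walk every arc but the first has a predecessor. -/
theorem IsWalk.exists_pred {u w : U} {l : List α}
    (h : IsWalk tl hd u (l.map fun a => (a, true)) w) {b : α} (hb : b ∈ l) :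
    tl b = u ∨ ∃ a ∈ l, hd a = tl b := by
  induction l generalizing u with
  | nil => simp at hb
  | cons a l ih =>
    obtain ⟨h1, h2⟩ := isWalk_forward_cons.1 h
    rcases List.mem_cons.1 hb with rfl | hb
    · exact Or.inl h1
    · rcases ih h2 hb with h3 | ⟨c, hc, hc'⟩
      · exact Or.inr ⟨a, by simp, h3.symm⟩
      · exact Or.inr ⟨c, by simp [hc], hc'⟩

theorem IsWalk.exists_last {u w : U} {l : List α}
    (h : IsWalk tl hd u (l.map fun a => (a, true)) w) (huw : u ≠ w) :
    ∃ a ∈ l, hd a = w ∧ tl a ∈ vertices tl hd u (l.map fun a => (a, true)) := by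
  induction l generalizing u with
  | nil => exact absurd h huw
  | cons a l ih =>
    obtain ⟨h1, h2⟩ := isWalk_forward_cons.1 h
    by_cases haw : hd a = w
    · exact ⟨a, by simp, haw, by simp [vertices, h1]⟩
    · obtain ⟨b, hb, hb', hb''⟩ := ih h2 haw
      exact ⟨b, by simp [hb], hb', List.mem_cons_of_mem _ hb''⟩

end ArcPath

/-! ### Hyperedges as paths of the principal tree; the network structure of `A`. -/

namespace ArborescenceNetwork

variable {V U : Type*} {P : HypergraphicPreferenceSystem V} (N : ArborescenceNetwork P U)

/-- A function on the nodes that does not change along any arc of the principal tree is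
constant. -/
theorem _root_.Arborescence.eq_of_forall_arc (T : Arborescence U V) {β : Type*} (φ : U → β)
    (h : ∀ f, φ (T.head f) = φ (T.tail f)) (u w : U) : φ u = φ w := by
  have key : ∀ w, φ w = φ T.root := by
    intro w
    obtain ⟨l, hl, -⟩ := T.directed w
    generalize T.root = r at hl
    induction l generalizing r with
    | nil => cases hl; rfl
    | cons a l ih =>
      obtain ⟨h1, h2⟩ := ArcPath.isWalk_forward_cons.1 hl
      rw [ih _ h2, h, h1]
  rw [key u, key w]

theorem _root_.Arborescence.above_root (T : Arborescence U V) (w : U) : T.Above T.root w := by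
  obtain ⟨l, hl⟩ := T.directed w
  exact ⟨l, hl, by simp [ArcPath.vertices]⟩

/-- The sequence of arcs of the principal tree that belong to a hyperedge. -/
noncomputable def path (e : P.Edge) : List V := (N.isPath e).choose

theorem path_ne_nil (e : P.Edge) : N.path e ≠ [] := (N.isPath e).choose_spec.1

theorem isDirectedPath_path (e : P.Edge) :
    ArcPath.IsDirectedPath N.T.tail N.T.head (N.src e) (N.path e) (N.tgt e) :=
  (N.isPath e).choose_spec.2.1

theorem mem_path {e : P.Edge} {f : V} : f ∈ N.path e ↔ f ∈ e.1 :=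
  ((N.isPath e).choose_spec.2.2 f).symm

/-- The first arc of the path of a hyperedge. -/
noncomputable def top (e : P.Edge) : V := (N.path e).head (N.path_ne_nil e)

theorem top_mem (e : P.Edge) : N.top e ∈ e.1 := N.mem_path.1 (List.head_mem _)

theorem path_eq_cons (e : P.Edge) : N.path e = N.top e :: (N.path e).tail :=
  (List.cons_head_tail (N.path_ne_nil e)).symm

theorem tail_top (e : P.Edge) : N.T.tail (N.top e) = N.src e := by
  have h := (N.isDirectedPath_path e).1
  rw [N.path_eq_cons e] at h
  exact (ArcPath.isWalk_forward_cons.1 h).1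

theorem top_single (i : V) : N.top (P.single i) = i := by
  simpa [HypergraphicPreferenceSystem.single] using N.top_mem (P.single i)

theorem sum_sub_eq [DecidableEq V] (e : P.Edge) (φ : U → ℝ) :
    ∑ f ∈ e.1, (φ (N.T.head f) - φ (N.T.tail f)) = φ (N.tgt e) - φ (N.src e) := by
  have h := N.isDirectedPath_path e
  rw [← h.1.forward_sum_sub φ, ← List.sum_toFinset _ h.nodup]
  refine Finset.sum_congr ?_ fun _ _ => rfl
  ext f
  simp [N.mem_path]

theorem exists_pred {e : P.Edge} {b : V} (hb : b ∈ e.1) :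
    N.T.tail b = N.src e ∨ ∃ a ∈ e.1, N.T.head a = N.T.tail b := by
  simpa [N.mem_path] using (N.isDirectedPath_path e).1.exists_pred (N.mem_path.2 hb)

/-- A later arc with this tail would make the path visit its first vertex again. -/
theorem eq_top_of_tail_eq {e : P.Edge} {k : V} (hk : k ∈ e.1)
    (h : N.T.tail k = N.src e) : k = N.top e := by
  have hd := N.isDirectedPath_path e
  have hk' := N.mem_path.2 hk
  rw [N.path_eq_cons e] at hd hk'
  by_contra hne
  have h1 := (List.mem_cons.1 hk').resolve_left hne
  have h2 := (ArcPath.isPath_cons.1 hd).2.1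
  rw [← h] at h2
  exact h2 ((ArcPath.isPath_cons.1 hd).2.2.1.endpoints_mem
    (List.mem_map.2 ⟨k, h1, rfl⟩ : (k, true) ∈ _)).1

theorem exists_pred_of_ne_top {e : P.Edge} {k : V} (hk : k ∈ e.1) (h : k ≠ N.top e) :
    ∃ a ∈ e.1, N.T.head a = N.T.tail k :=
  (N.exists_pred hk).resolve_left fun h' => h (N.eq_top_of_tail_eq hk h')

namespace BlockPartition

variable {N} [Fintype V] (S : BlockPartition N)

/-- Arcs and their heads carry the same number. Without a numbering, `Arborescence.head_injective`
needs a count of nodes and arcs. -/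
theorem head_injective (S : BlockPartition N) : Function.Injective N.T.head := by
  intro f g h
  have := S.ν_head f
  rw [h, S.ν_head g] at this
  exact (S.σ.injective (Fin.castSucc_injective _ this)).symm

/-- The root lies above the node with the last number, so it has that number itself, whereas heads
have the numbers before it. -/
theorem root_ne_head (S : BlockPartition N) (f : V) : N.T.root ≠ N.T.head f := by
  intro h
  have h1 : S.ν (S.ν.symm (Fin.last _)) ≤ S.ν N.T.root := S.depthFirst _ _ (N.T.above_root _)
  rw [h, S.ν_head, Equiv.apply_symm_apply] at h1
  exact absurd h1 (not_le.2 (Fin.castSucc_lt_last _))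

/-- The last arc on the path from the root to the head of `f` must be `f`, so this path passes
through the tail of `f`. -/
theorem ν_head_lt (f : V) : S.ν (N.T.head f) < S.ν (N.T.tail f) := by
  refine lt_of_le_of_ne (S.depthFirst _ _ ?_) fun h =>
    N.T.tail_ne_head f (S.ν.injective h).symm
  obtain ⟨l, hl⟩ := N.T.directed (N.T.head f)
  obtain ⟨a, -, h1, h2⟩ := hl.1.exists_last (S.root_ne_head f)
  rw [S.head_injective h1] at h2
  exact ⟨l, hl, h2⟩

theorem σ_lt_of_tail_eq {a b : V} (h : N.T.head a = N.T.tail b) : S.σ b < S.σ a := by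
  have := S.ν_head_lt b
  rwa [← h, S.ν_head, S.ν_head, Fin.castSucc_lt_castSucc_iff] at this

/-- Any other arc of the path has a predecessor in `e`, with a larger number; so the maximum is the
first arc. -/
theorem σ_le_top {e : P.Edge} {k : V} (hk : k ∈ e.1) : S.σ k ≤ S.σ (N.top e) := by
  by_contra! hlt
  obtain ⟨j, hj, hmax⟩ := e.1.exists_max_image S.σ ⟨k, hk⟩
  have hne : j ≠ N.top e := by
    rintro rfl
    exact absurd (hmax k hk) (not_le.2 hlt)
  obtain ⟨a, ha, ha'⟩ := N.exists_pred_of_ne_top hj hne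
  exact absurd (hmax a ha) (not_le.2 (S.σ_lt_of_tail_eq ha'))

theorem σ_lt_top {e : P.Edge} {k : V} (hk : k ∈ e.1) (h : k ≠ N.top e) :
    S.σ k < S.σ (N.top e) :=
  lt_of_le_of_ne (S.σ_le_top hk) fun h' => h (S.σ.injective h')

/-- If two paths share an arc, then the higher path contains the first arc of the lower path. -/
theorem top_mem_of_mem {e e' : P.Edge} {k : V} (hk : k ∈ e.1) (hk' : k ∈ e'.1)
    (h : S.σ (N.top e) ≤ S.σ (N.top e')) : N.top e ∈ e'.1 := by
  by_contra hn
  obtain ⟨j, hj, hmax⟩ := Set.Finite.exists_maximalFor S.σ {j | j ∈ e.1 ∧ j ∈ e'.1}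
    (Set.toFinite _) ⟨k, hk, hk'⟩
  have hne : j ≠ N.top e := by
    rintro rfl
    exact hn hj.2
  have hne' : j ≠ N.top e' := by
    rintro rfl
    exact absurd (S.σ_lt_top hj.1 hne) (not_lt.2 h)
  obtain ⟨a, ha, ha'⟩ := N.exists_pred_of_ne_top hj.1 hne
  obtain ⟨b, hb, hb'⟩ := N.exists_pred_of_ne_top hj.2 hne'
  obtain rfl : a = b := S.head_injective (ha'.trans hb'.symm)
  have hlt := S.σ_lt_of_tail_eq ha'
  exact absurd (hmax ⟨ha, hb⟩ hlt.le) (not_le.2 hlt)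

theorem inBlock_top {e : P.Edge} (he : e ≠ P.single (N.top e)) : InBlock S.σ (N.top e) e :=
  ⟨N.top_mem e, fun _ hk => S.σ_le_top hk, fun h => he (Subtype.ext h)⟩

/-- The nodes below an arc of the principal tree. -/
inductive _root_.Arborescence.Below (T : Arborescence U V) (f : V) : U → Prop
  | base : T.Below f (T.head f)
  | step (g : V) : T.Below f (T.tail g) → T.Below f (T.head g)

theorem ν_le_of_below {f : V} {u : U} (h : N.T.Below f u) : S.ν u ≤ S.ν (N.T.head f) := by
  induction h with
  | base => exact le_rfl
  | step g _ ih => exact (S.ν_head_lt g).le.trans ih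

theorem below_head_iff (S : BlockPartition N) {f g : V} :
    N.T.Below f (N.T.head g) ↔ g = f ∨ N.T.Below f (N.T.tail g) := by
  constructor
  · intro h
    generalize hu : N.T.head g = u at h
    cases h with
    | base => exact Or.inl (S.head_injective hu)
    | step g' h => exact Or.inr (S.head_injective hu ▸ h)
  · rintro (rfl | h)
    exacts [.base, .step g h]

theorem not_below_tail (S : BlockPartition N) (f : V) : ¬ N.T.Below f (N.T.tail f) := fun h =>
  absurd (S.ν_le_of_below h) (not_le.2 (S.ν_head_lt f))

open scoped Classical in
/-- The indicator function of the nodes below an arc. -/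
noncomputable def _root_.Arborescence.potential (T : Arborescence U V) (f : V) (u : U) : ℝ :=
  if T.Below f u then 1 else 0

/-- The only way into the set of nodes below `f` is the arc `f`, since every node is the head of at
most one arc. -/
theorem potential_sub (S : BlockPartition N) [DecidableEq V] (f g : V) :
    N.T.potential f (N.T.head g) - N.T.potential f (N.T.tail g) = if f = g then 1 else 0 := by
  unfold Arborescence.potential
  by_cases h : f = g
  · subst h
    rw [if_pos (S.below_head_iff.2 (Or.inl rfl)), if_neg (S.not_below_tail f), if_pos rfl,
      sub_zero]
  · have : N.T.Below f (N.T.head g) ↔ N.T.Below f (N.T.tail g) :=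
      S.below_head_iff.trans (or_iff_right (Ne.symm h))
    rw [if_neg h]
    by_cases hb : N.T.Below f (N.T.tail g)
    · rw [if_pos hb, if_pos (this.2 hb), sub_self]
    · rw [if_neg hb, if_neg fun h' => hb (this.1 h'), sub_self]

theorem potential_tgt_sub_src (S : BlockPartition N) [DecidableEq V] (f : V) (e : P.Edge) :
    N.T.potential f (N.tgt e) - N.T.potential f (N.src e) = if f ∈ e.1 then 1 else 0 := by
  rw [← N.sum_sub_eq, Finset.sum_congr rfl fun g _ => S.potential_sub f g]
  simp

end BlockPartition

end ArborescenceNetwork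

/-! ### Linear algebra of cardinal bases. -/

namespace Scarf

open Matrix

variable {ι κ : Type*} [Fintype ι] [Fintype κ]

theorem submatrix_mulVec_restrict (A : Matrix ι κ ℝ) {B : Finset κ} {z : κ → ℝ}
    (hz : ∀ j, j ∉ B → z j = 0) :
    (A.submatrix id (Subtype.val : {j // j ∈ B} → κ)) *ᵥ (fun j => z j.1) = A *ᵥ z := by
  classical
  ext i
  simp only [mulVec, dotProduct, submatrix_apply, id]
  rw [Finset.sum_coe_sort B fun j => A i j * z j]
  exact Finset.sum_subset (Finset.subset_univ B) fun j _ hj => by rw [hz j hj, mul_zero]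

/-- The columns of a cardinal basis are linearly independent. -/
theorem IsCardinalBasis.eq_zero {A : Matrix ι κ ℝ} {B : Finset κ} (h : IsCardinalBasis A B)
    {z : κ → ℝ} (hz : ∀ j, j ∉ B → z j = 0) (hA : A *ᵥ z = 0) : z = 0 := by
  have h1 := LinearMap.finrank_range_add_finrank_ker
    (A.submatrix id (Subtype.val : {j // j ∈ B} → κ)).mulVecLin
  have h2 := h.2
  rw [Matrix.rank] at h2
  rw [h2, Module.finrank_fintype_fun_eq_card, Fintype.card_coe, h.1] at h1
  have h3 : LinearMap.ker (A.submatrix id (Subtype.val : {j // j ∈ B} → κ)).mulVecLin = ⊥ :=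
    Submodule.finrank_eq_zero.1 (by omega)
  have h4 : (fun j : {j // j ∈ B} => z j.1) = 0 := by
    have : (fun j : {j // j ∈ B} => z j.1) ∈
        LinearMap.ker (A.submatrix id (Subtype.val : {j // j ∈ B} → κ)).mulVecLin := by
      rw [LinearMap.mem_ker, mulVecLin_apply, submatrix_mulVec_restrict A hz, hA]
    rwa [h3, Submodule.mem_bot] at this
  ext j
  by_cases hj : j ∈ B
  · exact congr_fun h4 ⟨j, hj⟩
  · exact hz j hj

/-- The columns of a cardinal basis span. -/
theorem IsCardinalBasis.exists_eq {A : Matrix ι κ ℝ} {B : Finset κ} (h : IsCardinalBasis A B)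
    (v : ι → ℝ) : ∃ z : κ → ℝ, IsBasicSolution A v B z := by
  classical
  have h2 := h.2
  rw [Matrix.rank] at h2
  have h3 : LinearMap.range (A.submatrix id (Subtype.val : {j // j ∈ B} → κ)).mulVecLin = ⊤ :=
    Submodule.eq_top_of_finrank_eq (by rw [h2, Module.finrank_fintype_fun_eq_card])
  obtain ⟨w, hw⟩ := LinearMap.range_eq_top.1 h3 v
  have hz : ∀ j, j ∉ B → (fun j => if hj : j ∈ B then w ⟨j, hj⟩ else 0) j = 0 :=
    fun j hj => dif_neg hj
  refine ⟨_, ?_, hz⟩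
  rw [← submatrix_mulVec_restrict A hz, ← hw, mulVecLin_apply]
  congr 1
  ext j
  simp

/-- The submatrix is square, so a trivial kernel already gives full row rank. -/
theorem isCardinalBasis_of_eq_zero {A : Matrix ι κ ℝ} {B : Finset κ}
    (hB : B.card = Fintype.card ι)
    (h : ∀ z : κ → ℝ, (∀ j, j ∉ B → z j = 0) → A *ᵥ z = 0 → z = 0) : IsCardinalBasis A B := by
  classical
  refine ⟨hB, ?_⟩
  rw [Matrix.rank, LinearMap.finrank_range_of_inj, Module.finrank_fintype_fun_eq_card,
    Fintype.card_coe, hB]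
  rw [← LinearMap.ker_eq_bot, LinearMap.ker_eq_bot']
  intro w hw
  have hz : ∀ j, j ∉ B → (fun j => if hj : j ∈ B then w ⟨j, hj⟩ else 0) j = 0 :=
    fun j hj => dif_neg hj
  have hw' : (fun j : {j // j ∈ B} => (fun j => if hj : j ∈ B then w ⟨j, hj⟩ else 0) j.1) = w := by
    ext j
    simp
  have := h _ hz (by rw [← submatrix_mulVec_restrict A hz, hw']; exact hw)
  rw [← hw']
  ext j
  exact congr_fun this j.1

theorem IsBasicSolution.unique {A : Matrix ι κ ℝ} {b : ι → ℝ} {B : Finset κ} {x x' : κ → ℝ}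
    (hB : IsCardinalBasis A B) (h : IsBasicSolution A b B x) (h' : IsBasicSolution A b B x') :
    x = x' := by
  have := hB.eq_zero (z := x - x') (fun j hj => by simp [h.2 j hj, h'.2 j hj])
    (by rw [mulVec_sub, h.1, h'.1, sub_self])
  exact sub_eq_zero.1 this

theorem IsExtremePoint.unique {A : Matrix ι κ ℝ} {b : ι → ℝ} {B : Finset κ} {x x' : κ → ℝ}
    (h : IsExtremePoint A b B x) (h' : IsExtremePoint A b B x') : x = x' :=
  h.2.1.unique h.1 h'.2.1

end Scarf

/-! ### Cardinal bases as trees of arcs; integrality of extreme points. -/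

namespace ArborescenceNetwork

open Matrix Scarf

variable {V U : Type*} [Fintype V] [DecidableEq V] {P : HypergraphicPreferenceSystem V}
  {N : ArborescenceNetwork P U}

/-- The vector with an entry `1` for every forward step and `-1` for every backward step. -/
def signs (p : List (P.Edge × Bool)) : Option P.Edge → ℝ
  | none => 0
  | some e => if (e, true) ∈ p then 1 else if (e, false) ∈ p then -1 else 0

theorem signs_some (p : List (P.Edge × Bool)) (e : P.Edge) :
    signs p (some e) = if (e, true) ∈ p then 1 else if (e, false) ∈ p then -1 else 0 := rfl

theorem sum_signs_mul {p : List (P.Edge × Bool)} (hp : (p.map Prod.fst).Nodup) (g : P.Edge → ℝ) :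
    ∑ e, signs p (some e) * g e = (p.map fun s => (if s.2 then 1 else -1) * g s.1).sum := by
  induction p with
  | nil => simp [signs]
  | cons s p ih =>
    rw [List.map_cons, List.nodup_cons] at hp
    obtain ⟨h1, h2⟩ := hp
    rw [List.map_cons, List.sum_cons, ← ih h2]
    obtain ⟨a, b⟩ := s
    have ht : (a, true) ∉ p := fun h => h1 (List.mem_map.2 ⟨_, h, rfl⟩)
    have hf : (a, false) ∉ p := fun h => h1 (List.mem_map.2 ⟨_, h, rfl⟩)
    have : ∀ e, signs ((a, b) :: p) (some e) * g e =
        (if e = a then (if b then 1 else -1) * g a else 0) + signs p (some e) * g e := by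
      intro e
      by_cases hea : e = a
      · subst hea
        cases b <;> simp [signs, ht, hf]
      · simp [signs, hea]
    rw [Finset.sum_congr rfl fun e _ => this e, Finset.sum_add_distrib]
    simp

theorem signs_of_mem {p : List (P.Edge × Bool)} (hp : (p.map Prod.fst).Nodup) {s : P.Edge × Bool}
    (hs : s ∈ p) : signs p (some s.1) = if s.2 then 1 else -1 := by
  obtain ⟨a, b⟩ := s
  cases b
  · have : (a, true) ∉ p := by
      intro h
      have := List.inj_on_of_nodup_map hp h hs rfl
      simp at this
    simp [signs, this, hs]
  · simp [signs, hs]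

/-- Recovers the steps of a path from its sign vector; distinctness of the arcs rules out an arc
used in both directions. -/
theorem mem_iff_signs {p : List (P.Edge × Bool)} (hp : (p.map Prod.fst).Nodup) (e : P.Edge)
    (b : Bool) : (e, b) ∈ p ↔ signs p (some e) = if b then 1 else -1 := by
  refine ⟨fun h => signs_of_mem hp h, fun h => ?_⟩
  rw [signs_some] at h
  by_contra hn
  by_cases ht : (e, true) ∈ p
  · cases b
    · rw [if_pos ht] at h
      norm_num at h
    · exact hn ht
  · rw [if_neg ht] at h
    cases b
    · rw [if_neg hn] at h
      norm_num at h
    · rw [if_pos rfl] at h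
      split_ifs at h <;> norm_num at h

namespace BlockPartition

variable (S : BlockPartition N)

theorem matA_some_some (i : V) (e : P.Edge) :
    S.matA (some i) (some e) = if i ∈ e.1 then 1 else 0 := by
  by_cases h : i ∈ e.1 <;> simp [matA, h]

theorem matA_mulVec_none (z : Option P.Edge → ℝ) : (S.matA *ᵥ z) none = z none := by
  simp [mulVec, dotProduct, Fintype.sum_option, matA]

theorem matA_mulVec_some (z : Option P.Edge → ℝ) (i : V) :
    (S.matA *ᵥ z) (some i) = ∑ e : P.Edge, if i ∈ e.1 then z (some e) else 0 := by
  simp only [mulVec, dotProduct, Fintype.sum_option, S.matA_some_some]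
  simp [matA]

/-- Exchange the sums and telescope `φ` along each hyperedge. A potential that is constant along the
support of `z` thus annihilates the combination of columns given by `z`. -/
theorem sum_mulVec_mul (z : Option P.Edge → ℝ) (φ : U → ℝ) :
    ∑ i, (S.matA *ᵥ z) (some i) * (φ (N.T.head i) - φ (N.T.tail i)) =
      ∑ e, z (some e) * (φ (N.tgt e) - φ (N.src e)) := by
  simp only [S.matA_mulVec_some, Finset.sum_mul]
  rw [Finset.sum_comm]
  refine Finset.sum_congr rfl fun e _ => ?_
  rw [← N.sum_sub_eq, Finset.mul_sum]
  simp only [ite_mul, zero_mul]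
  rw [← Finset.sum_filter]
  refine Finset.sum_congr ?_ fun _ _ => rfl
  ext
  simp

/-- The arcs of a cardinal basis connect any two nodes. -/
theorem exists_isPath_of_isCardinalBasis {B : Finset (Option P.Edge)}
    (hB : IsCardinalBasis S.matA B) (u w : U) :
    ∃ p, ArcPath.IsPath N.src N.tgt u p w ∧ ∀ s ∈ p, some s.1 ∈ B := by
  classical
  apply ArcPath.exists_isPath (Q := fun e => some e ∈ B)
  set R : U → U → Prop := fun u v => ∃ s : P.Edge × Bool, some s.1 ∈ B ∧
    ArcPath.stepStart N.src N.tgt s = u ∧ ArcPath.stepEnd N.src N.tgt s = v with hR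
  -- The indicator of the connected component of `w`. It does not change along the arcs of `B`.
  set φ : U → ℝ := fun u => if Relation.ReflTransGen R u w then 1 else 0 with hφ
  have hφe : ∀ e, some e ∈ B → φ (N.tgt e) - φ (N.src e) = 0 := by
    intro e he
    have h1 : R (N.src e) (N.tgt e) := ⟨(e, true), he, by simp [ArcPath.stepStart, ArcPath.stepEnd]⟩
    have h2 : R (N.tgt e) (N.src e) := ⟨(e, false), he, by simp [ArcPath.stepStart, ArcPath.stepEnd]⟩
    have : Relation.ReflTransGen R (N.src e) w ↔ Relation.ReflTransGen R (N.tgt e) w :=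
      ⟨fun h => h.head h2, fun h => h.head h1⟩
    simp [hφ, this]
  -- The columns of `B` span the unit vector of `f`, so `φ` cannot change along `f` either, and the
  -- component is everything.
  have hφf : ∀ f, φ (N.T.head f) = φ (N.T.tail f) := by
    intro f
    obtain ⟨z, hz, hz'⟩ := hB.exists_eq (Pi.single (some f) 1)
    have h := S.sum_mulVec_mul z φ
    rw [hz, Finset.sum_eq_single f, Finset.sum_eq_zero] at h
    · simpa [sub_eq_zero] using h
    · intro e _
      by_cases he : some e ∈ B
      · rw [hφe e he, mul_zero]
      · rw [hz' _ he, zero_mul]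
    · intro i _ hi
      simp [hi]
    · simp
  have := N.T.eq_of_forall_arc φ hφf u w
  simp only [hφ] at this
  rw [if_pos Relation.ReflTransGen.refl] at this
  by_contra hn
  rw [if_neg hn] at this
  norm_num at this

/-- The signed steps of a path express the column of any arc with the same ends. -/
theorem isBasicSolution_signs {B : Finset (Option P.Edge)} {e : P.Edge}
    {p : List (P.Edge × Bool)} (hp : ArcPath.IsPath N.src N.tgt (N.src e) p (N.tgt e))
    (hpB : ∀ s ∈ p, some s.1 ∈ B) :
    IsBasicSolution S.matA (fun i => S.matA i (some e)) B (signs p) := by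
  constructor
  · ext i
    cases i with
    | none => rw [S.matA_mulVec_none]; rfl
    | some i =>
      rw [S.matA_mulVec_some, S.matA_some_some, ← S.potential_tgt_sub_src, ← hp.1.sum_sub,
        ← sum_signs_mul hp.arcs_nodup (fun e => N.T.potential i (N.tgt e) - N.T.potential i (N.src e))]
      refine Finset.sum_congr rfl fun e' _ => ?_
      rw [S.potential_tgt_sub_src]
      simp
  · intro j hj
    cases j with
    | none => rfl
    | some a =>
      have h : ∀ b, (a, b) ∉ p := fun b h => hj (hpB _ h)
      simp [signs, h]

theorem none_mem_of_isExtremePoint {B : Finset (Option P.Edge)} {x : Option P.Edge → ℝ}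
    (h : IsExtremePoint S.matA S.vecb B x) : none ∈ B := by
  by_contra hn
  have h1 := congr_fun h.2.1.1 none
  rw [S.matA_mulVec_none, h.2.1.2 _ hn] at h1
  simp [vecb] at h1

theorem le_one_of_nonneg {x : Option P.Edge → ℝ} (h : S.matA *ᵥ x = S.vecb)
    (h0 : ∀ j, 0 ≤ x j) (e : P.Edge) : x (some e) ≤ 1 := by
  have h1 := congr_fun h (some (N.top e))
  rw [S.matA_mulVec_some] at h1
  rw [show (1 : ℝ) = S.vecb (some (N.top e)) from rfl, ← h1]
  have := Finset.single_le_sum (f := fun e' : P.Edge => if N.top e ∈ e'.1 then x (some e') else 0)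
    (fun e' _ => by split_ifs; exacts [h0 _, le_rfl]) (Finset.mem_univ e)
  simpa [N.top_mem e] using this

/-- Extreme points are integral. -/
theorem eq_zero_or_one_of_isExtremePoint {B : Finset (Option P.Edge)} {x : Option P.Edge → ℝ}
    (h : IsExtremePoint S.matA S.vecb B x) (e : P.Edge) : x (some e) = 0 ∨ x (some e) = 1 := by
  choose p hp hpB using fun i : V => S.exists_isPath_of_isCardinalBasis h.1
    (N.src (P.single i)) (N.tgt (P.single i))
  have hint : ∀ (q : List (P.Edge × Bool)) (a : P.Edge), ∃ k : ℤ, signs q (some a) = k := by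
    intro q a
    rw [signs_some]
    split_ifs
    exacts [⟨1, by simp⟩, ⟨-1, by simp⟩, ⟨0, by simp⟩]
  -- The right-hand side is the sum of the unit vectors, which are column `none` and the singleton
  -- columns. Each singleton column has coordinates in {-1, 0, 1}, so `x` is integral.
  have hb : IsBasicSolution S.matA S.vecb B (Pi.single none 1 + ∑ i, signs (p i)) := by
    constructor
    · rw [mulVec_add, mulVec_sum]
      ext i
      rw [Pi.add_apply, Finset.sum_apply, Finset.sum_congr rfl
        fun k _ => congr_fun (S.isBasicSolution_signs (hp k) (hpB k)).1 i]
      cases i with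
      | none => simp [S.matA_mulVec_none, vecb, matA]
      | some i =>
        simp [S.matA_mulVec_some, S.matA_some_some, vecb, HypergraphicPreferenceSystem.single]
    · intro j hj
      have hjn : j ≠ none := fun hjn => hj (hjn ▸ S.none_mem_of_isExtremePoint h)
      simp only [Pi.add_apply, Finset.sum_apply, Pi.single_apply, if_neg hjn, zero_add]
      exact Finset.sum_eq_zero fun i _ => (S.isBasicSolution_signs (hp i) (hpB i)).2 j hj
  rw [h.2.1.unique h.1 hb]
  have h0 : 0 ≤ x (some e) := h.2.2 _
  have h1 : x (some e) ≤ 1 := S.le_one_of_nonneg h.2.1.1 h.2.2 e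
  rw [h.2.1.unique h.1 hb] at h0 h1
  choose k hk using fun i => hint (p i) e
  simp only [Pi.add_apply, Finset.sum_apply, hk, Pi.single_apply, reduceCtorEq, if_false,
    zero_add] at h0 h1 ⊢
  have h0' : (0 : ℤ) ≤ ∑ i, k i := by exact_mod_cast h0
  have h1' : ∑ i, k i ≤ (1 : ℤ) := by exact_mod_cast h1
  have : ∑ i, k i = 0 ∨ ∑ i, k i = 1 := by omega
  rcases this with h | h
  · left; exact_mod_cast h
  · right; exact_mod_cast h

/-! ### The first-forward-arc-leaving rule is a pivoting rule -/

/-- Both sign vectors are the coordinates of the same column in the basis. -/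
theorem isPath_unique {B : Finset (Option P.Edge)} (hB : IsCardinalBasis S.matA B) {e : P.Edge}
    {p p' : List (P.Edge × Bool)} (hp : ArcPath.IsPath N.src N.tgt (N.src e) p (N.tgt e))
    (hpB : ∀ s ∈ p, some s.1 ∈ B) (hp' : ArcPath.IsPath N.src N.tgt (N.src e) p' (N.tgt e))
    (hpB' : ∀ s ∈ p', some s.1 ∈ B) : p = p' := by
  have h := (S.isBasicSolution_signs hp hpB).unique hB (S.isBasicSolution_signs hp' hpB')
  refine hp.eq_of_mem_iff hp' fun s => ?_
  rw [mem_iff_signs hp.arcs_nodup, mem_iff_signs hp'.arcs_nodup, h]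

theorem _root_.List.eq_of_append_cons_eq {α : Type*} {Q : α → Prop} {q r q' r' : List α} {a a' : α}
    (h : q ++ a :: r = q' ++ a' :: r') (hq : ∀ s ∈ q, ¬ Q s) (ha : Q a)
    (hq' : ∀ s ∈ q', ¬ Q s) (ha' : Q a') : a = a' := by
  induction q generalizing q' with
  | nil =>
    cases q' with
    | nil => exact (List.cons.inj h).1
    | cons b q' => exact absurd ((List.cons.inj h).1 ▸ ha) (hq' b (by simp))
  | cons b q ih =>
    cases q' with
    | nil => exact absurd ((List.cons.inj h).1 ▸ ha') (hq b (by simp))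
    | cons b' q' =>
      exact ih (List.cons.inj h).2 (fun s hs => hq s (by simp [hs]))
        fun s hs => hq' s (by simp [hs])

theorem _root_.List.exists_eq_append_cons {α : Type*} {Q : α → Prop} {l : List α}
    (h : ∃ s ∈ l, Q s) : ∃ q a r, l = q ++ a :: r ∧ Q a ∧ ∀ s ∈ q, ¬ Q s := by
  induction l with
  | nil => simp at h
  | cons b l ih =>
    by_cases hb : Q b
    · exact ⟨[], b, l, rfl, hb, by simp⟩
    · obtain ⟨s, hs, hQ⟩ := h
      obtain ⟨q, a, r, rfl, ha, hq⟩ := ih ⟨s, (List.mem_cons.1 hs).resolve_left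
        fun h => hb (h ▸ hQ), hQ⟩
      refine ⟨b :: q, a, r, rfl, ha, fun s hs => ?_⟩
      rcases List.mem_cons.1 hs with rfl | hs
      exacts [hb, hq s hs]

/-- The path is unique, and on it the two clauses of the rule exclude each other: a forward arc
cannot have both values 0 and 1. -/
theorem isFFLLeaving_unique {B : Finset (Option P.Edge)} {x : Option P.Edge → ℝ}
    (h : IsExtremePoint S.matA S.vecb B x) {jt jl jl' : Option P.Edge}
    (hl : IsFFLLeaving N x B jt jl) (hl' : IsFFLLeaving N x B jt jl') : jl = jl' := by
  obtain ⟨e, a, p, q, r, rfl, rfl, hp, hpB, rfl, hx⟩ := hl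
  obtain ⟨e', a', p', q', r', he, rfl, hp', hpB', rfl, hx'⟩ := hl'
  obtain rfl := Option.some_injective _ he
  have heq := S.isPath_unique h.1 hp hpB hp' hpB'
  rcases hx with ⟨h1, h2⟩ | ⟨h1, h2⟩ <;> rcases hx' with ⟨h1', h2'⟩ | ⟨h1', h2'⟩
  · have := List.eq_of_append_cons_eq (Q := fun s => s.2 = true ∧ x (some s.1) = 0) heq
      (fun s hs hQ => h2 s hs hQ.1 hQ.2) ⟨rfl, h1⟩
      (fun s hs hQ => h2' s hs hQ.1 hQ.2) ⟨rfl, h1'⟩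
    rw [(Prod.mk.inj this).1]
  · have := h1' (a, true) (heq ▸ by simp) rfl
    rw [h1] at this
    norm_num at this
  · have := h1 (a', true) (heq.symm ▸ by simp) rfl
    rw [h1'] at this
    norm_num at this
  · have := List.eq_of_append_cons_eq (Q := fun s => s.2 = true) heq
      (fun s hs hQ => by simp [h2 s hs] at hQ) rfl
      (fun s hs hQ => by simp [h2' s hs] at hQ) rfl
    rw [(Prod.mk.inj this).1]

theorem exists_isFFLLeaving {B : Finset (Option P.Edge)} {x : Option P.Edge → ℝ}
    (h : IsExtremePoint S.matA S.vecb B x) {jt : Option P.Edge} (hjt : jt ∉ B) :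
    ∃ jl, IsFFLLeaving N x B jt jl := by
  cases jt with
  | none => exact absurd (S.none_mem_of_isExtremePoint h) hjt
  | some e =>
    obtain ⟨p, hp, hpB⟩ := S.exists_isPath_of_isCardinalBasis h.1 (N.src e) (N.tgt e)
    -- In the row of the first arc of `e` the signed path has to add up to 1, and backward steps
    -- contribute at most 0.
    have hfwd : ∃ s ∈ p, s.2 = true := by
      by_contra! hn
      have h1 := congr_fun (S.isBasicSolution_signs hp hpB).1 (some (N.top e))
      rw [S.matA_mulVec_some, S.matA_some_some, if_pos (N.top_mem e)] at h1
      have h2 : ∑ e' : P.Edge, (if N.top e ∈ e'.1 then signs p (some e') else 0) ≤ 0 := by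
        refine Finset.sum_nonpos fun e' _ => ?_
        have : (e', true) ∉ p := fun h => hn _ h rfl
        rw [signs_some, if_neg this]
        split_ifs <;> norm_num
      linarith
    by_cases hz : ∃ s ∈ p, s.2 = true ∧ x (some s.1) = 0
    · obtain ⟨q, ⟨a, b⟩, r, rfl, ⟨hb, ha⟩, hq⟩ := List.exists_eq_append_cons hz
      obtain rfl : b = true := hb
      exact ⟨some a, e, a, _, q, r, rfl, rfl, hp, hpB, rfl,
        Or.inl ⟨ha, fun s hs h1 h2 => hq s hs ⟨h1, h2⟩⟩⟩
    · obtain ⟨q, ⟨a, b⟩, r, rfl, hb, hq⟩ := List.exists_eq_append_cons hfwd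
      obtain rfl : b = true := hb
      refine ⟨some a, e, a, _, q, r, rfl, rfl, hp, hpB, rfl, Or.inr ⟨fun s hs hs' => ?_, ?_⟩⟩
      · exact (S.eq_zero_or_one_of_isExtremePoint h s.1).resolve_left fun h0 =>
          hz ⟨s, hs, hs', h0⟩
      · intro s hs
        simpa using hq s hs

/-- The positive coordinates are those of the forward arcs, and they equal 1, so the ratios are the
values of `x`. The chosen arc has value 0, or else all forward arcs tie at 1. -/
theorem isLeavingCandidate_of_isFFLLeaving {B : Finset (Option P.Edge)} {x : Option P.Edge → ℝ}
    (h : IsExtremePoint S.matA S.vecb B x) {jt jl : Option P.Edge}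
    (hl : IsFFLLeaving N x B jt jl) : IsLeavingCandidate S.matA S.vecb B jt jl := by
  obtain ⟨e, a, p, q, r, rfl, rfl, hp, hpB, hpq, hx⟩ := hl
  have ha : (a, true) ∈ p := by rw [hpq]; simp
  have ha1 : signs p (some a) = 1 := by simpa using signs_of_mem hp.arcs_nodup ha
  refine ⟨hpB _ ha, x, signs p, h, S.isBasicSolution_signs hp hpB, by rw [ha1]; norm_num,
    fun j _ hj' => ?_⟩
  cases j with
  | none => simp [signs] at hj'
  | some b =>
    have hb : (b, true) ∈ p := by
      by_contra hn
      rw [signs_some] at hj'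
      rw [if_neg hn] at hj'
      split_ifs at hj' <;> norm_num at hj'
    have hb1 : signs p (some b) = 1 := by simpa using signs_of_mem hp.arcs_nodup hb
    rw [ha1, hb1, div_one, div_one]
    rcases hx with ⟨h1, -⟩ | ⟨h1, -⟩
    · rw [h1]; exact h.2.2 _
    · exact (h1 _ ha rfl).le.trans (h1 _ hb rfl).ge

open scoped Classical in
/-- The first-forward-arc-leaving rule. -/
noncomputable def fflRule (S : BlockPartition N) (B : Finset (Option P.Edge))
    (jt : Option P.Edge) : Option P.Edge :=
  if h : ∃ jl x, IsExtremePoint S.matA S.vecb B x ∧ IsFFLLeaving N x B jt jl then h.choose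
  else none

theorem isFFLRule_fflRule : S.IsFFLRule S.fflRule := by
  intro B x jt hx hjt jl
  obtain ⟨jl', hjl'⟩ := S.exists_isFFLLeaving hx hjt
  have hex : ∃ jl x, IsExtremePoint S.matA S.vecb B x ∧ IsFFLLeaving N x B jt jl :=
    ⟨jl', x, hx, hjl'⟩
  have hρ : IsFFLLeaving N x B jt (S.fflRule B jt) := by
    obtain ⟨x', hx', h⟩ := hex.choose_spec
    rw [hx.unique hx', fflRule, dif_pos hex]
    exact h
  exact ⟨fun h => S.isFFLLeaving_unique hx h hρ, fun h => h ▸ hρ⟩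

theorem IsFFLRule.isPivotingRule {S : BlockPartition N}
    {ρ : Finset (Option P.Edge) → Option P.Edge → Option P.Edge} (hρ : S.IsFFLRule ρ) :
    IsPivotingRule S.matA S.vecb ρ := by
  rintro B jt ⟨x, hx⟩ hjt
  exact S.isLeavingCandidate_of_isFFLLeaving hx ((hρ B x jt hx hjt _).2 rfl)

end BlockPartition

end ArborescenceNetwork

/-! ### Ranks in the preference lists. -/

namespace HypergraphicPreferenceSystem

variable {V : Type*} {P : HypergraphicPreferenceSystem V}

theorem mem_single {i k : V} : k ∈ (P.single i).1 ↔ k = i := by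
  simp [single]

theorem single_injective : Function.Injective P.single := fun i k h => by
  simpa [single] using congr_arg Subtype.val h

theorem numBetter_lt_degree {i : V} {e : P.Edge} (h : i ∈ e.1) : P.numBetter i e < P.degree i := by
  classical
  refine Finset.card_lt_card (Finset.ssubset_iff_of_subset ?_ |>.2 ⟨e, by simpa using h, ?_⟩)
  · intro e'
    simp only [Finset.mem_filter_univ]
    exact fun h => h.1
  · simp [h, P.pref_irrefl i e h]

theorem numBetter_lt_numBetter {i : V} {e e' : P.Edge} (h : i ∈ e.1) (h' : i ∈ e'.1)
    (hp : P.pref i e e') : P.numBetter i e < P.numBetter i e' := by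
  classical
  refine Finset.card_lt_card (Finset.ssubset_iff_of_subset ?_ |>.2 ⟨e, ?_, ?_⟩)
  · intro e''
    simp only [Finset.mem_filter_univ]
    exact fun h'' => ⟨h''.1, P.pref_trans i _ _ _ h''.1 h h' h''.2 hp⟩
  · simp [h, hp]
  · simp [h, P.pref_irrefl i e h]

theorem numBetter_lt_iff {i : V} {e e' : P.Edge} (h : i ∈ e.1) (h' : i ∈ e'.1) :
    P.numBetter i e < P.numBetter i e' ↔ P.pref i e e' := by
  refine ⟨fun hlt => ?_, numBetter_lt_numBetter h h'⟩
  by_cases he : e = e'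
  · subst he
    exact absurd hlt (lt_irrefl _)
  · exact (P.pref_total i e e' h h' he).resolve_right fun hp =>
      absurd hlt (numBetter_lt_numBetter h' h hp).not_gt

theorem numBetter_inj {i : V} {e e' : P.Edge} (h : i ∈ e.1) (h' : i ∈ e'.1)
    (hn : P.numBetter i e = P.numBetter i e') : e = e' := by
  by_contra he
  rcases P.pref_total i e e' h h' he with hp | hp
  · exact absurd hn (numBetter_lt_numBetter h h' hp).ne
  · exact absurd hn (numBetter_lt_numBetter h' h hp).ne'

theorem numBetter_single (i : V) : P.numBetter i (P.single i) + 1 = P.degree i := by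
  classical
  unfold numBetter degree
  have h : (Finset.univ.filter fun e : P.Edge => i ∈ e.1) =
      insert (P.single i)
        (Finset.univ.filter fun e' : P.Edge => i ∈ e'.1 ∧ P.pref i e' (P.single i)) := by
    ext e
    simp only [Finset.mem_filter_univ, Finset.mem_insert]
    constructor
    · intro h
      by_cases he : e = P.single i
      · exact Or.inl he
      · exact Or.inr ⟨h, P.singleton_worst i e h fun h' => he (Subtype.ext h')⟩
    · rintro (rfl | h)
      exacts [mem_single.2 rfl, h.1]
  rw [h, Finset.card_insert_of_notMem]
  simp only [Finset.mem_filter_univ, not_and]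
  exact fun h => P.pref_irrefl i _ h

end HypergraphicPreferenceSystem

namespace Scarf

variable {ι κ : Type*} [Fintype ι] [Fintype κ]

theorem utility_eq {C : Matrix ι κ ℝ} {O : Finset κ} {i : ι} {j : κ} (hj : j ∈ O)
    (h : ∀ k ∈ O, C i j ≤ C i k) : utility C O i = C i j := by
  refine IsLeast.csInf_eq ⟨⟨j, hj, rfl⟩, ?_⟩
  rintro _ ⟨k, hk, rfl⟩
  exact h k hk

end Scarf

/-! ### Bases with one hyperedge for each first arc, and a single iteration. -/

namespace ArborescenceNetwork

open Matrix Scarf HypergraphicPreferenceSystem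

variable {V U : Type*} [Fintype V] [DecidableEq V] {P : HypergraphicPreferenceSystem V}
  {N : ArborescenceNetwork P U}

/-- The columns `d i`. -/
def columns (d : V → P.Edge) : Finset (Option P.Edge) := Finset.univ.image fun i => some (d i)

/-- The columns `d i` together with the additional column. -/
def basisOf (d : V → P.Edge) : Finset (Option P.Edge) := insert none (columns d)

theorem mem_columns {d : V → P.Edge} {j : Option P.Edge} :
    j ∈ columns d ↔ ∃ i, some (d i) = j := by simp [columns]

theorem some_mem_basisOf {d : V → P.Edge} {e : P.Edge} :
    some e ∈ basisOf d ↔ ∃ i, d i = e := by simp [basisOf, columns]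

theorem mem_basisOf {d : V → P.Edge} {j : Option P.Edge} :
    j ∈ basisOf d ↔ j = none ∨ ∃ i, some (d i) = j := by simp [basisOf, columns]

namespace BlockPartition

variable (S : BlockPartition N)

/-! ### Triangular bases -/

theorem injective_of_top {d : V → P.Edge} (hd : ∀ i, N.top (d i) = i) : Function.Injective d :=
  fun i k h => by rw [← hd i, h, hd k]

theorem matA_mulVec_of_support {d : V → P.Edge} (hd : Function.Injective d)
    {z : Option P.Edge → ℝ} (hz : ∀ j, j ∉ basisOf d → z j = 0) (i : V) :
    (S.matA *ᵥ z) (some i) = ∑ k, if i ∈ (d k).1 then z (some (d k)) else 0 := by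
  rw [S.matA_mulVec_some, ← Finset.sum_image (s := Finset.univ) (g := d)
    (f := fun e : P.Edge => if i ∈ e.1 then z (some e) else 0) fun _ _ _ _ h => hd h]
  refine (Finset.sum_subset (Finset.subset_univ _) fun e _ he => ?_).symm
  have : z (some e) = 0 := hz _ fun h => he (by simpa using some_mem_basisOf.1 h)
  simp [this]

/-- A column `d k` with `k ≠ i` meets row `i` only if `σ i < σ k`. So the matrix is triangular with
unit diagonal, and substitution starts at the largest position. -/
theorem isCardinalBasis_basisOf {d : V → P.Edge} (hd : ∀ i, N.top (d i) = i) :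
    IsCardinalBasis S.matA (basisOf d) := by
  have hinj := injective_of_top hd
  refine isCardinalBasis_of_eq_zero ?_ fun z hz hA => ?_
  · rw [basisOf, Finset.card_insert_of_notMem (by simp [columns]), columns,
      Finset.card_image_of_injective (f := fun i => some (d i)) _
        ((Option.some_injective _).comp hinj), Fintype.card_option,
      Finset.card_univ]
  · have h0 : z none = 0 := by rw [← S.matA_mulVec_none z, hA]; rfl
    have hi : ∀ c (i : V), S.σ i = c → z (some (d i)) = 0 := by
      intro c
      induction c using WellFoundedGT.induction with
      | ind c ih =>
        rintro i rfl
        have h := congr_fun hA (some i)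
        rw [S.matA_mulVec_of_support hinj hz, Finset.sum_eq_single i] at h
        · simpa [show i ∈ (d i).1 by simpa [hd] using N.top_mem (d i)] using h
        · intro k _ hk
          split_ifs with hik
          · have := S.σ_lt_top hik (by rw [hd]; exact hk.symm)
            rw [hd] at this
            exact ih _ this k rfl
          · rfl
        · simp
    ext j
    by_cases hj : j ∈ basisOf d
    · rcases mem_basisOf.1 hj with rfl | ⟨i, rfl⟩
      exacts [h0, hi _ i rfl]
    · exact hz j hj

/-- A triangular basis is feasible. -/
theorem exists_isExtremePoint_basisOf {d : V → P.Edge} (hd : ∀ i, N.top (d i) = i) :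
    ∃ x, IsExtremePoint S.matA S.vecb (basisOf d) x := by
  have hinj := injective_of_top hd
  have hB := S.isCardinalBasis_basisOf hd
  obtain ⟨x, hx⟩ := hB.exists_eq S.vecb
  have hrow : ∀ i, ∑ k, (if i ∈ (d k).1 then x (some (d k)) else 0) = 1 := by
    intro i
    rw [← S.matA_mulVec_of_support hinj hx.2, hx.1]
    rfl
  have hmem : ∀ i, i ∈ (d i).1 := fun i => by simpa [hd] using N.top_mem (d i)
  have hlt : ∀ {i k}, i ∈ (d k).1 → k ≠ i → S.σ i < S.σ k := by
    intro i k hik hne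
    have := S.σ_lt_top hik (by rw [hd]; exact hne.symm)
    rwa [hd] at this
  have hi : ∀ c (i : V), S.σ i = c → 0 ≤ x (some (d i)) := by
    intro c
    induction c using WellFoundedGT.induction with
    | ind c ih =>
      rintro i rfl
      have h := hrow i
      rw [← Finset.add_sum_erase _ _ (Finset.mem_univ i), if_pos (hmem i)] at h
      suffices hs : ∑ k ∈ Finset.univ.erase i, (if i ∈ (d k).1 then x (some (d k)) else 0) ≤ 1 by
        linarith
      by_cases hk : ∃ k, k ≠ i ∧ i ∈ (d k).1
      -- Here `k` is the lowest first arc, other than `i`, of a column through `i`. All columns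
      -- through `i` except `d i` contain `k` (`top_mem_of_mem`), so their sum is at most that of
      -- row `k`, whose other terms are nonnegative by induction.
      · obtain ⟨k, ⟨hk, hik⟩, hmin⟩ := Set.Finite.exists_minimalFor S.σ
          {k | k ≠ i ∧ i ∈ (d k).1} (Set.toFinite _) hk
        rw [← hrow k]
        have h1 : ∀ k' ∈ Finset.univ.erase i, (if i ∈ (d k').1 then x (some (d k')) else 0) ≤
            if k ∈ (d k').1 then x (some (d k')) else 0 := by
          intro k' hk'
          have hk'i : k' ≠ i := (Finset.mem_erase.1 hk').1
          by_cases hik' : i ∈ (d k').1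
          · have hle : S.σ k ≤ S.σ k' := by
              by_contra! hlt'
              exact absurd (hmin ⟨hk'i, hik'⟩ hlt'.le) (not_le.2 hlt')
            have := S.top_mem_of_mem hik hik' (by rwa [hd, hd])
            rw [hd] at this
            rw [if_pos hik', if_pos this]
          · rw [if_neg hik']
            split_ifs with hkk'
            · refine ih _ ?_ k' rfl
              refine lt_of_lt_of_le (hlt hik hk) ?_
              have := S.σ_le_top hkk'
              rwa [hd] at this
            · exact le_rfl
        refine (Finset.sum_le_sum h1).trans (le_of_eq ?_)
        rw [← Finset.add_sum_erase Finset.univ _ (Finset.mem_univ i), if_neg, zero_add]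
        exact fun hki => absurd (hlt hki hk.symm) (hlt hik hk).not_gt
      · rw [Finset.sum_eq_zero]
        · exact zero_le_one
        · intro k hk'
          rw [if_neg]
          exact fun hik => hk ⟨k, (Finset.mem_erase.1 hk').1, hik⟩
  refine ⟨x, hB, hx, fun j => ?_⟩
  by_cases hj : j ∈ basisOf d
  · rcases mem_basisOf.1 hj with rfl | ⟨i, rfl⟩
    · rw [← S.matA_mulVec_none x, hx.1]
      exact zero_le_one
    · exact hi _ i rfl
  · rw [hx.2 j hj]

/-- If the arcs at and after the first arc of `e` are unmatched so far, then the singleton of this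
arc leaves when `e` enters. -/
theorem isFFLLeaving_single {d : V → P.Edge} (hd : ∀ i, N.top (d i) = i) {e : P.Edge}
    (hs : ∀ i, S.σ (N.top e) ≤ S.σ i → d i = P.single i) (he : e ≠ P.single (N.top e))
    {x : Option P.Edge → ℝ} (hx : IsExtremePoint S.matA S.vecb (basisOf d) x) :
    IsFFLLeaving N x (basisOf d) (some e) (some (d (N.top e))) := by
  have hinj := injective_of_top hd
  set i := N.top e with hi
  obtain ⟨p, hp, hpB⟩ := S.exists_isPath_of_isCardinalBasis hx.1 (N.src e) (N.tgt e)
  have hy := S.isBasicSolution_signs hp hpB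
  -- Row `i` meets only the column `d i`: any other `d k` through `i` has `σ i < σ k` and would be a
  -- singleton.
  have hyi : signs p (some (d i)) = 1 := by
    have h := congr_fun hy.1 (some i)
    rw [S.matA_mulVec_of_support hinj hy.2, S.matA_some_some, if_pos (N.top_mem e),
      Finset.sum_eq_single i] at h
    · rwa [if_pos] at h
      rw [hs i le_rfl]
      exact mem_single.2 rfl
    · intro k _ hk
      rw [if_neg]
      intro hik
      have := S.σ_lt_top hik (by rw [hd]; exact hk.symm)
      rw [hd] at this
      rw [hs k this.le, mem_single] at hik
      exact hk hik.symm
    · simp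
  have hmem : (d i, true) ∈ p := by rw [mem_iff_signs hp.arcs_nodup, hyi]; rfl
  -- The arc of the singleton has the tail `src e`, where the path starts, so it is the first step.
  obtain ⟨r, hr⟩ := hp.eq_cons_of_stepStart hmem
    (by rw [← N.tail_top e, ← hi]; simp [ArcPath.stepStart, ← N.tail_top, hd])
  refine ⟨e, d i, p, [], r, rfl, rfl, hp, hpB, hr, ?_⟩
  rcases S.eq_zero_or_one_of_isExtremePoint hx (d i) with h0 | h1
  · exact Or.inl ⟨h0, by simp⟩
  · refine Or.inr ⟨fun s hs' hs2 => ?_, by simp⟩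
    have hed : ∀ k, d k ≠ e := by
      rintro k rfl
      rw [hd] at hi
      exact he (by rw [hi]; exact hs k (by rw [hi]))
    -- Exchanging `d i` for `e` gives another triangular basis. Because `d i` has value 1, its
    -- extreme point is `x` minus the signs of the path plus the unit vector of `e`; nonnegativity
    -- forces the value 1 on every forward arc.
    set d' := Function.update d i e with hd'
    have hd't : ∀ k, N.top (d' k) = k := by
      intro k
      by_cases hk : k = i
      · subst hk; simp [hd', ← hi]
      · simp [hd', hk, hd]
    obtain ⟨x', hx'⟩ := S.exists_isExtremePoint_basisOf hd't
    have hz : IsBasicSolution S.matA S.vecb (basisOf d')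
        (x - signs p + Pi.single (some e) 1) := by
      constructor
      · rw [mulVec_add, mulVec_sub, hx.2.1.1, hy.1]
        ext k
        simp
      · intro j hj
        have hje : j ≠ some e := by
          rintro rfl
          exact hj (some_mem_basisOf.2 ⟨i, by simp [hd']⟩)
        rw [Pi.add_apply, Pi.sub_apply, Pi.single_eq_of_ne hje, add_zero]
        by_cases hjB : j ∈ basisOf d
        · rcases mem_basisOf.1 hjB with rfl | ⟨k, rfl⟩
          · exact absurd (Finset.mem_insert_self _ _) hj
          · have hk : k = i := by
              by_contra hk
              exact hj (some_mem_basisOf.2 ⟨k, by simp [hd', hk]⟩)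
            rw [hk, h1, hyi, sub_self]
        · rw [hx.2.1.2 j hjB, hy.2 j hjB, sub_self]
    have h2 : 0 ≤ x' (some s.1) := hx'.2.2 _
    have hse : s.1 ≠ e := by
      obtain ⟨k, hk⟩ := some_mem_basisOf.1 (hpB s hs')
      rw [← hk]
      exact hed k
    rw [hx'.2.1.unique hx'.1 hz, Pi.add_apply, Pi.sub_apply, signs_of_mem hp.arcs_nodup hs',
      if_pos hs2, Pi.single_eq_of_ne (by simpa using hse)] at h2
    have h3 : x (some s.1) ≤ 1 := S.le_one_of_nonneg hx.2.1.1 hx.2.2 _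
    linarith

/-! ### The entries of the ordinal matrix -/

theorem C_lt_iff {i : V} {e e' : P.Edge} (h : i ∈ e.1) (h' : i ∈ e'.1) :
    S.C i e' < S.C i e ↔ P.pref i e e' := by
  rw [← numBetter_lt_iff h h', S.C_incident i e h, S.C_incident i e' h', sub_lt_sub_iff_left,
    add_lt_add_iff_right, Nat.cast_lt]

theorem C_lt_degree {i : V} {e : P.Edge} (h : i ∈ e.1) : S.C i e < P.degree i := by
  rw [S.C_incident i e h]
  have : (0 : ℝ) ≤ P.numBetter i e := Nat.cast_nonneg _
  linarith

theorem C_lt_of_mem_of_notMem {i : V} {e e' : P.Edge} (h : i ∈ e.1) (h' : i ∉ e'.1) :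
    S.C i e < S.C i e' :=
  (S.C_lt_degree h).trans_le (S.C_other_ge i e' h')

theorem C_single (i : V) : S.C i (P.single i) = 0 := by
  rw [S.C_incident i _ (mem_single.2 rfl), ← numBetter_single i]
  push_cast
  ring

theorem C_nonneg (i : V) (e : P.Edge) : 0 ≤ S.C i e := by
  by_cases h : i ∈ e.1
  · rw [S.C_incident i e h, sub_nonneg]
    exact_mod_cast numBetter_lt_degree h
  · exact (Nat.cast_nonneg _).trans (S.C_other_ge i e h)

theorem C_single_lt_iff {i : V} {e : P.Edge} : S.C i (P.single i) < S.C i e ↔ e ≠ P.single i := by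
  refine ⟨fun h he => lt_irrefl _ (he ▸ h), fun h => ?_⟩
  by_cases hi : i ∈ e.1
  · rw [S.C_lt_iff hi (mem_single.2 rfl)]
    exact P.singleton_worst i e hi fun h' => h (Subtype.ext h')
  · exact S.C_lt_of_mem_of_notMem (mem_single.2 rfl) hi

/-! ### One iteration -/

/-- Every vertex strictly prefers `e` to its current utility. -/
def Acceptable (d : V → P.Edge) (e : P.Edge) : Prop := ∀ i, S.C i (d i) < S.C i e

/-- The column that enters in the ordinal pivot: the first acceptable hyperedge, or the
additional column if there is none. -/
def IsNext (d : V → P.Edge) (j : Option P.Edge) : Prop :=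
  (j = none ∧ ∀ e, ¬ S.Acceptable d e) ∨
    ∃ e, j = some e ∧ S.Acceptable d e ∧ ∀ e', S.Acceptable d e' → S.pos e ≤ S.pos e'

theorem IsNext.unique {d : V → P.Edge} {j j' : Option P.Edge} (h : S.IsNext d j)
    (h' : S.IsNext d j') : j = j' := by
  rcases h with ⟨rfl, h⟩ | ⟨e, rfl, he, h⟩ <;> rcases h' with ⟨rfl, h'⟩ | ⟨e', rfl, he', h'⟩
  · rfl
  · exact absurd he' (h _)
  · exact absurd he (h' _)
  · rw [S.pos.injective (le_antisymm (h _ he') (h' _ he))]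

/-- The hyperedge `d i` is the worst one for `i`. -/
def IsSeparated (d : V → P.Edge) : Prop := ∀ i k, k ≠ i → S.C i (d i) < S.C i (d k)

theorem utility_columns {d : V → P.Edge} (h : S.IsSeparated d) (i : V) :
    utility S.matC (columns d) (some i) = S.C i (d i) := by
  refine utility_eq (C := S.matC) (j := some (d i)) (mem_columns.2 ⟨i, rfl⟩) fun j hj => ?_
  obtain ⟨k, rfl⟩ := mem_columns.1 hj
  by_cases hk : k = i
  · rw [hk]
  · exact (h i k hk).le

theorem utility_insert_some {d : V → P.Edge} (h : S.IsSeparated d) {j : Option P.Edge}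
    (hj : ∀ i, S.C i (d i) ≤ S.matC (some i) j) (i : V) :
    utility S.matC (insert j (columns d)) (some i) = S.C i (d i) := by
  refine utility_eq (C := S.matC) (j := some (d i))
    (Finset.mem_insert_of_mem (mem_columns.2 ⟨i, rfl⟩)) fun j' hj' => ?_
  rcases Finset.mem_insert.1 hj' with rfl | hj'
  · exact hj i
  · obtain ⟨k, rfl⟩ := mem_columns.1 hj'
    by_cases hk : k = i
    · rw [hk]
    · exact (h i k hk).le

theorem matC_none_lt_iff {e e' : P.Edge} :
    S.matC none (some e) < S.matC none (some e') ↔ S.pos e' < S.pos e := by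
  simp [matC]

theorem matC_none_pos (e : P.Edge) : 0 < S.matC none (some e) := by
  simp [matC]

/-- The iterations from the pair of bases given by `d` and the entering hyperedge `e`. -/
theorem isIteration_iff {ρ : Finset (Option P.Edge) → Option P.Edge → Option P.Edge}
    (hρ : S.IsFFLRule ρ) {d : V → P.Edge} (hd : ∀ i, N.top (d i) = i) (hsep : S.IsSeparated d)
    {e : P.Edge} (hacc : S.Acceptable d e) (hpos : ∀ i, S.pos (d i) < S.pos e)
    (hs : ∀ i, S.σ (N.top e) ≤ S.σ i → d i = P.single i) {js : Option P.Edge}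
    (hjs : S.IsNext (Function.update d (N.top e) e) js) (B' O' : Finset (Option P.Edge)) :
    IsIteration S.matC ρ (basisOf d) (insert (some e) (columns d)) B' O' ↔
      B' = basisOf (Function.update d (N.top e) e) ∧
        O' = insert js (columns (Function.update d (N.top e) e)) := by
  have hinj := injective_of_top hd
  set i₀ := N.top e with hi₀
  set d' := Function.update d i₀ e with hd'
  have hdi : d' i₀ = e := by simp [hd']
  have hdk : ∀ k, k ≠ i₀ → d' k = d k := fun k hk => by simp [hd', hk]
  have hed : ∀ k, d k ≠ e := fun k hk => lt_irrefl _ (hk ▸ hpos k)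
  have he : e ≠ P.single i₀ := fun h => hed i₀ ((hs i₀ le_rfl).trans h.symm)
  -- No utility decreases, so a hyperedge held before the pivot is not acceptable after it.
  have hle : ∀ k, S.C k (d k) ≤ S.C k (d' k) := by
    intro k
    by_cases hk : k = i₀
    · rw [hk, hdi]; exact (hacc i₀).le
    · rw [hdk k hk]
  -- In row `i₀`, a hyperedge `d k` through `i₀` would have a higher first arc and thus be a
  -- singleton; so the other columns have non-incident, large entries. In the other rows it suffices
  -- that `e` is acceptable.
  have hsep' : S.IsSeparated d' := by
    intro i k hki
    by_cases hi : i = i₀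
    · subst hi
      rw [hdi, hdk k hki]
      refine S.C_lt_of_mem_of_notMem (N.top_mem e) fun hik => ?_
      have := S.σ_lt_top hik (by rw [hd]; exact hki.symm)
      rw [hd] at this
      rw [hs k this.le, mem_single] at hik
      exact hki hik.symm
    · rw [hdk i hi]
      by_cases hk : k = i₀
      · rw [hk, hdi]; exact hacc i
      · rw [hdk k hk]; exact hsep i k hki
  have hρe : ρ (basisOf d) (some e) = some (d i₀) := by
    obtain ⟨x, hx⟩ := S.exists_isExtremePoint_basisOf hd
    have heB : some e ∉ basisOf d := fun h => by
      obtain ⟨k, hk⟩ := some_mem_basisOf.1 h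
      exact hed k hk
    exact ((hρ _ x _ hx heB _).1 (S.isFFLLeaving_single hd hs he hx)).symm
  have hOB : insert (some e) (columns d) \ basisOf d = {some e} := by
    ext j
    simp only [Finset.mem_sdiff, Finset.mem_insert, mem_columns, mem_basisOf,
      Finset.mem_singleton]
    constructor
    · tauto
    · rintro rfl
      simp [hed]
  have hB' : insert (some e) ((basisOf d).erase (some (d i₀))) = basisOf d' := by
    ext j
    simp only [Finset.mem_insert, Finset.mem_erase, mem_basisOf]
    constructor
    · rintro (rfl | ⟨h1, rfl | ⟨k, rfl⟩⟩)
      · exact Or.inr ⟨i₀, by rw [hdi]⟩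
      · exact Or.inl rfl
      · exact Or.inr ⟨k, by rw [hdk k]; rintro rfl; exact h1 rfl⟩
    · rintro (rfl | ⟨k, rfl⟩)
      · simp
      · by_cases hk : k = i₀
        · left; rw [hk, hdi]
        · right
          rw [hdk k hk]
          exact ⟨fun h => hk (hinj (Option.some_injective _ h)), Or.inr ⟨k, rfl⟩⟩
  have hO' : (insert (some e) (columns d)).erase (some (d i₀)) = columns d' := by
    ext j
    simp only [Finset.mem_insert, Finset.mem_erase, mem_columns]
    constructor
    · rintro ⟨h1, rfl | ⟨k, rfl⟩⟩
      · exact ⟨i₀, by rw [hdi]⟩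
      · exact ⟨k, by rw [hdk k]; rintro rfl; exact h1 rfl⟩
    · rintro ⟨k, rfl⟩
      by_cases hk : k = i₀
      · rw [hk, hdi]
        exact ⟨fun h => hed i₀ (Option.some_injective _ h).symm, Or.inl rfl⟩
      · rw [hdk k hk]
        exact ⟨fun h => hk (hinj (Option.some_injective _ h)), Or.inr ⟨k, rfl⟩⟩
  have hOB' : insert (some e) (columns d) \ basisOf d' = {some (d i₀)} := by
    ext j
    simp only [Finset.mem_sdiff, Finset.mem_insert, mem_columns, mem_basisOf,
      Finset.mem_singleton, not_or, not_exists]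
    constructor
    · rintro ⟨rfl | ⟨k, rfl⟩, -, h⟩
      · exact absurd (by rw [hdi]) (h i₀)
      · by_cases hk : k = i₀
        · rw [hk]
        · exact absurd (by rw [hdk k hk]) (h k)
    · rintro rfl
      refine ⟨Or.inr ⟨_, rfl⟩, by simp, fun k hk => ?_⟩
      have hk := Option.some_injective _ hk
      by_cases hki : k = i₀
      · rw [hki, hdi] at hk; exact hed _ hk.symm
      · rw [hdk k hki] at hk; exact hki (hinj hk)
  have hu : ∀ i, utility S.matC (insert (some e) (columns d)) (some i) = S.C i (d i) :=
    S.utility_insert_some hsep fun i => (hacc i).le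
  have hu0 : utility S.matC (insert (some e) (columns d)) none = S.matC none (some e) := by
    refine utility_eq (Finset.mem_insert_self _ _) fun j hj => ?_
    rcases Finset.mem_insert.1 hj with rfl | hj
    · exact le_rfl
    · obtain ⟨k, rfl⟩ := mem_columns.1 hj
      exact (S.matC_none_lt_iff.2 (hpos k)).le
  have hu' : ∀ i, utility S.matC (columns d') (some i) = S.C i (d' i) := S.utility_columns hsep'
  -- Column `none` always qualifies, because `M` exceeds every utility. It has the smallest entry of
  -- row `none`, so it enters only if no hyperedge is acceptable.
  have hcand : ∀ k, k ∈ ordinalCandidates S.matC (insert (some e) (columns d)) (some (d i₀)) none ↔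
      k = none ∨ ∃ e', k = some e' ∧ S.Acceptable d' e' := by
    intro k
    simp only [ordinalCandidates, hO', Set.mem_ofPred_eq]
    cases k with
    | none =>
      refine iff_of_true ⟨by simp [columns], fun i hi => ?_⟩ (Or.inl rfl)
      obtain ⟨i, rfl⟩ := Option.ne_none_iff_exists'.1 hi
      rw [hu']
      exact S.lt_M _ _
    | some e' =>
      constructor
      · rintro ⟨-, h⟩
        refine Or.inr ⟨e', rfl, fun i => ?_⟩
        have := h (some i) (by simp)
        rwa [hu'] at this
      · rintro (h | ⟨e'', h, hacc'⟩)
        · simp at h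
        · obtain rfl := Option.some_injective _ h
          refine ⟨fun hm => ?_, fun i hi => ?_⟩
          · rcases Finset.mem_insert.1 hm with h | h
            · have := hacc' i₀
              rw [Option.some_injective _ h, hdi] at this
              exact lt_irrefl _ this
            · obtain ⟨k, hk⟩ := mem_columns.1 h
              have := hacc' k
              rw [← Option.some_injective _ hk] at this
              exact absurd (hle k) (not_le.2 this)
          · obtain ⟨i, rfl⟩ := Option.ne_none_iff_exists'.1 hi
            rw [hu']
            exact hacc' i
  constructor
  · rintro ⟨jt, jl, h1, h2, h3, il, ir, jr, js', h4, h5, h6, h7, h8, h9⟩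
    obtain rfl := Finset.singleton_injective (h1.symm.trans hOB)
    rw [hρe, hB'] at h2
    subst h2
    obtain rfl := Finset.singleton_injective (h3.symm.trans hOB')
    refine ⟨rfl, ?_⟩
    rw [hO'] at h9 h5
    have hil : il = some i₀ := by
      have h := h4.2
      cases il with
      | none =>
        rw [hu0] at h
        exact absurd h (S.matC_none_lt_iff.2 (hpos i₀)).ne
      | some i =>
        rw [hu] at h
        by_contra hne
        exact absurd h (hsep i i₀ fun h => hne (by rw [h])).ne
    subst hil
    have hjr : jr = some e := by
      obtain ⟨hm, h⟩ := h5
      obtain ⟨k, rfl⟩ := mem_columns.1 hm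
      rw [hu'] at h
      by_cases hk : k = i₀
      · rw [hk, hdi]
      · exact absurd h (hsep' i₀ k hk).ne
    subst hjr
    -- Being acceptable, `e` lies strictly above the old utility in every row of `V`, so only row
    -- `none` dislikes it. Maximizing row `none` then means taking the leftmost candidate.
    have hir : ir = none := by
      have h := h6.2
      cases ir with
      | none => rfl
      | some i =>
        rw [hu] at h
        exact absurd h (hacc i).ne
    subst hir
    rw [h9]
    congr 1
    refine IsNext.unique S ?_ hjs
    rcases (hcand js').1 h7 with rfl | ⟨e', rfl, he'⟩
    · refine Or.inl ⟨rfl, fun e' he' => ?_⟩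
      exact absurd (h8 _ ((hcand _).2 (Or.inr ⟨e', rfl, he'⟩)))
        (not_le.2 (S.matC_none_pos e'))
    · refine Or.inr ⟨e', rfl, he', fun e'' he'' => ?_⟩
      by_contra! hlt
      exact absurd (h8 _ ((hcand _).2 (Or.inr ⟨e'', rfl, he''⟩)))
        (not_le.2 (S.matC_none_lt_iff.2 hlt))
  · rintro ⟨rfl, rfl⟩
    refine ⟨some e, some (d i₀), hOB, by rw [hρe, hB'], hOB', some i₀, none, some e, js,
      ⟨Finset.mem_insert_of_mem (mem_columns.2 ⟨_, rfl⟩), hu i₀⟩, ?_,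
      ⟨Finset.mem_insert_self _ _, hu0⟩, ?_, ?_, by rw [hO']⟩
    · rw [hO', hu', hdi]
      exact ⟨mem_columns.2 ⟨i₀, by rw [hdi]⟩, rfl⟩
    · rcases hjs with ⟨rfl, -⟩ | ⟨e', rfl, he', -⟩
      exacts [(hcand _).2 (Or.inl rfl), (hcand _).2 (Or.inr ⟨e', rfl, he'⟩)]
    · intro k hk
      rcases (hcand k).1 hk with rfl | ⟨e'', rfl, he''⟩
      · rcases hjs with ⟨rfl, -⟩ | ⟨e', rfl, -, -⟩
        exacts [le_rfl, (S.matC_none_pos e').le]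
      · rcases hjs with ⟨rfl, hjs⟩ | ⟨e', rfl, -, hjs⟩
        · exact absurd he'' (hjs _)
        · exact not_lt.1 fun hlt => absurd (S.matC_none_lt_iff.1 hlt) (not_lt.2 (hjs _ he''))

end BlockPartition

end ArborescenceNetwork

/-! ### The greedy assignment and the run that it predicts. -/

namespace ArborescenceNetwork

open Matrix Scarf HypergraphicPreferenceSystem

variable {V U : Type*} [Fintype V] [DecidableEq V] {P : HypergraphicPreferenceSystem V}
  {N : ArborescenceNetwork P U}

/-- `D i` is the hyperedge that `i` likes best among the hyperedges `e` with first arc `i` that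
every other vertex `k` of `e` prefers to `D k`. -/
structure IsGreedy (N : ArborescenceNetwork P U) (D : V → P.Edge) : Prop where
  top : ∀ i, N.top (D i) = i
  pref : ∀ i, ∀ k ∈ (D i).1, k ≠ i → P.pref k (D i) (D k)
  best : ∀ e : P.Edge, (∀ k ∈ e.1, k ≠ N.top e → P.pref k e (D k)) →
    ¬ P.pref (N.top e) e (D (N.top e))

namespace BlockPartition

variable (S : BlockPartition N)

/-- The condition on a hyperedge with first arc `i` involves `D` only at lower arcs, so `D` can be
chosen by induction on the position. The singleton is always eligible. -/
theorem exists_isGreedy (S : BlockPartition N) : ∃ D, IsGreedy N D := by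
  have key : ∀ c : ℕ, ∃ D : V → P.Edge, (∀ i, N.top (D i) = i) ∧
      ∀ i, (S.σ i).val < c → (∀ k ∈ (D i).1, k ≠ i → P.pref k (D i) (D k)) ∧
        ∀ e : P.Edge, N.top e = i → (∀ k ∈ e.1, k ≠ i → P.pref k e (D k)) →
          ¬ P.pref i e (D i) := by
    intro c
    induction c with
    | zero => exact ⟨P.single, N.top_single, by simp⟩
    | succ c ih =>
      obtain ⟨D, hD, h⟩ := ih
      by_cases hc : ∃ i, (S.σ i).val = c
      · obtain ⟨i, hi⟩ := hc
        obtain ⟨e, ⟨he, he'⟩, hmin⟩ := Set.Finite.exists_minimalFor (P.numBetter i)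
          {e : P.Edge | N.top e = i ∧ ∀ k ∈ e.1, k ≠ i → P.pref k e (D k)} (Set.toFinite _)
          ⟨P.single i, N.top_single i, fun k hk hki => absurd (mem_single.1 hk) hki⟩
        have hupd : ∀ k, k ≠ i → Function.update D i e k = D k := fun k hk => by simp [hk]
        -- The conditions at positions up to `c` do not see the value that is changed at `i`.
        have hne : ∀ i' (e' : P.Edge), (S.σ i').val ≤ c → N.top e' = i' → ∀ k ∈ e'.1, k ≠ i' →
            k ≠ i := by
          rintro i' e' hi' ht k hk hki rfl
          have := S.σ_lt_top hk (by rw [ht]; exact hki)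
          rw [ht, Fin.lt_def] at this
          omega
        refine ⟨Function.update D i e, fun k => ?_, fun i' hi' => ?_⟩
        · by_cases hk : k = i
          · rw [hk, Function.update_self, he]
          · rw [hupd k hk, hD]
        · have hle : (S.σ i').val ≤ c := by omega
          by_cases hii : i' = i
          · subst hii
            rw [Function.update_self]
            refine ⟨fun k hk hki => ?_, fun e'' ht hp hlt => ?_⟩
            · rw [hupd k hki]
              exact he' k hk hki
            · have hm : i' ∈ e.1 := by rw [← he]; exact N.top_mem e
              have hm' : i' ∈ e''.1 := by rw [← ht]; exact N.top_mem e''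
              have hlt' := numBetter_lt_numBetter hm' hm hlt
              refine absurd (hmin ⟨ht, fun k hk hki => ?_⟩ hlt'.le) (not_le.2 hlt')
              rw [← hupd k hki]
              exact hp k hk hki
          · have hlt : (S.σ i').val < c := by
              refine lt_of_le_of_ne hle fun h => hii (S.σ.injective (Fin.ext (h.trans hi.symm)))
            rw [hupd i' hii]
            refine ⟨fun k hk hki => ?_, fun e'' ht hp => (h i' hlt).2 e'' ht fun k hk hki => ?_⟩
            · rw [hupd k (hne i' _ hle (hD i') k hk hki)]
              exact (h i' hlt).1 k hk hki
            · rw [← hupd k (hne i' _ hle ht k hk hki)]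
              exact hp k hk hki
      · refine ⟨D, hD, fun i hi => h i ?_⟩
        exact lt_of_le_of_ne (by omega) fun hi' => hc ⟨i, hi'⟩
  obtain ⟨D, hD, h⟩ := key (Fintype.card V)
  exact ⟨D, hD, fun i => (h i (S.σ i).2).1, fun e => (h _ (S.σ _).2).2 e rfl⟩

/-- The hyperedges held after the blocks before position `c` have been treated. -/
def stage (S : BlockPartition N) (D : V → P.Edge) (c : ℕ) (i : V) : P.Edge :=
  if (S.σ i).val < c then D i else P.single i

/-- The block at position `j` contributes a column. -/
def Active (S : BlockPartition N) (D : V → P.Edge) (j : ℕ) : Prop :=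
  ∃ i, (S.σ i).val = j ∧ D i ≠ P.single i

/-- The column of the vertex at position `j`. -/
def columnAt (S : BlockPartition N) (D : V → P.Edge) (j : ℕ) : Option P.Edge :=
  if h : j < Fintype.card V then some (D (S.σ.symm ⟨j, h⟩)) else none

variable {S} {D : V → P.Edge}

theorem columnAt_σ (i : V) : S.columnAt D (S.σ i).val = some (D i) := by
  simp [columnAt]

theorem stage_of_lt {c : ℕ} {i : V} (h : (S.σ i).val < c) : S.stage D c i = D i := if_pos h

theorem stage_of_le {c : ℕ} {i : V} (h : c ≤ (S.σ i).val) : S.stage D c i = P.single i :=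
  if_neg (not_lt.2 h)

theorem Active.lt {j : ℕ} (h : S.Active D j) : j < Fintype.card V := by
  obtain ⟨i, rfl, -⟩ := h
  exact (S.σ i).2

theorem pos_lt_iff {e : P.Edge} : (S.pos e).val < Fintype.card V ↔ ∃ i, e = P.single i := by
  constructor
  · intro h
    refine ⟨S.σ.symm ⟨_, h⟩, S.pos.injective (Fin.ext ?_)⟩
    rw [S.pos_single, Equiv.apply_symm_apply]
  · rintro ⟨i, rfl⟩
    rw [S.pos_single]
    exact (S.σ i).2

theorem ne_single_iff {e : P.Edge} : e ≠ P.single (N.top e) ↔ Fintype.card V ≤ (S.pos e).val := by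
  rw [← not_lt, pos_lt_iff, not_iff_not]
  refine ⟨fun h => ⟨_, h⟩, ?_⟩
  rintro ⟨i, rfl⟩
  rw [N.top_single]

theorem top_stage (hD : IsGreedy N D) (c : ℕ) (i : V) : N.top (S.stage D c i) = i := by
  unfold stage
  split_ifs
  exacts [hD.top i, N.top_single i]

/-- If `i` lies on the hyperedge of `k ≠ i`, then this is not a singleton, so `k` has been treated,
and so has the lower arc `i`; then `D` respects the preference of `i`. Otherwise the entry is a
non-incident one. -/
theorem isSeparated_stage (hD : IsGreedy N D) (c : ℕ) : S.IsSeparated (S.stage D c) := by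
  intro i k hki
  have hi : i ∈ (S.stage D c i).1 := by
    have := N.top_mem (S.stage D c i)
    rwa [top_stage hD] at this
  by_cases hik : i ∈ (S.stage D c k).1
  · have hlt := S.σ_lt_top hik (by rw [top_stage hD]; exact hki.symm)
    rw [top_stage hD] at hlt
    by_cases hk : (S.σ k).val < c
    · rw [stage_of_lt hk] at hik ⊢
      rw [stage_of_lt (lt_trans hlt hk)] at hi ⊢
      rw [S.C_lt_iff hik hi]
      exact hD.pref k i hik hki.symm
    · rw [stage_of_le (not_lt.1 hk), mem_single] at hik
      exact absurd hik hki.symm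
  · exact S.C_lt_of_mem_of_notMem hi hik

theorem mem_self (hD : IsGreedy N D) (i : V) : i ∈ (D i).1 := by
  simpa [hD.top] using N.top_mem (D i)

theorem acceptable_stage (hD : IsGreedy N D) {i : V} (hi : D i ≠ P.single i) :
    S.Acceptable (S.stage D (S.σ i).val) (D i) := by
  intro k
  by_cases hk : k ∈ (D i).1
  · by_cases hki : k = i
    · subst hki
      rw [stage_of_le le_rfl, S.C_single_lt_iff]
      exact hi
    · have := S.σ_lt_top hk (by rw [hD.top]; exact hki)
      rw [hD.top] at this
      rw [stage_of_lt this, S.C_lt_iff hk (mem_self hD k)]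
      exact hD.pref i k hk hki
  · refine S.C_lt_of_mem_of_notMem ?_ hk
    simpa [top_stage hD] using N.top_mem (S.stage D (S.σ i).val k)

theorem Acceptable.ne_single {c : ℕ} {e : P.Edge}
    (h : S.Acceptable (S.stage D c) e) : e ≠ P.single (N.top e) := by
  rw [← S.C_single_lt_iff]
  refine lt_of_le_of_lt ?_ (h _)
  rw [S.C_single]
  exact S.C_nonneg _ _

/-- An acceptable hyperedge belongs to a block that has not been treated. -/
theorem Acceptable.le (hD : IsGreedy N D) {c : ℕ} {e : P.Edge}
    (h : S.Acceptable (S.stage D c) e) : c ≤ (S.σ (N.top e)).val := by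
  by_contra! hlt
  have hp : ∀ k ∈ e.1, P.pref k e (D k) := by
    intro k hk
    have hk' := h k
    have := S.σ_le_top hk
    rwa [stage_of_lt (lt_of_le_of_lt this hlt), S.C_lt_iff hk (mem_self hD k)] at hk'
  exact hD.best e (fun k hk _ => hp k hk) (hp _ (N.top_mem e))

/-- Acceptable hyperedges lie in blocks from `c` on. In block `c` an acceptable hyperedge is
eligible for the greedy choice, so `D i` comes first; later blocks stand to the right. Beyond the
last block nothing is acceptable. -/
theorem isNext_stage (hD : IsGreedy N D) {c : ℕ} (hc : S.Active D c ∨ c = Fintype.card V) :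
    S.IsNext (S.stage D c) (S.columnAt D c) := by
  rcases hc with ⟨i, rfl, hi⟩ | rfl
  · rw [columnAt_σ]
    refine Or.inr ⟨D i, rfl, acceptable_stage hD hi, fun e he => ?_⟩
    have hns := Acceptable.ne_single he
    have hb : InBlock S.σ i (D i) := by
      have := S.inBlock_top (e := D i) (by rwa [hD.top])
      rwa [hD.top] at this
    rcases (Acceptable.le hD he).lt_or_eq with hlt | heq
    · exact (S.pos_block _ _ _ _ hb (S.inBlock_top hns) hlt).le
    · have hit : i = N.top e := S.σ.injective (Fin.ext heq)
      by_cases hei : e = D i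
      · rw [hei]
      · have hm : i ∈ e.1 := hit ▸ N.top_mem e
        refine (S.pos_pref i _ _ hb (hit ▸ S.inBlock_top hns) ?_).le
        refine (P.pref_total i _ _ hm (mem_self hD i) hei).resolve_left fun hp => ?_
        refine hD.best e (fun k hk hkt => ?_) (hit ▸ hp)
        have hk' := he k
        have hlt := S.σ_lt_top hk hkt
        rw [← hit] at hlt
        rwa [stage_of_lt hlt, S.C_lt_iff hk (mem_self hD k)] at hk'
  · refine Or.inl ⟨by simp [columnAt], fun e he => ?_⟩
    exact absurd (Acceptable.le hD he) (not_le.2 (S.σ _).2)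

/-- This makes the entering column the strict minimum of row `none` in the ordinal basis. -/
theorem pos_stage_lt (hD : IsGreedy N D) {i : V} (hi : D i ≠ P.single i) (k : V) :
    S.pos (S.stage D (S.σ i).val k) < S.pos (D i) := by
  have hi' : D i ≠ P.single (N.top (D i)) := by rwa [hD.top]
  have hb := S.inBlock_top hi'
  by_cases hks : S.stage D (S.σ i).val k = P.single k
  · rw [hks]
    exact (pos_lt_iff.2 ⟨k, rfl⟩).trans_le (ne_single_iff.1 hi')
  · have hk : (S.σ k).val < (S.σ i).val := by
      by_contra! hle
      exact hks (stage_of_le hle)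
    have hb' := S.inBlock_top (e := S.stage D (S.σ i).val k) (by rwa [top_stage hD])
    exact S.pos_block _ _ _ _ hb' hb (by rw [top_stage hD, hD.top]; exact hk)

/-! ### The run -/

section Run

open scoped Classical in
/-- The number of iterations. -/
noncomputable def runLength (S : BlockPartition N) (D : V → P.Edge) : ℕ :=
  Nat.count (S.Active D) (Fintype.card V)

open scoped Classical in
/-- The position of the block from which the entering column of iteration `k` is taken. -/
noncomputable def runIndex (S : BlockPartition N) (D : V → P.Edge) (k : ℕ) : ℕ :=
  if k < S.runLength D then Nat.nth (S.Active D) k else Fintype.card V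

/-- The cardinal bases of the run. -/
noncomputable def runB (S : BlockPartition N) (D : V → P.Edge) (k : ℕ) : Finset (Option P.Edge) :=
  basisOf (S.stage D (S.runIndex D k))

/-- The ordinal bases of the run. -/
noncomputable def runO (S : BlockPartition N) (D : V → P.Edge) (k : ℕ) : Finset (Option P.Edge) :=
  insert (S.columnAt D (S.runIndex D k)) (columns (S.stage D (S.runIndex D k)))

/-- The index `|V|` encodes the end of the run: there `columnAt` is `none`, and the two bases
coincide. -/
theorem runIndex_runLength : S.runIndex D (S.runLength D) = Fintype.card V := if_neg (lt_irrefl _)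

open scoped Classical in
theorem runIndex_count {j : ℕ} (h : S.Active D j) :
    Nat.count (S.Active D) j < S.runLength D ∧
      S.runIndex D (Nat.count (S.Active D) j) = j := by
  have : Nat.count (S.Active D) j < S.runLength D := Nat.count_strict_mono h h.lt
  exact ⟨this, by rw [runIndex, if_pos this, Nat.nth_count h]⟩

open scoped Classical in
theorem active_runIndex {k : ℕ} (hk : k < S.runLength D) : S.Active D (S.runIndex D k) := by
  rw [runIndex, if_pos hk]
  refine Nat.nth_mem k fun hf => ?_
  refine lt_of_lt_of_le hk ?_
  rw [runLength, Nat.count_eq_card_filter_range]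
  refine Finset.card_le_card fun x hx => ?_
  simpa using (Finset.mem_filter.1 hx).2

open scoped Classical in
theorem count_runIndex {k : ℕ} (hk : k ≤ S.runLength D) :
    Nat.count (S.Active D) (S.runIndex D k) = k := by
  rcases hk.lt_or_eq with hk | rfl
  · rw [runIndex, if_pos hk]
    refine Nat.count_nth fun hf => ?_
    refine lt_of_lt_of_le hk ?_
    rw [runLength, Nat.count_eq_card_filter_range]
    refine Finset.card_le_card fun x hx => ?_
    simpa using (Finset.mem_filter.1 hx).2
  · rw [runIndex_runLength]
    rfl

open scoped Classical in
theorem runLength_le : S.runLength D ≤ Fintype.card V := Nat.count_le _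

theorem not_active_of_lt_runIndex_zero {j : ℕ} (h : j < S.runIndex D 0) : ¬ S.Active D j := by
  classical
  intro ha
  have h1 := Nat.count_strict_mono ha h
  rw [count_runIndex (Nat.zero_le _)] at h1
  exact absurd h1 (Nat.not_lt_zero _)

theorem not_active_between {k j : ℕ} (hk : k < S.runLength D) (h1 : S.runIndex D k < j)
    (h2 : j < S.runIndex D (k + 1)) : ¬ S.Active D j := by
  classical
  intro ha
  have h3 := Nat.count_strict_mono ha h2
  have h4 := Nat.count_strict_mono (active_runIndex hk) h1
  rw [count_runIndex hk] at h3
  rw [count_runIndex hk.le] at h4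
  omega

theorem runIndex_lt_succ {k : ℕ} (hk : k < S.runLength D) :
    S.runIndex D k < S.runIndex D (k + 1) := by
  classical
  by_contra! hle
  have := Nat.count_monotone (S.Active D) hle
  rw [count_runIndex hk, count_runIndex hk.le] at this
  omega

theorem eq_single_of_not_active {i : V} (h : ¬ S.Active D (S.σ i).val) : D i = P.single i := by
  by_contra hn
  exact h ⟨i, rfl, hn⟩

theorem stage_runIndex_zero : S.stage D (S.runIndex D 0) = P.single := by
  ext1 i
  by_cases h : (S.σ i).val < S.runIndex D 0
  · rw [stage_of_lt h, eq_single_of_not_active (not_active_of_lt_runIndex_zero h)]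
  · exact stage_of_le (not_lt.1 h)

/-- Strictly between two consecutive active positions `D` consists of singletons, so the stage
changes only at `i`. -/
theorem stage_runIndex_succ {k : ℕ} (hk : k < S.runLength D) {i : V}
    (hi : (S.σ i).val = S.runIndex D k) :
    S.stage D (S.runIndex D (k + 1)) = Function.update (S.stage D (S.runIndex D k)) i (D i) := by
  have hlt := runIndex_lt_succ hk
  ext1 l
  by_cases hl : l = i
  · subst hl
    rw [Function.update_self, stage_of_lt (hi ▸ hlt)]
  · rw [Function.update_of_ne hl]
    have hne : (S.σ l).val ≠ S.runIndex D k := fun h =>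
      hl (S.σ.injective (Fin.ext (h.trans hi.symm)))
    rcases lt_or_gt_of_ne hne with h | h
    · rw [stage_of_lt h, stage_of_lt (h.trans hlt)]
    · rw [stage_of_le h.le]
      by_cases h' : (S.σ l).val < S.runIndex D (k + 1)
      · rw [stage_of_lt h', eq_single_of_not_active (not_active_between hk h h')]
      · exact stage_of_le (not_lt.1 h')

theorem active_or_eq (S : BlockPartition N) (D : V → P.Edge) (k : ℕ) :
    S.Active D (S.runIndex D k) ∨ S.runIndex D k = Fintype.card V := by
  by_cases hk : k < S.runLength D
  · exact Or.inl (active_runIndex hk)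
  · exact Or.inr (if_neg hk)

theorem runB_zero : S.runB D 0 = S.initB := by
  ext j
  cases j with
  | none => simp [runB, basisOf, initB]
  | some e => simp [runB, stage_runIndex_zero, some_mem_basisOf, initB, pos_lt_iff, eq_comm]

theorem acceptable_single_iff {e : P.Edge} :
    S.Acceptable P.single e ↔ e ≠ P.single (N.top e) := by
  refine ⟨fun h => S.C_single_lt_iff.1 (h _), fun h i => S.C_single_lt_iff.2 ?_⟩
  rintro rfl
  exact h (by rw [N.top_single])

/-- Against the singletons every other hyperedge is acceptable, so the first entering column is the
one right after the singletons. If there is none, column `none` takes its place. -/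
theorem runO_zero (hD : IsGreedy N D) : S.runO D 0 = S.initO := by
  have hnext := isNext_stage hD (active_or_eq S D 0)
  rw [stage_runIndex_zero] at hnext
  rw [runO, stage_runIndex_zero, initO]
  split_ifs with hlt
  · obtain ⟨e, he⟩ : ∃ e, S.pos e = ⟨Fintype.card V, hlt⟩ := S.pos.surjective _
    have hacc : S.Acceptable P.single e := by
      rw [acceptable_single_iff, S.ne_single_iff, he]
    rcases hnext with ⟨-, h⟩ | ⟨e', h1, h2, h3⟩
    · exact absurd hacc (h e)
    · have h4 := S.ne_single_iff.1 (acceptable_single_iff.1 h2)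
      have h5 : (S.pos e').val ≤ Fintype.card V := by
        have := h3 e hacc
        rw [he] at this
        exact this
      obtain rfl : e' = e := S.pos.injective (Fin.ext (by rw [he]; exact le_antisymm h5 h4))
      rw [h1]
      ext j
      cases j with
      | none => simp [columns]
      | some a =>
        have h6 : a = e' ↔ (S.pos a).val = Fintype.card V := by
          rw [← S.pos.injective.eq_iff, he, Fin.ext_iff]
        have h7 := S.pos_lt_iff (e := a)
        have h8 : (S.pos a).val ≤ Fintype.card V ↔
            a = e' ∨ ∃ i, a = P.single i := by
          rw [← h7, h6, Nat.le_iff_lt_or_eq, or_comm]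
        simp [mem_columns, h8, eq_comm]
  · rcases hnext with ⟨h, -⟩ | ⟨e', -, h2, -⟩
    · rw [h]
      rw [← runB_zero (D := D), runB, stage_runIndex_zero, basisOf]
    · exact absurd (S.ne_single_iff.1 (acceptable_single_iff.1 h2))
        (not_le.2 ((S.pos e').2.trans_le (not_lt.1 hlt)))

theorem columnAt_runIndex {k : ℕ} (hk : k < S.runLength D) :
    ∃ i, (S.σ i).val = S.runIndex D k ∧ D i ≠ P.single i ∧
      S.columnAt D (S.runIndex D k) = some (D i) := by
  obtain ⟨i, hi, hi'⟩ := active_runIndex hk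
  exact ⟨i, hi, hi', by rw [← hi, columnAt_σ]⟩

/-- As an equivalence this gives both the existence of the run and its uniqueness. -/
theorem isIteration_run_iff {ρ : Finset (Option P.Edge) → Option P.Edge → Option P.Edge}
    (hρ : S.IsFFLRule ρ) (hD : IsGreedy N D) {k : ℕ} (hk : k < S.runLength D)
    (B' O' : Finset (Option P.Edge)) :
    IsIteration S.matC ρ (S.runB D k) (S.runO D k) B' O' ↔
      B' = S.runB D (k + 1) ∧ O' = S.runO D (k + 1) := by
  obtain ⟨i, hi, hi', hcol⟩ := columnAt_runIndex hk
  have hupd := stage_runIndex_succ hk hi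
  have htop := hD.top i
  rw [runB, runO, runB, runO, hcol, hupd]
  have hnext := isNext_stage hD (active_or_eq S D (k + 1))
  rw [hupd] at hnext
  have := S.isIteration_iff hρ (d := S.stage D (S.runIndex D k)) (e := D i)
    (js := S.columnAt D (S.runIndex D (k + 1))) (top_stage hD _) (isSeparated_stage hD _)
    (hi ▸ acceptable_stage hD hi') (hi ▸ pos_stage_lt hD hi')
    (fun l hl => stage_of_le (by rw [← hi]; rwa [htop] at hl)) (by rwa [htop]) B' O'
  rw [htop] at this
  exact this

theorem runB_ne_runO {k : ℕ} (hk : k < S.runLength D) :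
    S.runB D k ≠ S.runO D k := by
  obtain ⟨i, hi, hi', hcol⟩ := columnAt_runIndex hk
  intro h
  have : (none : Option P.Edge) ∈ S.runO D k := by
    rw [← h]
    exact Finset.mem_insert_self _ _
  rw [runO, hcol] at this
  simp [columns] at this

theorem runB_eq_runO : S.runB D (S.runLength D) = S.runO D (S.runLength D) := by
  rw [runB, runO, runIndex_runLength, columnAt, dif_neg (lt_irrefl _), basisOf]

theorem isRun_run {ρ : Finset (Option P.Edge) → Option P.Edge → Option P.Edge}
    (hρ : S.IsFFLRule ρ) (hD : IsGreedy N D) :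
    IsRun S.matC ρ S.initB S.initO (S.runLength D) (S.runB D) (S.runO D) :=
  ⟨runB_zero, runO_zero hD, fun _ hk =>
    ⟨runB_ne_runO hk, (isIteration_run_iff hρ hD hk _ _).2 ⟨rfl, rfl⟩⟩, runB_eq_runO⟩

/-- Each iteration is forced. The predicted bases differ before `runLength` and agree there, so a
run can stop neither earlier nor later. -/
theorem isRun_unique {ρ : Finset (Option P.Edge) → Option P.Edge → Option P.Edge}
    (hρ : S.IsFFLRule ρ) (hD : IsGreedy N D) {T : ℕ} {B O : ℕ → Finset (Option P.Edge)}
    (h : IsRun S.matC ρ S.initB S.initO T B O) :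
    T = S.runLength D ∧ B T = S.runB D (S.runLength D) := by
  obtain ⟨h0, h0', hstep, hT⟩ := h
  have key : ∀ k, k ≤ T → k ≤ S.runLength D → B k = S.runB D k ∧ O k = S.runO D k := by
    intro k
    induction k with
    | zero => exact fun _ _ => ⟨h0.trans runB_zero.symm, h0'.trans (runO_zero hD).symm⟩
    | succ k ih =>
      intro hk hk'
      obtain ⟨h1, h2⟩ := ih (by omega) (by omega)
      have := (hstep k (by omega)).2
      rw [h1, h2] at this
      exact (isIteration_run_iff hρ hD (by omega) _ _).1 this
  have hTeq : T = S.runLength D := by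
    rcases lt_trichotomy T (S.runLength D) with hlt | heq | hgt
    · obtain ⟨h1, h2⟩ := key T le_rfl hlt.le
      exact absurd (h1.symm.trans (hT.trans h2)) (runB_ne_runO hlt)
    · exact heq
    · obtain ⟨h1, h2⟩ := key _ hgt.le le_rfl
      exact absurd (h1.trans (runB_eq_runO.trans h2.symm)) (hstep _ hgt).1
  subst hTeq
  exact ⟨rfl, (key _ le_rfl le_rfl).1⟩

theorem runB_runLength : S.runB D (S.runLength D) = basisOf D := by
  rw [runB, runIndex_runLength]
  congr 1
  ext1 i
  exact stage_of_lt (S.σ i).2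

/-- At the end no hyperedge is acceptable, so each one is dominated in some row of `V`; column
`none` is dominated in row `none`. -/
theorem isDominatingBasis_basisOf (S : BlockPartition N) (hD : IsGreedy N D) :
    IsDominatingBasis S.matA S.vecb S.matC (basisOf D) := by
  refine ⟨S.exists_isExtremePoint_basisOf hD.top, (S.isCardinalBasis_basisOf hD.top).1, ?_⟩
  have hst : S.stage D (Fintype.card V) = D := by
    ext1 i
    exact stage_of_lt (S.σ i).2
  have hsep := isSeparated_stage (S := S) hD (Fintype.card V)
  have hnext := isNext_stage hD (Or.inr rfl : S.Active D (Fintype.card V) ∨ _)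
  rw [hst] at hsep hnext
  intro j
  cases j with
  | none =>
    refine ⟨none, le_of_eq ?_⟩
    symm
    refine utility_eq (Finset.mem_insert_self _ _) fun j _ => ?_
    cases j with
    | none => exact le_rfl
    | some e => exact (S.matC_none_pos e).le
  | some e =>
    rcases hnext with ⟨-, h⟩ | ⟨e', h, -⟩
    · have := h e
      unfold Acceptable at this
      push Not at this
      obtain ⟨i, hi⟩ := this
      refine ⟨some i, ?_⟩
      rw [basisOf, S.utility_insert_some hsep fun i => (S.lt_M _ _).le]
      exact hi
    · simp [columnAt] at h

/-- The extreme point of a dominating basis is a stable matching. -/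
theorem isStableMatching_of_isDominatingBasis {B : Finset (Option P.Edge)}
    (hB : IsDominatingBasis S.matA S.vecb S.matC B) {x : Option P.Edge → ℝ}
    (hx : IsExtremePoint S.matA S.vecb B x) : P.IsStableMatching fun e => x (some e) := by
  classical
  have h01 := S.eq_zero_or_one_of_isExtremePoint hx
  have hfin : ∀ i j, j ∈ B → utility S.matC B i ≤ S.matC i j := fun i j hj =>
    csInf_le ((B.finite_toSet.image _).bddBelow) ⟨j, hj, rfl⟩
  refine ⟨h01, fun e => ?_⟩
  obtain ⟨i, hi⟩ := hB.2.2 (some e)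
  cases i with
  | none =>
    have := hi.trans (hfin none none (S.none_mem_of_isExtremePoint hx))
    exact absurd this (not_le.2 (S.matC_none_pos e))
  | some i =>
    have hrow := congr_fun hx.2.1.1 (some i)
    rw [S.matA_mulVec_some] at hrow
    change _ = (1 : ℝ) at hrow
    have hworse : ∀ a : P.Edge, i ∈ a.1 → x (some a) ≠ 0 → S.C i e ≤ S.C i a := by
      intro a _ ha
      refine hi.trans (hfin (some i) (some a) ?_)
      by_contra hn
      exact ha (hx.2.1.2 _ hn)
    -- Row `i` contains a matched hyperedge through `i`. If `i` were not in `e`, the non-incident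
    -- entry of `e` would exceed the entry of that hyperedge.
    have hie : i ∈ e.1 := by
      by_contra hn
      obtain ⟨a, -, ha⟩ := Finset.exists_ne_zero_of_sum_ne_zero (hrow.trans_ne one_ne_zero)
      have hia : i ∈ a.1 := by
        by_contra hia
        simp [hia] at ha
      rw [if_pos hia] at ha
      exact absurd (hworse a hia ha) (not_le.2 (S.C_lt_of_mem_of_notMem hia hn))
    refine ⟨i, hie, ?_⟩
    rw [← hrow, Finset.sum_filter]
    refine Finset.sum_congr rfl fun a _ => ?_
    by_cases hia : i ∈ a.1
    · by_cases ha : x (some a) = 0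
      · simp [ha]
      · have h1 := hworse a hia ha
        rw [if_pos hia, if_pos]
        refine ⟨hia, ?_⟩
        by_cases hae : a = e
        · exact Or.inr hae
        · refine Or.inl ((P.pref_total i a e hia hie hae).resolve_right fun hp => ?_)
          exact absurd h1 (not_le.2 ((S.C_lt_iff hie hia).2 hp))
    · rw [if_neg hia, if_neg fun h => hia h.1]

end Run

end BlockPartition

end ArborescenceNetwork

/-! ### Depth-first orderings and block partitions from a linear order of the arcs. -/

theorem exists_equiv_fin_of_injective {α β : Type*} [Fintype α] [LinearOrder β] {key : α → β}
    (hkey : Function.Injective key) {m : ℕ} (hm : Fintype.card α = m) :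
    ∃ pos : α ≃ Fin m, ∀ a b, pos a < pos b ↔ key a < key b := by
  let _ : LinearOrder α := LinearOrder.lift' key hkey
  refine ⟨(monoEquivOfFin α hm).symm.toEquiv, fun a b => ?_⟩
  exact (monoEquivOfFin α hm).symm.lt_iff_lt

namespace Arborescence

variable {U V : Type*} [Fintype U] [Fintype V] (T : Arborescence U V)

/-- Every node is the root or the head of exactly one arc. -/
theorem bijective_elim_head : Function.Bijective fun o : Option V => o.elim T.root T.head := by
  classical
  have hsurj : Function.Surjective fun o : Option V => o.elim T.root T.head := by
    intro w
    by_cases hw : T.root = w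
    · exact ⟨none, hw⟩
    · obtain ⟨l, hl⟩ := T.directed w
      obtain ⟨a, -, ha, -⟩ := hl.1.exists_last hw
      exact ⟨some a, ha⟩
  -- The arcs inject into the edges of a tree, of which there are `|U| - 1`. Hence `|V| + 1 ≤ |U|`,
  -- and the surjection gives the other inequality.
  refine (Fintype.bijective_iff_surjective_and_card _).2 ⟨hsurj, ?_⟩
  refine le_antisymm ?_ (Fintype.card_le_of_surjective _ hsurj)
  rw [Fintype.card_option, ← T.isTree.card_edgeFinset, add_le_add_iff_right]
  rw [← Finset.card_univ]
  refine Finset.card_le_card_of_injOn (fun f => s(T.tail f, T.head f)) (fun f _ => ?_)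
    fun f _ g _ h => T.arcs_injective h
  simp only [SimpleGraph.coe_edgeFinset, SimpleGraph.mem_edgeSet, SimpleGraph.fromRel_adj]
  exact ⟨T.tail_ne_head f, Or.inl ⟨f, rfl, rfl⟩⟩

theorem head_injective : Function.Injective T.head := fun f g h =>
  Option.some_injective _ (T.bijective_elim_head.1 (a₁ := some f) (a₂ := some g) h)

theorem root_ne_head (f : V) : T.root ≠ T.head f := fun h => by
  have := T.bijective_elim_head.1 (a₁ := none) (a₂ := some f) h
  simp at this

theorem eq_root_or_exists_head (u : U) : u = T.root ∨ ∃ f, T.head f = u := by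
  obtain ⟨o, rfl⟩ := T.bijective_elim_head.2 u
  cases o with
  | none => exact Or.inl rfl
  | some f => exact Or.inr ⟨f, rfl⟩

/-- Among any non-empty set of arcs there is one without predecessor. -/
theorem exists_first_arc {X : Set V} (hX : X.Nonempty) :
    ∃ f ∈ X, ∀ g ∈ X, T.head g ≠ T.tail f := by
  obtain ⟨f, hf⟩ := hX
  obtain ⟨l, hl, -⟩ := T.directed (T.head f)
  -- Follow the path from the root to the head of `f`: its first arc in `X` will do, since no arc of
  -- `X` ends at the current node before that.
  have key : ∀ (l : List V) (u : U),
      ArcPath.IsWalk T.tail T.head u (l.map fun a => (a, true)) (T.head f) →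
      (∀ g ∈ X, T.head g ≠ u) → ∃ f ∈ X, ∀ g ∈ X, T.head g ≠ T.tail f := by
    intro l
    induction l with
    | nil =>
      intro u hu hX
      exact absurd (Eq.symm hu) (hX f hf)
    | cons a l ih =>
      intro u hu hX
      obtain ⟨h1, h2⟩ := ArcPath.isWalk_forward_cons.1 hu
      by_cases ha : a ∈ X
      · exact ⟨a, ha, h1.symm ▸ hX⟩
      · refine ih _ h2 fun g hg hga => ha ?_
        rwa [← T.head_injective hga]
  exact key l _ hl fun g _ h => T.root_ne_head g h.symm

end Arborescence

namespace ArborescenceNetwork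

open HypergraphicPreferenceSystem

variable {V U : Type*} [Fintype V] [Fintype U] [DecidableEq V]
  {P : HypergraphicPreferenceSystem V} {N : ArborescenceNetwork P U}

theorem top_eq_of_inBlock {σ : V ≃ Fin (Fintype.card V)}
    (hσ : ∀ f g, N.T.head g = N.T.tail f → σ f < σ g) {i : V} {e : P.Edge}
    (h : InBlock σ i e) : N.top e = i := by
  by_contra hne
  obtain ⟨a, ha, ha'⟩ := N.exists_pred_of_ne_top h.1 (Ne.symm hne)
  exact absurd (h.2.1 a ha) (not_le.2 (hσ _ _ ha'))

/-- It suffices that every arc comes before the arc that enters its tail; the root receives the last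
number. This is all that the program has to ensure. -/
theorem exists_blockPartition (σ : V ≃ Fin (Fintype.card V))
    (hσ : ∀ f g, N.T.head g = N.T.tail f → σ f < σ g) : ∃ S : BlockPartition N, S.σ = σ := by
  classical
  let ν : U ≃ Fin (Fintype.card V + 1) :=
    (Equiv.ofBijective _ N.T.bijective_elim_head).symm.trans
      ((Equiv.optionCongr σ).trans finSuccEquivLast.symm)
  have hν : ∀ f, ν (N.T.head f) = (σ f).castSucc := by
    intro f
    have : (Equiv.ofBijective _ N.T.bijective_elim_head).symm (N.T.head f) = some f := by
      rw [Equiv.symm_apply_eq]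
      rfl
    simp [ν, this]
  have hνr : ν N.T.root = Fin.last _ := by
    have : (Equiv.ofBijective _ N.T.bijective_elim_head).symm N.T.root = none := by
      rw [Equiv.symm_apply_eq]
      rfl
    simp [ν, this]
  have hνle : ∀ f, ν (N.T.head f) ≤ ν (N.T.tail f) := by
    intro f
    rcases N.T.eq_root_or_exists_head (N.T.tail f) with h | ⟨g, hg⟩
    · rw [h, hνr]
      exact Fin.le_last _
    · rw [← hg, hν, hν]
      exact Fin.castSucc_le_castSucc_iff.2 (hσ f g hg).le
  have hwalk : ∀ (l : List V) (u w u' : U),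
      ArcPath.IsWalk N.T.tail N.T.head u (l.map fun a => (a, true)) w →
      u' ∈ ArcPath.vertices N.T.tail N.T.head u (l.map fun a => (a, true)) → ν w ≤ ν u' := by
    intro l
    have hle : ∀ (l : List V) (u w : U),
        ArcPath.IsWalk N.T.tail N.T.head u (l.map fun a => (a, true)) w → ν w ≤ ν u := by
      intro l
      induction l with
      | nil => rintro u w ⟨⟩; exact le_rfl
      | cons a l ih =>
        intro u w h
        obtain ⟨h1, h2⟩ := ArcPath.isWalk_forward_cons.1 h
        exact (ih _ _ h2).trans (h1 ▸ hνle a)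
    induction l with
    | nil =>
      intro u w u' h hu
      have : u' = u := by simpa [ArcPath.vertices] using hu
      rw [this]
      exact hle _ _ _ h
    | cons a l ih =>
      intro u w u' h hu
      rcases List.mem_cons.1 hu with rfl | hu
      · exact hle _ _ _ h
      · exact ih _ _ _ (ArcPath.isWalk_forward_cons.1 h).2 hu
  -- Lexicographic sort: singletons first, then by block, then by the rank in the list of the first
  -- arc.
  let key : P.Edge → ℕ ×ₗ ℕ ×ₗ ℕ := fun e =>
    if e = P.single (N.top e) then toLex (0, toLex ((σ (N.top e)).val, 0))
    else toLex (1, toLex ((σ (N.top e)).val, P.numBetter (N.top e) e))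
  have hkey_single : ∀ i, key (P.single i) = toLex (0, toLex ((σ i).val, 0)) := fun i => by
    simp [key, N.top_single]
  have hkey_other : ∀ e, e ≠ P.single (N.top e) →
      key e = toLex (1, toLex ((σ (N.top e)).val, P.numBetter (N.top e) e)) :=
    fun e he => if_neg he
  have hinj : Function.Injective key := by
    intro e e' h
    by_cases he : e = P.single (N.top e) <;> by_cases he' : e' = P.single (N.top e')
    · rw [he, he', hkey_single, hkey_single] at h
      have : σ (N.top e) = σ (N.top e') := Fin.ext (by simpa using h)
      rw [he, he', σ.injective this]
    · rw [he, hkey_single, hkey_other e' he'] at h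
      simp at h
    · rw [he', hkey_single, hkey_other e he] at h
      simp at h
    · rw [hkey_other e he, hkey_other e' he'] at h
      have h1 : (σ (N.top e)).val = (σ (N.top e')).val ∧
        P.numBetter (N.top e) e = P.numBetter (N.top e') e' := by simpa using h
      have h2 : N.top e = N.top e' := σ.injective (Fin.ext h1.1)
      rw [h2] at h1
      exact numBetter_inj (h2 ▸ N.top_mem e) (N.top_mem e') h1.2
  obtain ⟨pos, hpos⟩ := exists_equiv_fin_of_injective hinj (Fintype.card_coe P.edges)
  have hblock : ∀ {i e}, InBlock σ i e →
      key e = toLex (1, toLex ((σ i).val, P.numBetter i e)) := by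
    intro i e h
    have ht := top_eq_of_inBlock hσ h
    rw [hkey_other e, ht]
    rw [ht]
    rintro rfl
    exact h.2.2 rfl
  -- The columns before `{i}` are exactly the singletons of the smaller arcs, so the two positions
  -- agree by counting.
  have hsingle : ∀ i, (pos (P.single i)).val = (σ i).val := by
    intro i
    rw [← Fin.card_Iio (pos (P.single i)), ← Fin.card_Iio (σ i)]
    symm
    refine Finset.card_bij (fun j _ => pos (P.single (σ.symm j))) ?_ ?_ ?_
    · intro j hj
      rw [Finset.mem_Iio] at hj ⊢
      rw [hpos, hkey_single, hkey_single]
      simpa [Prod.Lex.toLex_lt_toLex] using hj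
    · intro j _ j' _ h
      exact σ.symm.injective (single_injective (pos.injective h))
    · intro q hq
      obtain ⟨e, rfl⟩ := pos.surjective q
      rw [Finset.mem_Iio, hpos, hkey_single] at hq
      have he : e = P.single (N.top e) := by
        by_contra he
        rw [hkey_other e he] at hq
        simp [Prod.Lex.toLex_lt_toLex] at hq
      rw [he, hkey_single] at hq
      refine ⟨σ (N.top e), ?_, by rw [Equiv.symm_apply_apply, ← he]⟩
      rw [Finset.mem_Iio]
      simpa [Prod.Lex.toLex_lt_toLex] using hq
  let C : Matrix V P.Edge ℝ := fun i e =>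
    if i ∈ e.1 then (P.degree i : ℝ) - (P.numBetter i e + 1)
    else P.degree i + ((P.edges.card : ℝ) - (pos e).val)
  obtain ⟨M, hM⟩ := (Set.finite_range fun q : V × P.Edge => C q.1 q.2).bddAbove
  refine ⟨{
    ν := ν
    σ := σ
    depthFirst := ?_
    ν_head := hν
    pos := pos
    pos_single := hsingle
    pos_block := ?_
    pos_pref := ?_
    C := C
    C_incident := fun i e h => if_pos h
    C_other_ge := ?_
    C_other_anti := ?_
    M := M + 1
    lt_M := fun i e => lt_add_of_le_of_pos (hM ⟨(i, e), rfl⟩) one_pos }, rfl⟩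
  · rintro u w ⟨l, hl, hu⟩
    exact hwalk l _ _ _ hl.1 hu
  · intro i i' e e' h h' hlt
    rw [hpos, hblock h, hblock h']
    simp only [Prod.Lex.toLex_lt_toLex]
    exact Or.inr ⟨trivial, Or.inl hlt⟩
  · intro i e e' h h' hlt
    rw [hpos, hblock h, hblock h']
    simp only [Prod.Lex.toLex_lt_toLex]
    exact Or.inr ⟨trivial, Or.inr ⟨trivial, numBetter_lt_numBetter h.1 h'.1 hlt⟩⟩
  · intro i e h
    simp only [C, if_neg h, le_add_iff_nonneg_right, sub_nonneg]
    exact_mod_cast (pos e).2.le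
  · intro i e e' h h' hlt
    simp only [C, if_neg h, if_neg h', add_lt_add_iff_left, sub_lt_sub_iff_left]
    exact_mod_cast hlt

end ArborescenceNetwork

/-! ### Rules for reasoning about programs with step bounds. -/

namespace RAM

/-- Started in `s`, the program `c` halts after at most `K` steps in a store that satisfies `Q`. -/
def Ends (c : Program) (s : Store) (K : ℕ) (Q : Store → Prop) : Prop :=
  ∃ t s', Exec c s t s' ∧ t ≤ K ∧ Q s'

variable {c c₁ c₂ : Program} {s : Store} {K K' K₁ K₂ : ℕ} {Q Q' : Store → Prop} {e : Expr}

theorem Ends.mono (h : Ends c s K Q) (hK : K ≤ K') (hQ : ∀ s', Q s' → Q' s') : Ends c s K' Q' := by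
  obtain ⟨t, s', h1, h2, h3⟩ := h
  exact ⟨t, s', h1, h2.trans hK, hQ _ h3⟩

theorem Ends.seq (h₁ : Ends c₁ s K₁ Q) (h₂ : ∀ s', Q s' → Ends c₂ s' K₂ Q') :
    Ends (.seq c₁ c₂) s (K₁ + K₂) Q' := by
  obtain ⟨t, s', h1, h2, h3⟩ := h₁
  obtain ⟨t', s'', h1', h2', h3'⟩ := h₂ s' h3
  exact ⟨t + t', s'', .seq h1 h1', add_le_add h2 h2', h3'⟩

theorem Ends.skip (h : Q s) : Ends .skip s 1 Q := ⟨1, s, .skip s, le_rfl, h⟩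

theorem Ends.assign {r : ℕ} (h : Q (s.setReg r (e.eval s))) : Ends (.assign r e) s (e.cost + 1) Q :=
  ⟨_, _, .assign s r e, le_rfl, h⟩

theorem Ends.put {a : ℕ} {i j : Expr} (h : Q (s.setArr a (i.eval s) (j.eval s) (e.eval s))) :
    Ends (.put a i j e) s (i.cost + j.cost + e.cost + 1) Q :=
  ⟨_, _, .put s a i j e, le_rfl, h⟩

theorem Ends.assign_seq {r : ℕ} (h : Ends c (s.setReg r (e.eval s)) K Q) :
    Ends (.seq (.assign r e) c) s (e.cost + 1 + K) Q :=
  Ends.seq (Q := fun s' => s' = s.setReg r (e.eval s)) (.assign rfl) fun _ h' => h' ▸ h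

theorem Ends.put_seq {a : ℕ} {i j : Expr}
    (h : Ends c (s.setArr a (i.eval s) (j.eval s) (e.eval s)) K Q) :
    Ends (.seq (.put a i j e) c) s (i.cost + j.cost + e.cost + 1 + K) Q :=
  Ends.seq (Q := fun s' => s' = s.setArr a (i.eval s) (j.eval s) (e.eval s)) (.put rfl)
    fun _ h' => h' ▸ h

theorem Ends.cond (h₁ : e.eval s ≠ 0 → Ends c₁ s K Q) (h₂ : e.eval s = 0 → Ends c₂ s K Q) :
    Ends (.cond e c₁ c₂) s (e.cost + 1 + K) Q := by
  by_cases he : e.eval s = 0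
  · obtain ⟨t, s', h1, h2, h3⟩ := h₂ he
    exact ⟨_, s', .cond_false he h1, add_le_add le_rfl h2, h3⟩
  · obtain ⟨t, s', h1, h2, h3⟩ := h₁ he
    exact ⟨_, s', .cond_true he h1, add_le_add le_rfl h2, h3⟩

/-- A loop that is executed `N` times, with the invariant `I`. -/
theorem Ends.loop (I : ℕ → Store → Prop) (N : ℕ)
    (he : ∀ k s, k ≤ N → I k s → (e.eval s ≠ 0 ↔ k < N))
    (hb : ∀ k s, k < N → I k s → Ends c s K (I (k + 1))) (h : I 0 s) :
    Ends (.loop e c) s (N * (e.cost + 1 + K) + (e.cost + 1)) (I N) := by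
  have key : ∀ d k s, k + d = N → I k s →
      Ends (.loop e c) s (d * (e.cost + 1 + K) + (e.cost + 1)) (I N) := by
    intro d
    induction d with
    | zero =>
      rintro k s rfl hk
      refine ⟨_, s, .loop_false ?_, by simp, by simpa using hk⟩
      by_contra hn
      exact absurd ((he k s le_rfl hk).1 hn) (lt_irrefl _)
    | succ d ih =>
      intro k s hkd hk
      obtain ⟨t, s', h1, h2, h3⟩ := hb k s (by omega) hk
      obtain ⟨t', s'', h1', h2', h3'⟩ := ih (k + 1) s' (by omega) h3
      refine ⟨_, s'', .loop_true ((he k s (by omega) hk).2 (by omega)) h1 h1', ?_, h3'⟩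
      have : (d + 1) * (e.cost + 1 + K) = d * (e.cost + 1 + K) + (e.cost + 1 + K) := by ring
      omega
  exact key N 0 s (by omega) h

theorem Store.setReg_reg (s : Store) (r v r' : ℕ) :
    (s.setReg r v).reg r' = if r' = r then v else s.reg r' := Function.update_apply _ _ _ _

theorem Store.setReg_arr (s : Store) (r v : ℕ) : (s.setReg r v).arr = s.arr := rfl

theorem Store.setArr_reg (s : Store) (a i j v : ℕ) : (s.setArr a i j v).reg = s.reg := rfl

theorem Store.setArr_arr (s : Store) (a i j v a' i' j' : ℕ) :
    (s.setArr a i j v).arr a' i' j' =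
      if a' = a ∧ i' = i ∧ j' = j then v else s.arr a' i' j' := rfl

theorem Store.setReg_setReg (s : Store) (r v w : ℕ) :
    (s.setReg r v).setReg r w = s.setReg r w := by
  simp [Store.setReg]

end RAM

namespace ArborescenceNetwork

open RAM HypergraphicPreferenceSystem

/-! ### The program -/

namespace StableProgram

/-- The entry `a[i]` of a one-dimensional array. -/
abbrev at1 (a : ℕ) (i : Expr) : Expr := .get a i (.const 0)

/-- Assign to an entry of a one-dimensional array. -/
abbrev put1 (a : ℕ) (i e : Expr) : Program := .put a i (.const 0) e

abbrev incr (r : ℕ) : Program := .assign r (.add (.reg r) (.const 1))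

/-- Mark the heads of all arcs in array `9`. -/
def markHeads : Program :=
  .seq (.assign 3 (.const 0))
    (.loop (.lt (.reg 3) (.reg 0)) (.seq (put1 9 (at1 1 (.reg 3)) (.const 1)) (incr 3)))

/-- Find an arc whose head is marked and whose tail is not. -/
def findArc : Program :=
  .seq (.assign 4 (.const 0))
    (.loop (.lt (.reg 4) (.reg 0))
      -- Marks are 0 or 1, so the comparison asks for tail mark 0 and head mark 1. The scan does not
      -- stop at a hit; the last hit remains in register `5`.
      (.seq (.cond (.lt (at1 9 (at1 0 (.reg 4))) (at1 9 (at1 1 (.reg 4))))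
        (.assign 5 (.reg 4)) .skip) (incr 4)))

/-- Store a depth-first ordering of the arcs in array `10`. -/
def orderArcs : Program :=
  .seq (.assign 3 (.const 0))
    (.loop (.lt (.reg 3) (.reg 0))
      (.seq findArc
      -- Arcs are found from the root downwards but numbered towards the root, so the array is
      -- filled from the back.
      (.seq (put1 10 (.sub (.sub (.reg 0) (.const 1)) (.reg 3)) (.reg 5))
      (.seq (put1 9 (at1 1 (.reg 5)) (.const 0)) (incr 3)))))

/-- The entry at position `reg 4` of the preference list of vertex `reg 5`. -/
abbrev current : Expr := .get 5 (.reg 5) (.reg 4)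

/-- The last entry of the preference list of vertex `reg 5`. -/
abbrev last : Expr := .get 5 (.reg 5) (.sub (at1 4 (.reg 5)) (.const 1))

/-- Find the best hyperedge of vertex `reg 5` with first arc `reg 5` that is not marked in
array `11`. -/
def findBest : Program :=
  -- The comparison `mark < (src = tail)` is 1 only if the mark is 0 and the equality holds;
  -- subtracting it from 1 negates it.
  .loop (.sub (.const 1) (.lt (at1 11 current) (.eq (at1 2 current) (at1 0 (.reg 5))))) (incr 4)

/-- Mark the remaining hyperedges of the preference list of vertex `reg 5`. -/
def markRest : Program :=
  .loop (.lt (.reg 4) (at1 4 (.reg 5))) (.seq (put1 11 current (.const 1)) (incr 4))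

/-- Record an iteration if the hyperedge of vertex `reg 5` is not a singleton. -/
def record : Program :=
  .cond (.eq (at1 12 (.reg 5)) last) .skip
    (.seq (put1 6 (.reg 2) (.add last (.const 1)))
    -- The hyperedge of this block entered `O` in the previous ordinal pivot, hence the index shift.
    -- In the first recorded block truncated subtraction writes a meaningless value at index 0,
    -- which is overwritten later.
    (.seq (put1 7 (.sub (.reg 2) (.const 1)) (.add (at1 12 (.reg 5)) (.const 1)))
    (incr 2)))

/-- Treat the blocks in the given order. -/
def treatBlocks : Program :=
  .seq (.assign 3 (.const 0))
    (.loop (.lt (.reg 3) (.reg 0))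
      (.seq (.assign 5 (at1 10 (.reg 3)))
      (.seq (.assign 4 (.const 0))
      (.seq findBest
      (.seq (put1 12 (.reg 5) current)
      (.seq markRest
      (.seq record (incr 3))))))))

/-- Add up the values of the hyperedges at vertex `reg 5`. -/
def addValues : Program :=
  .loop (.lt (.reg 4) (at1 4 (.reg 5)))
    (.seq (.assign 6 (.add (.reg 6) (at1 8 current))) (incr 4))

/-- Compute the extreme point of the last basis. -/
def solve : Program :=
  .seq (.assign 3 (.const 0))
    (.loop (.lt (.reg 3) (.reg 0))
      (.seq (.assign 5 (at1 10 (.sub (.sub (.reg 0) (.const 1)) (.reg 3))))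
      (.seq (.assign 6 (.const 0))
      (.seq (.assign 4 (.const 0))
      (.seq addValues
      (.seq (.cond (.reg 6) .skip (put1 8 (at1 12 (.reg 5)) (.const 1))) (incr 3)))))))

end StableProgram

/-- Scarf's algorithm with the first-forward-arc-leaving rule. -/
def stableProgram : Program :=
  .seq StableProgram.markHeads
  (.seq StableProgram.orderArcs
  (.seq StableProgram.treatBlocks
  -- The last ordinal pivot brings in column `none`, whose name is 0.
  (.seq (StableProgram.put1 7 (.sub (.reg 2) (.const 1)) (.const 0)) StableProgram.solve)))

/-! ### The instance in memory and the initial marks. -/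

variable {V U : Type*} [Fintype V] [Fintype U] {P : HypergraphicPreferenceSystem V}
  {N : ArborescenceNetwork P U}

namespace Labeling

variable (L : Labeling N)

theorem vert_inj {i k : V} : (L.vert i : ℕ) = L.vert k ↔ i = k := by
  rw [Fin.val_inj, L.vert.injective.eq_iff]

theorem node_inj {u w : U} : (L.node u : ℕ) = L.node w ↔ u = w := by
  rw [Fin.val_inj, L.node.injective.eq_iff]

theorem edge_inj {e e' : P.Edge} : (L.edge e : ℕ) = L.edge e' ↔ e = e' := by
  rw [Fin.val_inj, L.edge.injective.eq_iff]

theorem exists_vert {k : ℕ} (hk : k < Fintype.card V) : ∃ i, (L.vert i : ℕ) = k :=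
  ⟨L.vert.symm ⟨k, hk⟩, by simp⟩

/-- The part of the store that holds the instance. -/
structure Given (s : Store) : Prop where
  numVert : s.reg 0 = Fintype.card V
  tail : ∀ f, s.arr 0 (L.vert f) 0 = L.node (N.T.tail f)
  head : ∀ f, s.arr 1 (L.vert f) 0 = L.node (N.T.head f)
  src : ∀ e, s.arr 2 (L.edge e) 0 = L.node (N.src e)
  degree : ∀ i, s.arr 4 (L.vert i) 0 = P.degree i
  pref : ∀ i e, i ∈ e.1 → s.arr 5 (L.vert i) (P.numBetter i e) = L.edge e

variable {L} {s s' : Store}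

theorem Given.congr (h : L.Given s) (hr : s'.reg 0 = s.reg 0) (ha : ∀ a < 6, s'.arr a = s.arr a) :
    L.Given s' where
  numVert := hr.trans h.numVert
  tail f := by rw [ha 0 (by norm_num), h.tail]
  head f := by rw [ha 1 (by norm_num), h.head]
  src e := by rw [ha 2 (by norm_num), h.src]
  degree i := by rw [ha 4 (by norm_num), h.degree]
  pref i e hi := by rw [ha 5 (by norm_num), h.pref i e hi]

theorem setArr_arr_of_ne {a i j v a' : ℕ} (h : a' ≠ a) : (s.setArr a i j v).arr a' = s.arr a' := by
  funext i' j'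
  simp [Store.setArr_arr, h]

theorem Given.setReg (h : L.Given s) {r v : ℕ} (hr : r ≠ 0) : L.Given (s.setReg r v) :=
  h.congr (by simp [Store.setReg_reg, hr.symm]) fun _ _ => rfl

theorem Given.setArr (h : L.Given s) {a i j v : ℕ} (ha : 6 ≤ a) : L.Given (s.setArr a i j v) :=
  h.congr rfl fun _ ha' => setArr_arr_of_ne (by omega)

variable (L) in
/-- The part of the store that is used after the arcs have been ordered is still empty. -/
structure Fresh (s : Store) : Prop extends L.Given s where
  reg_two : s.reg 2 = 0
  arr_zero : ∀ a i j, 6 ≤ a → a ≠ 9 → a ≠ 10 → s.arr a i j = 0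

theorem Fresh.setReg (h : L.Fresh s) {r v : ℕ} (hr : 3 ≤ r) : L.Fresh (s.setReg r v) where
  toGiven := h.toGiven.setReg (by omega)
  reg_two := by rw [Store.setReg_reg, if_neg (by omega), h.reg_two]
  arr_zero := h.arr_zero

theorem Fresh.setArr (h : L.Fresh s) {a i j v : ℕ} (ha : a = 9 ∨ a = 10) :
    L.Fresh (s.setArr a i j v) where
  toGiven := h.toGiven.setArr (by omega)
  reg_two := h.reg_two
  arr_zero a' i' j' h1 h2 h3 := by
    rw [Store.setArr_arr, if_neg (by omega), h.arr_zero a' i' j' h1 h2 h3]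

theorem IsInput.fresh (h : L.IsInput s) : L.Fresh s where
  numVert := h.numVert
  tail := h.tail
  head := h.head
  src := h.src
  degree := h.degree
  pref := h.pref
  reg_two := h.reg_zero 2 le_rfl
  arr_zero a i j ha _ _ := h.arr_zero a i j ha

open scoped Classical in
-- All nodes but the root end up marked. From here on, a mark means that the arc into the node has
-- not been numbered yet.
theorem ends_markHeads (h : L.Fresh s) (h9 : ∀ i j, s.arr 9 i j = 0) :
    Ends StableProgram.markHeads s (20 * Fintype.card V + 20) fun s' => L.Fresh s' ∧
      ∀ u, s'.arr 9 (L.node u) 0 = if ∃ f, N.T.head f = u then 1 else 0 := by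
  refine Ends.mono (Ends.assign_seq (Ends.loop (K := 10) (fun k s => s.reg 3 = k ∧ L.Fresh s ∧
      ∀ u, s.arr 9 (L.node u) 0 = if ∃ f, N.T.head f = u ∧ (L.vert f : ℕ) < k then 1 else 0)
    (Fintype.card V) ?_ ?_ ?_)) ?_ ?_ (K' := 20 * Fintype.card V + 20)
  · rintro k s - ⟨h3, hF, -⟩
    simp [Expr.eval, h3, hF.numVert]
  · rintro k s hk ⟨h3, hF, h9⟩
    obtain ⟨i, rfl⟩ := L.exists_vert hk
    refine Ends.mono (Ends.put_seq (Ends.assign ?_)) ?_ (fun _ h => h)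
      (Q := fun s => s.reg 3 = (L.vert i : ℕ) + 1 ∧ L.Fresh s ∧ ∀ u, s.arr 9 (L.node u) 0 =
        if ∃ f, N.T.head f = u ∧ (L.vert f : ℕ) < (L.vert i : ℕ) + 1 then 1 else 0)
    · refine ⟨?_, (hF.setArr (by simp)).setReg (by norm_num), fun u => ?_⟩
      · simp [Expr.eval, Store.setReg_reg, Store.setArr_reg, h3]
      · have h1 : (∃ f, N.T.head f = u ∧ (L.vert f : ℕ) < (L.vert i : ℕ) + 1) ↔
            N.T.head i = u ∨ ∃ f, N.T.head f = u ∧ (L.vert f : ℕ) < (L.vert i : ℕ) := by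
          constructor
          · rintro ⟨f, hf, hlt⟩
            rcases Nat.lt_succ_iff_lt_or_eq.1 hlt with h | h
            · exact Or.inr ⟨f, hf, h⟩
            · exact Or.inl (L.vert_inj.1 h ▸ hf)
          · rintro (h | ⟨f, hf, h⟩)
            exacts [⟨i, h, by omega⟩, ⟨f, hf, by omega⟩]
        simp only [h1, Store.setReg_arr, Store.setArr_arr, Expr.eval, h3, hF.head, L.node_inj, h9,
          true_and, and_true]
        by_cases hu : u = N.T.head i
        · simp [hu]
        · simp [hu, Ne.symm hu]
    · simp [Expr.cost]
  · refine ⟨by simp [Store.setReg_reg, Expr.eval], h.setReg le_rfl, fun u => ?_⟩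
    simp [Store.setReg_arr, h9]
  · simp [Expr.cost]
    omega
  · rintro s' ⟨-, h1, h2⟩
    exact ⟨h1, fun u => by simp [h2]⟩

end Labeling

end ArborescenceNetwork

/-! ### Correctness of the computed ordering. -/

namespace ArborescenceNetwork

open RAM HypergraphicPreferenceSystem

variable {V U : Type*} [Fintype V] [Fintype U] {P : HypergraphicPreferenceSystem V}
  {N : ArborescenceNetwork P U}

namespace Labeling

variable {L : Labeling N} {s s' : Store}

/-- The first `k` arcs of the ordering are `τ 0, …, τ (k - 1)`. -/
structure IsPartialOrder (L : Labeling N) (τ : ℕ → V) (k : ℕ) (s : Store) : Prop where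
  fresh : L.Fresh s
  counter : s.reg 3 = k
  order : ∀ j < k, s.arr 10 (Fintype.card V - 1 - j) 0 = L.vert (τ j)
  inj : ∀ j < k, ∀ j' < k, τ j = τ j' → j = j'
  pred : ∀ j < k, ∀ g, N.T.head g = N.T.tail (τ j) → ∃ j' < j, τ j' = g
  mark_le : ∀ u, s.arr 9 (L.node u) 0 ≤ 1
  mark : ∀ u, s.arr 9 (L.node u) 0 = 1 ↔ ∃ f, N.T.head f = u ∧ ∀ j < k, τ j ≠ f

theorem ends_findArc {τ : ℕ → V} {k : ℕ} (hk : k < Fintype.card V)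
    (h : L.IsPartialOrder τ k s) :
    Ends StableProgram.findArc s (30 * Fintype.card V + 30) fun s' => L.IsPartialOrder τ k s' ∧
      ∃ i, s'.reg 5 = L.vert i ∧ s'.arr 9 (L.node (N.T.tail i)) 0 = 0 ∧
        s'.arr 9 (L.node (N.T.head i)) 0 = 1 := by
  classical
  -- Fewer than `|V|` arcs are numbered. Among the others take one without predecessor: the arc into
  -- its tail, if any, is numbered, so the tail is unmarked.
  have hready : ∃ i, s.arr 9 (L.node (N.T.tail i)) 0 = 0 ∧ s.arr 9 (L.node (N.T.head i)) 0 = 1 := by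
    obtain ⟨f, hf, hf'⟩ := N.T.exists_first_arc (X := {f | ∀ j < k, τ j ≠ f}) (by
      by_contra hn
      rw [Set.not_nonempty_iff_eq_empty, Set.eq_empty_iff_forall_notMem] at hn
      have hsub : (Finset.univ : Finset V) ⊆ (Finset.range k).image τ := by
        intro f _
        have := hn f
        simp only [Set.mem_ofPred_eq, not_forall, ne_eq, not_not] at this
        obtain ⟨j, hj, rfl⟩ := this
        exact Finset.mem_image_of_mem _ (Finset.mem_range.2 hj)
      have h1 := (Finset.card_le_card hsub).trans Finset.card_image_le
      rw [Finset.card_univ, Finset.card_range] at h1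
      omega)
    refine ⟨f, ?_, (h.mark _).2 ⟨f, rfl, hf⟩⟩
    have h1 := h.mark_le (N.T.tail f)
    have h2 : ¬ s.arr 9 (L.node (N.T.tail f)) 0 = 1 := by
      rw [h.mark]
      rintro ⟨g, hg, hg'⟩
      exact hf' g hg' hg
    omega
  obtain ⟨i₀, hi₀⟩ := hready
  -- Once the scan has passed `i₀`, register `5` holds some suitable arc, possibly a different one.
  refine Ends.mono (Ends.assign_seq (Ends.loop (K := 20) (fun l s' => L.Fresh s' ∧ s'.reg 3 = k ∧
    s'.reg 4 = l ∧ s'.arr = s.arr ∧ ((L.vert i₀ : ℕ) < l → ∃ i, s'.reg 5 = L.vert i ∧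
      s.arr 9 (L.node (N.T.tail i)) 0 = 0 ∧ s.arr 9 (L.node (N.T.head i)) 0 = 1))
    (Fintype.card V) ?_ ?_ ?_)) ?_ ?_ (K' := 30 * Fintype.card V + 30)
  · rintro l s' - ⟨hF, -, h4, -⟩
    simp [Expr.eval, h4, hF.numVert]
  · rintro l s' hl ⟨hF, h3, h4, ha, h5⟩
    obtain ⟨i, rfl⟩ := L.exists_vert hl
    have hev : (Expr.lt (StableProgram.at1 9 (StableProgram.at1 0 (.reg 4)))
        (StableProgram.at1 9 (StableProgram.at1 1 (.reg 4)))).eval s' ≠ 0 ↔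
        s.arr 9 (L.node (N.T.tail i)) 0 = 0 ∧ s.arr 9 (L.node (N.T.head i)) 0 = 1 := by
      have h1 := h.mark_le (N.T.tail i)
      have h2 := h.mark_le (N.T.head i)
      simp only [Expr.eval, h4, hF.tail, hF.head, ha]
      split_ifs with hlt
      · simp only [ne_eq, one_ne_zero, not_false_eq_true, true_iff]
        omega
      · simp only [ne_eq, not_true_eq_false, false_iff]
        omega
    refine Ends.mono (Ends.seq (Q := fun s'' => L.Fresh s'' ∧ s''.reg 3 = k ∧
      s''.reg 4 = (L.vert i : ℕ) ∧ s''.arr = s.arr ∧ ((L.vert i₀ : ℕ) < (L.vert i : ℕ) + 1 →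
        ∃ i, s''.reg 5 = L.vert i ∧ s.arr 9 (L.node (N.T.tail i)) 0 = 0 ∧
          s.arr 9 (L.node (N.T.head i)) 0 = 1)) (K₁ := 14)
      (Ends.mono (Ends.cond (K := 2) (fun he => ?_) (fun he => ?_)) ?_ fun _ h => h)
      (fun s'' hs'' => Ends.assign (Q := fun s' => L.Fresh s' ∧ s'.reg 3 = k ∧
        s'.reg 4 = (L.vert i : ℕ) + 1 ∧ s'.arr = s.arr ∧ ((L.vert i₀ : ℕ) < (L.vert i : ℕ) + 1 →
        ∃ i, s'.reg 5 = L.vert i ∧ s.arr 9 (L.node (N.T.tail i)) 0 = 0 ∧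
          s.arr 9 (L.node (N.T.head i)) 0 = 1)) ?_)) ?_ (fun _ h => h)
    · refine Ends.assign ⟨hF.setReg (by norm_num), ?_, ?_, ha, fun _ => ⟨i, ?_, hev.1 he⟩⟩
      · simp [Store.setReg_reg, h3]
      · simp [Store.setReg_reg, h4]
      · simp [Store.setReg_reg, h4, Expr.eval]
    · refine (Ends.skip ⟨hF, h3, h4, ha, fun hlt => ?_⟩).mono (by norm_num) fun _ h => h
      rcases Nat.lt_succ_iff_lt_or_eq.1 hlt with hlt | heq
      · exact h5 hlt
      · rw [L.vert_inj] at heq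
        exact absurd he (hev.2 (heq ▸ hi₀))
    · simp [Expr.cost]
    · obtain ⟨hF, h3, h4, ha, h5⟩ := hs''
      refine ⟨hF.setReg (by norm_num), ?_, ?_, ha, ?_⟩
      · simp [Store.setReg_reg, h3]
      · simp [Store.setReg_reg, h4, Expr.eval]
      · simpa [Store.setReg_reg] using h5
    · simp [Expr.cost]
  · exact ⟨h.fresh.setReg (by norm_num), by simp [Store.setReg_reg, h.counter],
      by simp [Store.setReg_reg, Expr.eval], rfl, fun h => absurd h (Nat.not_lt_zero _)⟩
  · simp [Expr.cost]
    omega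
  · rintro s' ⟨hF, h3, -, ha, h5⟩
    obtain ⟨i, hi⟩ := h5 (L.vert i₀).2
    refine ⟨⟨hF, h3, ?_, h.inj, h.pred, ?_, ?_⟩, i, ?_⟩
    · rw [ha]; exact h.order
    · rw [ha]; exact h.mark_le
    · rw [ha]; exact h.mark
    · rw [ha]; exact hi

theorem IsPartialOrder.step {τ : ℕ → V} {k : ℕ} (hk : k < Fintype.card V)
    (h : L.IsPartialOrder τ k s) {i : V} (ht : s.arr 9 (L.node (N.T.tail i)) 0 = 0)
    (hh : s.arr 9 (L.node (N.T.head i)) 0 = 1) :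
    L.IsPartialOrder (Function.update τ k i) (k + 1)
      (((s.setArr 10 (Fintype.card V - 1 - k) 0 (L.vert i)).setArr 9
        (L.node (N.T.head i)) 0 0).setReg 3 (k + 1)) := by
  have hτ : ∀ j < k, Function.update τ k i j = τ j := fun j hj => by simp [hj.ne]
  have hi : ∀ j < k, τ j ≠ i := by
    obtain ⟨f, hf, hf'⟩ := (h.mark _).1 hh
    rwa [← N.T.head_injective hf]
  have hlt : ∀ j, j < k + 1 ↔ j < k ∨ j = k := fun j => by omega
  refine ⟨((h.fresh.setArr (by simp)).setArr (by simp)).setReg le_rfl, ?_, ?_, ?_, ?_, ?_, ?_⟩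
  · simp [Store.setReg_reg]
  · intro j hj
    rw [Store.setReg_arr, setArr_arr_of_ne (by norm_num), Store.setArr_arr]
    rcases (hlt j).1 hj with hj | rfl
    · rw [hτ j hj, if_neg (by omega), h.order j hj]
    · simp
  · intro j hj j' hj' hjj
    rcases (hlt j).1 hj with hj | rfl <;> rcases (hlt j').1 hj' with hj' | rfl
    · rw [hτ j hj, hτ j' hj'] at hjj
      exact h.inj j hj j' hj' hjj
    · rw [hτ j hj, Function.update_self] at hjj
      exact absurd hjj (hi j hj)
    · rw [hτ j' hj', Function.update_self] at hjj
      exact absurd hjj.symm (hi j' hj')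
    · rfl
  · intro j hj g hg
    rcases (hlt j).1 hj with hj | rfl
    · rw [hτ j hj] at hg
      obtain ⟨j', hj', rfl⟩ := h.pred j hj g hg
      exact ⟨j', hj', hτ j' (hj'.trans hj)⟩
    · rw [Function.update_self] at hg
      by_contra! hn
      have : s.arr 9 (L.node (N.T.tail i)) 0 = 1 :=
        (h.mark _).2 ⟨g, hg, fun j' hj' => hτ j' hj' ▸ hn j' hj'⟩
      omega
  · intro u
    rw [Store.setReg_arr, Store.setArr_arr, setArr_arr_of_ne (by norm_num)]
    split_ifs
    exacts [zero_le_one, h.mark_le u]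
  · intro u
    rw [Store.setReg_arr, Store.setArr_arr, setArr_arr_of_ne (by norm_num)]
    by_cases hu : u = N.T.head i
    · rw [if_pos ⟨rfl, by rw [hu], rfl⟩]
      refine iff_of_false (by norm_num) ?_
      rintro ⟨f, hf, hf'⟩
      rw [hu] at hf
      exact hf' k (by omega) (by rw [Function.update_self, N.T.head_injective hf])
    · rw [if_neg (fun h => hu (L.node_inj.1 h.2.1)), h.mark]
      refine exists_congr fun f => and_congr_right fun hf => ?_
      constructor
      · intro hf' j hj
        rcases (hlt j).1 hj with hj | rfl
        · rw [hτ j hj]; exact hf' j hj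
        · rw [Function.update_self]
          rintro rfl
          exact hu hf.symm
      · intro hf' j hj
        have := hf' j (by omega)
        rwa [hτ j hj] at this

theorem ends_orderArcs [Nonempty V] (h : L.Fresh s) (h9 : ∀ u, s.arr 9 (L.node u) 0 =
    open scoped Classical in if ∃ f, N.T.head f = u then 1 else 0) :
    Ends StableProgram.orderArcs s (60 * (Fintype.card V * Fintype.card V) +
        60 * Fintype.card V + 60) fun s' => L.Fresh s' ∧
      ∃ σ : V ≃ Fin (Fintype.card V), (∀ f g, N.T.head g = N.T.tail f → σ f < σ g) ∧
        ∀ i, s'.arr 10 (σ i) 0 = L.vert i := by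
  classical
  refine Ends.mono (Ends.assign_seq (Ends.loop (K := 30 * Fintype.card V + 50)
    (fun k s => ∃ τ, L.IsPartialOrder τ k s)
    (Fintype.card V) ?_ ?_ ?_)) ?_ ?_ (K' := 60 * (Fintype.card V * Fintype.card V) +
        60 * Fintype.card V + 60)
  · rintro k s - ⟨τ, hτ⟩
    simp [Expr.eval, hτ.counter, hτ.fresh.numVert]
  · rintro k s hk ⟨τ, hτ⟩
    refine Ends.mono (Ends.seq (ends_findArc hk hτ) (Q' := fun s => ∃ τ, L.IsPartialOrder τ (k + 1) s)
      (K₂ := 20) ?_) (by omega) (fun _ h => h)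
    rintro s' ⟨h', i, h5, ht, hh⟩
    refine Ends.mono (Ends.put_seq (Ends.put_seq (Ends.assign
      (Q := fun s => ∃ τ, L.IsPartialOrder τ (k + 1) s) ⟨Function.update τ k i, ?_⟩))) ?_ fun _ h => h
    · convert h'.step hk ht hh using 1
      simp [Expr.eval, Store.setArr_reg, h'.counter, h'.fresh.numVert, h5,
        setArr_arr_of_ne, h'.fresh.head]
    · simp [Expr.cost]
  · refine ⟨fun _ => Classical.arbitrary V, h.setReg le_rfl, by simp [Store.setReg_reg, Expr.eval],
      by simp, by simp, by simp, fun u => ?_, fun u => ?_⟩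
    · rw [Store.setReg_arr, h9]
      split_ifs <;> norm_num
    · rw [Store.setReg_arr, h9]
      simp
  · simp only [Expr.cost]
    nlinarith
  · rintro s' ⟨τ, hτ⟩
    refine ⟨hτ.fresh, ?_⟩
    have hbij : Function.Bijective fun j : Fin (Fintype.card V) => τ j := by
      rw [Fintype.bijective_iff_injective_and_card]
      exact ⟨fun j j' hjj => Fin.ext (hτ.inj j j.2 j' j'.2 hjj), by simp⟩
    let E := Equiv.ofBijective _ hbij
    have hE : ∀ f, τ (E.symm f) = f := fun f => E.apply_symm_apply f
    -- The order of discovery reversed, so that predecessors receive larger numbers.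
    refine ⟨E.symm.trans Fin.revPerm, fun f g hg => ?_, fun i => ?_⟩
    · obtain ⟨j', hj', hj''⟩ := hτ.pred (E.symm f) (E.symm f).2 g (by rw [hE]; exact hg)
      have : (E.symm g : ℕ) = j' := hτ.inj _ (E.symm g).2 j' (hj'.trans (E.symm f).2)
        ((hE g).trans hj''.symm)
      simp only [Equiv.trans_apply, Fin.revPerm_apply, Fin.rev_lt_rev]
      rw [Fin.lt_def]
      omega
    · have := hτ.order (E.symm i) (E.symm i).2
      rw [hE] at this
      rw [← this]
      simp only [Equiv.trans_apply, Fin.revPerm_apply, Fin.val_rev]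
      congr 1
      omega

end Labeling

end ArborescenceNetwork

/-! ### Every position of a preference list is occupied. -/

namespace HypergraphicPreferenceSystem

variable {V : Type*} {P : HypergraphicPreferenceSystem V}

/-- Ranks are distinct and smaller than the degree, so by counting they take every such value. -/
theorem exists_numBetter_eq {i : V} {l : ℕ} (hl : l < P.degree i) :
    ∃ e : P.Edge, i ∈ e.1 ∧ P.numBetter i e = l := by
  classical
  have hinj : Set.InjOn (P.numBetter i) (Finset.univ.filter fun e : P.Edge => i ∈ e.1) :=
    fun e he e' he' h => numBetter_inj (by simpa using he) (by simpa using he') h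
  have himg : (Finset.univ.filter fun e : P.Edge => i ∈ e.1).image (P.numBetter i) =
      Finset.range (P.degree i) := by
    refine Finset.eq_of_subset_of_card_le ?_ ?_
    · intro k hk
      obtain ⟨e, he, rfl⟩ := Finset.mem_image.1 hk
      exact Finset.mem_range.2 (numBetter_lt_degree (by simpa using he))
    · rw [Finset.card_image_of_injOn hinj, Finset.card_range]
      rfl
  obtain ⟨e, he, rfl⟩ := Finset.mem_image.1 (himg ▸ Finset.mem_range.2 hl)
  exact ⟨e, by simpa using he, rfl⟩

theorem degree_le (i : V) : P.degree i ≤ P.edges.card := by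
  classical
  exact (Finset.card_le_univ _).trans (Fintype.card_coe _).le

end HypergraphicPreferenceSystem

/-! ### Correctness of the treatment of the blocks. -/

namespace ArborescenceNetwork

open RAM HypergraphicPreferenceSystem

variable {V U : Type*} [Fintype V] [Fintype U] [DecidableEq V]
  {P : HypergraphicPreferenceSystem V} {N : ArborescenceNetwork P U}

namespace Labeling

variable {L : Labeling N} {s s' : Store} {S : BlockPartition N} {D : V → P.Edge}

/-- The blocks before position `j` have been treated. -/
structure IsMarked (L : Labeling N) (S : BlockPartition N) (D : V → P.Edge) (j : ℕ)
    (s : Store) : Prop extends L.Given s where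
  order : ∀ i, s.arr 10 (S.σ i) 0 = L.vert i
  mark : ∀ e : P.Edge, s.arr 11 (L.edge e) 0 = 0 ↔
    ∀ k ∈ e.1, (S.σ k : ℕ) < j → P.pref k e (D k)
  value : ∀ i, (S.σ i : ℕ) < j → s.arr 12 (L.vert i) 0 = L.edge (D i)
  zero : ∀ i j, s.arr 8 i j = 0

open scoped Classical in
/-- The iterations that belong to the blocks before position `j` have been recorded. -/
structure IsRecorded (L : Labeling N) (S : BlockPartition N) (D : V → P.Edge) (j : ℕ)
    (s : Store) : Prop where
  count : s.reg 2 = Nat.count (S.Active D) j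
  leaving : ∀ k < Nat.count (S.Active D) j, ∃ i, (S.σ i : ℕ) = S.runIndex D k ∧
    s.arr 6 k 0 = L.edge (P.single i) + 1
  entering : ∀ k, k + 1 < Nat.count (S.Active D) j →
    ∃ i, (S.σ i : ℕ) = S.runIndex D (k + 1) ∧ s.arr 7 k 0 = L.edge (D i) + 1

theorem IsMarked.congr {j : ℕ} (h : L.IsMarked S D j s) (hr : s'.reg 0 = s.reg 0)
    (ha : ∀ a, a ≠ 6 → a ≠ 7 → s'.arr a = s.arr a) : L.IsMarked S D j s' where
  toGiven := h.toGiven.congr hr fun a h => ha a (by omega) (by omega)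
  order := by rw [ha 10 (by norm_num) (by norm_num)]; exact h.order
  mark := by rw [ha 11 (by norm_num) (by norm_num)]; exact h.mark
  value := by rw [ha 12 (by norm_num) (by norm_num)]; exact h.value
  zero := by rw [ha 8 (by norm_num) (by norm_num)]; exact h.zero

theorem IsRecorded.congr {j : ℕ} (h : L.IsRecorded S D j s) (hr : s'.reg 2 = s.reg 2)
    (h6 : s'.arr 6 = s.arr 6) (h7 : s'.arr 7 = s.arr 7) : L.IsRecorded S D j s' where
  count := hr.trans h.count
  leaving := by rw [h6]; exact h.leaving
  entering := by rw [h7]; exact h.entering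

/-- With the lower blocks marked, the test "unmarked and starting at the tail of `i`" is exactly
eligibility for the greedy choice. The scan stops at `D i`, because `D i` is eligible and nothing
better is. -/
theorem ends_findBest (hD : IsGreedy N D) {i : V} (h : L.IsMarked S D (S.σ i) s)
    (h5 : s.reg 5 = L.vert i) :
    Ends StableProgram.findBest (s.setReg 4 0) (30 * P.edges.card + 30) fun s' =>
      s' = s.setReg 4 (P.numBetter i (D i)) := by
  classical
  have hDi := BlockPartition.mem_self hD i
  have hlt := numBetter_lt_degree hDi
  refine Ends.mono (Ends.loop (K := 4) (fun l s' => s' = s.setReg 4 l) (P.numBetter i (D i))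
    ?_ ?_ rfl) ?_ (fun _ h => h)
  · rintro l _ hl rfl
    obtain ⟨e, he, rfl⟩ := P.exists_numBetter_eq (hl.trans_lt hlt)
    have hev : (Expr.lt (StableProgram.at1 11 StableProgram.current)
        (.eq (StableProgram.at1 2 StableProgram.current)
          (StableProgram.at1 0 (.reg 5)))).eval (s.setReg 4 (P.numBetter i e)) =
        if s.arr 11 (L.edge e) 0 = 0 ∧ N.src e = N.T.tail i then 1 else 0 := by
      simp only [Expr.eval, Store.setReg_reg, Store.setReg_arr, h5, if_true,
        show (5 : ℕ) ≠ 4 by norm_num, if_false, h.pref i e he, h.src, h.tail, L.node_inj]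
      by_cases h1 : N.src e = N.T.tail i
      · simp [h1]
      · simp [h1]
    have hgood : (s.arr 11 (L.edge e) 0 = 0 ∧ N.src e = N.T.tail i) ↔
        N.top e = i ∧ ∀ k ∈ e.1, k ≠ i → P.pref k e (D k) := by
      constructor
      · rintro ⟨h1, h2⟩
        have ht := N.eq_top_of_tail_eq he h2.symm
        refine ⟨ht.symm, fun k hk hki => (h.mark e).1 h1 k hk ?_⟩
        have := S.σ_lt_top hk (by rwa [← ht])
        rwa [← ht] at this
      · rintro ⟨h1, h2⟩
        refine ⟨(h.mark e).2 fun k hk hlt => h2 k hk ?_, by rw [← N.tail_top, h1]⟩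
        rintro rfl
        exact lt_irrefl _ hlt
    rw [Expr.eval, hev, Expr.eval]
    have hiff : ¬ (s.arr 11 (L.edge e) 0 = 0 ∧ N.src e = N.T.tail i) ↔
        P.numBetter i e < P.numBetter i (D i) := by
      rw [hgood]
      constructor
      · intro hn
        refine lt_of_le_of_ne hl fun heq => hn ?_
        rw [numBetter_inj he hDi heq]
        exact ⟨hD.top i, hD.pref i⟩
      · rintro hlt ⟨rfl, h2⟩
        exact hD.best e h2 ((numBetter_lt_iff he hDi).1 hlt)
    rw [← hiff]
    by_cases hc : s.arr 11 (L.edge e) 0 = 0 ∧ N.src e = N.T.tail i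
    · simp [hc]
    · simp [hc]
  · rintro l _ hl rfl
    refine Ends.mono (Ends.assign (Q := fun s' => s' = s.setReg 4 (l + 1)) ?_) (by simp [Expr.cost])
      fun _ h => h
    simp [Expr.eval, Store.setReg_reg, Store.setReg_setReg]
  · have := P.degree_le i
    simp only [Expr.cost]
    omega

/-- Position `l` itself is marked too. For the position of `D i`, the hyperedges at `i` that are
spared are those that `i` strictly prefers to `D i`. -/
theorem ends_markRest {i : V} {l : ℕ} (h : L.Given s) (h5 : s.reg 5 = L.vert i)
    (h4 : s.reg 4 = l) (hl : l ≤ P.degree i) :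
    Ends StableProgram.markRest s (30 * P.edges.card + 30) fun s' =>
      (∀ r, r ≠ 4 → s'.reg r = s.reg r) ∧ (∀ a, a ≠ 11 → s'.arr a = s.arr a) ∧
      ∀ e : P.Edge, s'.arr 11 (L.edge e) 0 =
        if i ∈ e.1 ∧ l ≤ P.numBetter i e then 1 else s.arr 11 (L.edge e) 0 := by
  refine Ends.mono (Ends.loop (K := 14) (fun k s' => s'.reg 4 = l + k ∧
      (∀ r, r ≠ 4 → s'.reg r = s.reg r) ∧ (∀ a, a ≠ 11 → s'.arr a = s.arr a) ∧
      ∀ e : P.Edge, s'.arr 11 (L.edge e) 0 =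
        if i ∈ e.1 ∧ l ≤ P.numBetter i e ∧ P.numBetter i e < l + k then 1
        else s.arr 11 (L.edge e) 0) (P.degree i - l) ?_ ?_ ?_) ?_ ?_
  · rintro k s' hk ⟨h1, h2, h3, -⟩
    have hG : L.Given s' := h.congr (h2 0 (by norm_num)) fun a ha => h3 a (by omega)
    simp only [Expr.eval, h1, h2 5 (by norm_num), h5, hG.degree]
    split_ifs <;> omega
  · rintro k s' hk ⟨h1, h2, h3, h11⟩
    have hG : L.Given s' := h.congr (h2 0 (by norm_num)) fun a ha => h3 a (by omega)
    obtain ⟨e₀, he₀, hn⟩ := P.exists_numBetter_eq (show l + k < P.degree i by omega)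
    have hcur : StableProgram.current.eval s' = L.edge e₀ := by
      simp only [Expr.eval, h1, h2 5 (by norm_num), h5]
      rw [← hn, hG.pref i e₀ he₀]
    refine Ends.mono (Ends.put_seq (Ends.assign (Q := fun s' => s'.reg 4 = l + (k + 1) ∧
      (∀ r, r ≠ 4 → s'.reg r = s.reg r) ∧ (∀ a, a ≠ 11 → s'.arr a = s.arr a) ∧
      ∀ e : P.Edge, s'.arr 11 (L.edge e) 0 =
        if i ∈ e.1 ∧ l ≤ P.numBetter i e ∧ P.numBetter i e < l + (k + 1) then 1
        else s.arr 11 (L.edge e) 0) ⟨?_, fun r hr => ?_, fun a ha => ?_, fun e => ?_⟩))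
      (by simp [Expr.cost]) fun _ h => h
    · simp [Store.setReg_reg, Store.setArr_reg, Expr.eval, h1, add_assoc]
    · simp [Store.setReg_reg, Store.setArr_reg, hr, h2 r hr]
    · rw [Store.setReg_arr, setArr_arr_of_ne ha, h3 a ha]
    · rw [Store.setReg_arr, Store.setArr_arr, hcur, h11]
      by_cases hee : e = e₀
      · subst hee
        rw [if_pos ⟨rfl, rfl, rfl⟩, if_pos ⟨he₀, by omega, by omega⟩]
        rfl
      · rw [if_neg fun h => hee (L.edge_inj.1 h.2.1)]
        refine if_congr ?_ rfl rfl
        constructor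
        · rintro ⟨ha, hb, hc⟩
          exact ⟨ha, hb, by omega⟩
        · rintro ⟨ha, hb, hc⟩
          refine ⟨ha, hb, lt_of_le_of_ne (by omega) fun heq => hee ?_⟩
          exact numBetter_inj ha he₀ (heq.trans hn.symm)
  · refine ⟨by simp [h4], fun _ _ => rfl, fun _ _ => rfl, fun e => ?_⟩
    rw [if_neg]
    omega
  · have h1 := P.degree_le i
    have h2 : (P.degree i - l) * 24 ≤ P.edges.card * 24 := Nat.mul_le_mul_right _ (by omega)
    simp only [Expr.cost]
    omega
  · rintro s' ⟨-, h2, h3, h11⟩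
    refine ⟨h2, h3, fun e => ?_⟩
    rw [h11]
    refine if_congr ?_ rfl rfl
    constructor
    · rintro ⟨ha, hb, -⟩
      exact ⟨ha, hb⟩
    · rintro ⟨ha, hb⟩
      have := numBetter_lt_degree ha
      exact ⟨ha, hb, by omega⟩

open scoped Classical in
theorem ends_record {i : V} (h : L.IsMarked S D ((S.σ i : ℕ) + 1) s)
    (hR : L.IsRecorded S D (S.σ i) s) (h5 : s.reg 5 = L.vert i) :
    Ends StableProgram.record s 50 fun s' => L.IsMarked S D ((S.σ i : ℕ) + 1) s' ∧
      L.IsRecorded S D ((S.σ i : ℕ) + 1) s' ∧ s'.reg 3 = s.reg 3 := by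
  have hlast : StableProgram.last.eval s = L.edge (P.single i) := by
    simp only [Expr.eval, h5, h.degree]
    rw [← numBetter_single i, Nat.add_sub_cancel]
    exact h.pref i _ (mem_single.2 rfl)
  have hval : s.arr 12 (L.vert i) 0 = L.edge (D i) := h.value i (Nat.lt_succ_self _)
  have hact : S.Active D (S.σ i) ↔ D i ≠ P.single i := by
    constructor
    · rintro ⟨k, hk, hk'⟩
      rwa [S.σ.injective (Fin.ext hk)] at hk'
    · exact fun h => ⟨i, rfl, h⟩
  have hcond : (Expr.eq (StableProgram.at1 12 (.reg 5)) StableProgram.last).eval s ≠ 0 ↔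
      D i = P.single i := by
    rw [Expr.eval, hlast]
    simp only [Expr.eval, h5, hval, L.edge_inj]
    by_cases hDi : D i = P.single i <;> simp [hDi]
  refine Ends.mono (Ends.cond (K := 30) (fun hc => ?_) (fun hc => ?_)) (by simp [Expr.cost])
    fun _ h => h
  · have hna : ¬ S.Active D (S.σ i) := fun ha => hact.1 ha (hcond.1 hc)
    refine (Ends.skip ⟨h, ?_, rfl⟩).mono (by norm_num) fun _ h => h
    have hcount : Nat.count (S.Active D) ((S.σ i : ℕ) + 1) = Nat.count (S.Active D) (S.σ i) := by
      rw [Nat.count_succ, if_neg hna, add_zero]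
    refine ⟨?_, ?_, ?_⟩ <;> rw [hcount]
    exacts [hR.count, hR.leaving, hR.entering]
  · have ha : S.Active D (S.σ i) := hact.2 fun hDi => hcond.2 hDi hc
    obtain ⟨h1, h2⟩ := BlockPartition.runIndex_count ha
    have hcount : Nat.count (S.Active D) ((S.σ i : ℕ) + 1) =
        Nat.count (S.Active D) (S.σ i) + 1 := by
      rw [Nat.count_succ, if_pos ha]
    refine Ends.mono (Ends.put_seq (Ends.put_seq (Ends.assign (Q := fun s' =>
      L.IsMarked S D ((S.σ i : ℕ) + 1) s' ∧ L.IsRecorded S D ((S.σ i : ℕ) + 1) s' ∧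
      s'.reg 3 = s.reg 3) ⟨?_, ?_, rfl⟩))) (by simp [Expr.cost]) fun _ h => h
    · refine h.congr rfl fun a h6 h7 => ?_
      rw [Store.setReg_arr, setArr_arr_of_ne h7, setArr_arr_of_ne h6]
    · refine ⟨?_, fun k hk => ?_, fun k hk => ?_⟩
      · rw [hcount, ← hR.count]
        simp [Store.setReg_reg, Store.setArr_reg, Expr.eval]
      · rw [Store.setReg_arr, setArr_arr_of_ne (by norm_num), Store.setArr_arr]
        by_cases hkc : k = Nat.count (S.Active D) (S.σ i)
        · refine ⟨i, by rw [hkc, h2], ?_⟩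
          rw [if_pos ⟨rfl, by rw [Expr.eval, hR.count, hkc], rfl⟩, Expr.eval, hlast]
          rfl
        · rw [if_neg fun h => hkc (h.2.1.trans hR.count)]
          exact hR.leaving k (by omega)
      · rw [Store.setReg_arr, Store.setArr_arr, setArr_arr_of_ne (by norm_num)]
        have hj : (Expr.sub (.reg 2) (.const 1)).eval
            (s.setArr 6 ((Expr.reg 2).eval s) ((Expr.const 0).eval s)
              ((Expr.add StableProgram.last (.const 1)).eval s)) =
            Nat.count (S.Active D) (S.σ i) - 1 := by
          simp [Expr.eval, Store.setArr_reg, hR.count]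
        rw [hj]
        -- For the first active block the count is 0 and this case is void: the value written at
        -- index 0 is not yet claimed to be correct.
        by_cases hkc : k + 1 = Nat.count (S.Active D) (S.σ i)
        · refine ⟨i, by rw [hkc, h2], ?_⟩
          rw [if_pos ⟨rfl, by omega, rfl⟩]
          simp only [Expr.eval, Store.setArr_reg, h5, setArr_arr_of_ne (show (12 : ℕ) ≠ 6 by norm_num),
            hval]
        · rw [if_neg fun h => hkc (by omega)]
          exact hR.entering k (by omega)

theorem ends_treatBlocks (hD : IsGreedy N D) (h : L.Fresh s)
    (h10 : ∀ i, s.arr 10 (S.σ i) 0 = L.vert i) :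
    Ends StableProgram.treatBlocks s
      (60 * (Fintype.card V * P.edges.card) + 200 * Fintype.card V + 200) fun s' =>
      L.IsMarked S D (Fintype.card V) s' ∧ L.IsRecorded S D (Fintype.card V) s' := by
  classical
  refine Ends.mono (Ends.assign_seq (Ends.loop (K := 60 * P.edges.card + 160) (fun j s =>
    s.reg 3 = j ∧ L.IsMarked S D j s ∧ L.IsRecorded S D j s) (Fintype.card V) ?_ ?_ ?_)) ?_ ?_
    (K' := 60 * (Fintype.card V * P.edges.card) + 200 * Fintype.card V + 200)
  · rintro j s - ⟨h3, hM, -⟩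
    simp [Expr.eval, h3, hM.numVert]
  · rintro j s hj ⟨h3, hM, hR⟩
    obtain ⟨i, rfl⟩ : ∃ i, (S.σ i : ℕ) = j := ⟨S.σ.symm ⟨j, hj⟩, by simp⟩
    have hDi := BlockPartition.mem_self hD i
    have hev : (StableProgram.at1 10 (.reg 3)).eval s = L.vert i := by
      simp only [Expr.eval, h3, hM.order]
    have hM' : L.IsMarked S D (S.σ i) (s.setReg 5 (L.vert i)) :=
      hM.congr (by simp [Store.setReg_reg]) fun _ _ _ => rfl
    refine Ends.mono (Ends.assign_seq (K := 60 * P.edges.card + 150) (Q := fun s' =>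
      s'.reg 3 = (S.σ i : ℕ) + 1 ∧ L.IsMarked S D ((S.σ i : ℕ) + 1) s' ∧
      L.IsRecorded S D ((S.σ i : ℕ) + 1) s') ?_) (by simp [Expr.cost]; omega) fun _ h => h
    rw [hev]
    refine Ends.mono (Ends.assign_seq (Ends.seq
      (ends_findBest hD hM' (by simp [Store.setReg_reg])) (Q' := fun s' =>
        s'.reg 3 = (S.σ i : ℕ) + 1 ∧ L.IsMarked S D ((S.σ i : ℕ) + 1) s' ∧
        L.IsRecorded S D ((S.σ i : ℕ) + 1) s') (K₂ := 30 * P.edges.card + 110) ?_)) ?_ fun _ h => h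
    · rintro _ rfl
      set s₁ := (s.setReg 5 (L.vert i)).setReg 4 (P.numBetter i (D i)) with hs₁
      have hG₁ : L.Given s₁ := hM'.toGiven.setReg (by norm_num)
      have h51 : s₁.reg 5 = L.vert i := by simp [hs₁, Store.setReg_reg]
      have hcur : StableProgram.current.eval s₁ = L.edge (D i) := by
        rw [Expr.eval, Expr.eval, h51, ← hG₁.pref i _ hDi]
        simp [Expr.eval, hs₁, Store.setReg_reg]
      have hput : Expr.eval s₁ (.reg 5) = L.vert i := h51
      refine Ends.mono (Ends.put_seq (Ends.seq (ends_markRest (i := i) (l := P.numBetter i (D i))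
        (hG₁.setArr (by norm_num)) h51 (by simp [Store.setArr_reg, hs₁, Store.setReg_reg])
        (numBetter_lt_degree hDi).le) (Q' := fun s' =>
        s'.reg 3 = (S.σ i : ℕ) + 1 ∧ L.IsMarked S D ((S.σ i : ℕ) + 1) s' ∧
        L.IsRecorded S D ((S.σ i : ℕ) + 1) s') (K₂ := 60) ?_)) ?_ fun _ h => h
      · rintro s₂ ⟨hr, ha, h11⟩
        rw [hput, hcur] at ha h11
        have hM₂ : L.IsMarked S D ((S.σ i : ℕ) + 1) s₂ := by
          refine ⟨hM'.toGiven.congr ?_ fun a h => ?_, ?_, fun e => ?_, fun k hk => ?_, ?_⟩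
          · rw [hr 0 (by norm_num)]
            simp [Store.setArr_reg, hs₁, Store.setReg_reg]
          · rw [ha a (by omega), setArr_arr_of_ne (by omega)]
            rfl
          · rw [ha 10 (by norm_num), setArr_arr_of_ne (by norm_num)]
            exact hM.order
          · rw [h11 e, setArr_arr_of_ne (by norm_num)]
            have hme : s₁.arr 11 (L.edge e) 0 = 0 ↔ _ := hM.mark e
            have hsplit : ∀ k : V, (S.σ k : ℕ) < (S.σ i : ℕ) + 1 ↔
                (S.σ k : ℕ) < (S.σ i : ℕ) ∨ k = i := by
              intro k
              rw [Nat.lt_succ_iff_lt_or_eq, Fin.val_inj, S.σ.injective.eq_iff]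
            -- The hyperedges marked in this round are those that violate the new condition at `i`,
            -- `D i` included.
            by_cases hc : i ∈ e.1 ∧ P.numBetter i (D i) ≤ P.numBetter i e
            · rw [if_pos hc]
              refine iff_of_false one_ne_zero fun hall => ?_
              have := (numBetter_lt_iff hc.1 hDi).2 (hall i hc.1 (Nat.lt_succ_self _))
              omega
            · rw [if_neg hc, hme]
              constructor
              · intro hall k hk hlt
                rcases (hsplit k).1 hlt with hlt | rfl
                · exact hall k hk hlt
                · exact (numBetter_lt_iff hk hDi).1 (not_le.1 fun hle => hc ⟨hk, hle⟩)
              · intro hall k hk hlt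
                exact hall k hk (by omega)
          · rw [ha 12 (by norm_num), Store.setArr_arr]
            by_cases hki : k = i
            · subst hki
              simp [Expr.eval]
            · rw [if_neg fun h => hki (L.vert_inj.1 h.2.1)]
              refine hM.value k (lt_of_le_of_ne (by omega) fun heq => hki ?_)
              exact S.σ.injective (Fin.ext heq)
          · rw [ha 8 (by norm_num), setArr_arr_of_ne (by norm_num)]
            exact hM.zero
        have hR₂ : L.IsRecorded S D (S.σ i) s₂ := by
          refine hR.congr ?_ ?_ ?_
          · rw [hr 2 (by norm_num)]
            simp [Store.setArr_reg, hs₁, Store.setReg_reg]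
          · rw [ha 6 (by norm_num), setArr_arr_of_ne (by norm_num)]
            rfl
          · rw [ha 7 (by norm_num), setArr_arr_of_ne (by norm_num)]
            rfl
        refine Ends.mono (Ends.seq (ends_record hM₂ hR₂ (by rw [hr 5 (by norm_num)]; exact h51))
          (Q' := fun s' => s'.reg 3 = (S.σ i : ℕ) + 1 ∧ L.IsMarked S D ((S.σ i : ℕ) + 1) s' ∧
          L.IsRecorded S D ((S.σ i : ℕ) + 1) s') (K₂ := 4) ?_) (by norm_num) fun _ h => h
        rintro s₃ ⟨hM₃, hR₃, h33⟩
        refine Ends.assign ⟨?_, hM₃.congr (by simp [Store.setReg_reg]) fun _ _ _ => rfl,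
          hR₃.congr (by simp [Store.setReg_reg]) rfl rfl⟩
        rw [Store.setReg_reg, if_pos rfl, Expr.eval, Expr.eval, Expr.eval, h33, hr 3 (by norm_num)]
        simp [Store.setArr_reg, hs₁, Store.setReg_reg, h3]
      · simp [Expr.cost]
        omega
    · simp [Expr.cost]
      omega
  · refine ⟨by simp [Store.setReg_reg, Expr.eval],
      ⟨h.toGiven.setReg (by norm_num), h10, fun e => ?_, by simp,
        fun i j => h.arr_zero 8 i j (by norm_num) (by norm_num) (by norm_num)⟩,
      ⟨by simp [Store.setReg_reg, h.reg_two], by simp, by simp⟩⟩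
    rw [Store.setReg_arr, h.arr_zero 11 _ _ (by norm_num) (by norm_num) (by norm_num)]
    simp
  · simp only [Expr.cost]
    nlinarith
  · rintro s' ⟨-, hM, hR⟩
    exact ⟨hM, hR⟩

theorem ends_addValues {i : V} (h : L.Given s) (h5 : s.reg 5 = L.vert i) (h4 : s.reg 4 = 0)
    (h6 : s.reg 6 = 0) :
    Ends StableProgram.addValues s (30 * P.edges.card + 30) fun s' =>
      (∀ r, r ≠ 4 → r ≠ 6 → s'.reg r = s.reg r) ∧ s'.arr = s.arr ∧
      (s'.reg 6 = 0 ↔ ∀ e : P.Edge, i ∈ e.1 → s.arr 8 (L.edge e) 0 = 0) := by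
  refine Ends.mono (Ends.loop (K := 14) (fun k s' => s'.reg 4 = k ∧
      (∀ r, r ≠ 4 → r ≠ 6 → s'.reg r = s.reg r) ∧ s'.arr = s.arr ∧
      (s'.reg 6 = 0 ↔ ∀ e : P.Edge, i ∈ e.1 → P.numBetter i e < k → s.arr 8 (L.edge e) 0 = 0))
      (P.degree i) ?_ ?_ ?_) ?_ ?_
  · rintro k s' hk ⟨h1, h2, h3, -⟩
    simp only [Expr.eval, h1, h2 5 (by norm_num) (by norm_num), h5, h3, h.degree]
    split_ifs <;> omega
  · rintro k s' hk ⟨h1, h2, h3, h4⟩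
    obtain ⟨e₀, he₀, hn⟩ := P.exists_numBetter_eq hk
    have hcur : (StableProgram.at1 8 StableProgram.current).eval s' = s.arr 8 (L.edge e₀) 0 := by
      simp only [Expr.eval, h1, h2 5 (by norm_num) (by norm_num), h5, h3]
      rw [← hn, h.pref i e₀ he₀]
    refine Ends.mono (Ends.assign_seq (Ends.assign (Q := fun s' => s'.reg 4 = k + 1 ∧
      (∀ r, r ≠ 4 → r ≠ 6 → s'.reg r = s.reg r) ∧ s'.arr = s.arr ∧
      (s'.reg 6 = 0 ↔ ∀ e : P.Edge, i ∈ e.1 → P.numBetter i e < k + 1 →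
        s.arr 8 (L.edge e) 0 = 0)) ⟨?_, fun r hr hr' => ?_, h3, ?_⟩))
      (by simp [Expr.cost]) fun _ h => h
    · simp [Store.setReg_reg, Expr.eval, h1]
    · simp [Store.setReg_reg, hr, hr', h2 r hr hr']
    · rw [Store.setReg_reg, if_neg (by norm_num), Store.setReg_reg, if_pos rfl, Expr.eval, hcur,
        Expr.eval, Nat.add_eq_zero_iff, h4]
      constructor
      · rintro ⟨ha, hb⟩ e he hlt
        rcases Nat.lt_succ_iff_lt_or_eq.1 hlt with hlt | heq
        · exact ha e he hlt
        · rw [numBetter_inj he he₀ (heq.trans hn.symm), hb]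
      · intro hall
        exact ⟨fun e he hlt => hall e he (by omega), hall e₀ he₀ (by omega)⟩
  · exact ⟨h4, fun _ _ _ => rfl, rfl, by simp [h6]⟩
  · have h1 := P.degree_le i
    simp only [Expr.cost]
    omega
  · rintro s' ⟨-, h2, h3, h4⟩
    refine ⟨h2, h3, h4.trans (forall₂_congr fun e he => ?_)⟩
    simp [numBetter_lt_degree he]

end Labeling

end ArborescenceNetwork

/-! ### The extreme point and the recorded pivots. -/

namespace ArborescenceNetwork

open RAM HypergraphicPreferenceSystem Scarf

variable {V U : Type*} [Fintype V] [Fintype U] [DecidableEq V]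
  {P : HypergraphicPreferenceSystem V} {N : ArborescenceNetwork P U}

namespace BlockPartition

variable {S : BlockPartition N} {D : V → P.Edge}

/-- The vertex `i` is matched by `D i` unless it belongs to a matched hyperedge with a later first
arc. -/
theorem eq_one_iff_of_isExtremePoint (hD : IsGreedy N D) {x : Option P.Edge → ℝ}
    (hx : IsExtremePoint S.matA S.vecb (basisOf D) x) (i : V) :
    x (some (D i)) = 1 ↔ ∀ e : P.Edge, i ∈ e.1 → S.σ i < S.σ (N.top e) → x (some e) ≠ 1 := by
  have hrow := congr_fun hx.2.1.1 (some i)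
  rw [S.matA_mulVec_some] at hrow
  change _ = (1 : ℝ) at hrow
  have hnn : ∀ e : P.Edge, 0 ≤ if i ∈ e.1 then x (some e) else 0 := fun e => by
    split_ifs
    exacts [hx.2.2 _, le_rfl]
  constructor
  · intro h1 e he hlt h1'
    have hne : e ≠ D i := by
      rintro rfl
      rw [hD.top] at hlt
      exact lt_irrefl _ hlt
    rw [← Finset.add_sum_erase _ _ (Finset.mem_univ (D i)), if_pos (mem_self hD i), h1] at hrow
    have := Finset.single_le_sum (f := fun e : P.Edge => if i ∈ e.1 then x (some e) else 0)
      (fun e _ => hnn e) (Finset.mem_erase.2 ⟨hne, Finset.mem_univ e⟩)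
    simp only [if_pos he, h1'] at this
    linarith
  · intro h
    obtain ⟨e, -, he⟩ := Finset.exists_ne_zero_of_sum_ne_zero (hrow.trans_ne one_ne_zero)
    have hie : i ∈ e.1 := by
      by_contra hie
      simp [hie] at he
    rw [if_pos hie] at he
    have h1 := (S.eq_zero_or_one_of_isExtremePoint hx e).resolve_left he
    obtain ⟨k, rfl⟩ := some_mem_basisOf.1 (by
      by_contra hn
      exact he (hx.2.1.2 _ hn))
    by_cases hki : i = k
    · rwa [hki]
    · exact absurd h1 (h _ hie (S.σ_lt_top hie (by rwa [hD.top])))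

theorem eq_of_ne_zero (hD : IsGreedy N D) {x : Option P.Edge → ℝ}
    (hx : IsExtremePoint S.matA S.vecb (basisOf D) x) {e : P.Edge} (he : x (some e) ≠ 0) :
    e = D (N.top e) := by
  obtain ⟨k, rfl⟩ := some_mem_basisOf.1 (by
    by_contra hn
    exact he (hx.2.1.2 _ hn))
  rw [hD.top]

/-- The column that leaves the cardinal basis in an iteration. -/
theorem runB_sdiff (hD : IsGreedy N D) {k : ℕ} (hk : k < S.runLength D) {i : V}
    (hi : (S.σ i : ℕ) = S.runIndex D k) :
    S.runB D k \ S.runB D (k + 1) = {some (P.single i)} := by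
  have hne : D i ≠ P.single i := by
    obtain ⟨i', hi', hne⟩ := active_runIndex hk
    rwa [S.σ.injective (Fin.ext (hi'.trans hi.symm))] at hne
  have hinj := injective_of_top (top_stage (S := S) hD (S.runIndex D k))
  have hsi : S.stage D (S.runIndex D k) i = P.single i := stage_of_le hi.ge
  have htop := top_stage (S := S) hD (S.runIndex D k)
  rw [runB, runB, stage_runIndex_succ hk hi]
  ext j
  rw [Finset.mem_sdiff, mem_basisOf, mem_basisOf, Finset.mem_singleton]
  constructor
  · rintro ⟨rfl | ⟨l, rfl⟩, hn⟩
    · exact absurd (Or.inl rfl) hn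
    · by_cases hl : l = i
      · rw [hl, hsi]
      · exact absurd (Or.inr ⟨l, by rw [Function.update_of_ne hl]⟩) hn
  · rintro rfl
    refine ⟨Or.inr ⟨i, by rw [hsi]⟩, ?_⟩
    rintro (h | ⟨l, hl⟩)
    · simp at h
    · have hl := Option.some_injective _ hl
      by_cases hli : l = i
      · rw [hli, Function.update_self] at hl
        exact hne hl
      · rw [Function.update_of_ne hli, ← hsi] at hl
        exact hli (hinj hl)

/-- The column that enters the ordinal basis in an iteration. -/
theorem runO_sdiff (hD : IsGreedy N D) {k : ℕ} (hk : k < S.runLength D) :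
    S.runO D (k + 1) \ S.runO D k = {S.columnAt D (S.runIndex D (k + 1))} := by
  obtain ⟨i, hi, hne, hcol⟩ := columnAt_runIndex hk
  have htop := top_stage (S := S) hD (S.runIndex D k)
  rw [runO, runO, hcol, stage_runIndex_succ hk hi]
  ext j
  simp only [Finset.mem_sdiff, Finset.mem_insert, mem_columns, Finset.mem_singleton]
  constructor
  · rintro ⟨h | ⟨l, rfl⟩, hn⟩
    · exact h
    · by_cases hl : l = i
      · rw [hl, Function.update_self] at hn
        exact absurd (Or.inl rfl) hn
      · rw [Function.update_of_ne hl] at hn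
        exact absurd (Or.inr ⟨l, rfl⟩) hn
  · rintro rfl
    refine ⟨Or.inl rfl, ?_⟩
    rcases active_or_eq S D (k + 1) with ⟨i', hi', hne'⟩ | h
    · have hlt := runIndex_lt_succ hk
      rw [← hi', columnAt_σ]
      rintro (h | ⟨l, hl⟩)
      · have h := congr_arg N.top (Option.some_injective _ h)
        rw [hD.top, hD.top] at h
        subst h
        omega
      · have hl := Option.some_injective _ hl
        have h := congr_arg N.top hl
        rw [htop, hD.top] at h
        subst h
        rw [stage_of_le (by omega)] at hl
        exact hne' hl.symm
    · rw [h, columnAt, dif_neg (lt_irrefl _)]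
      simp

end BlockPartition

namespace Labeling

variable {L : Labeling N} {s s' : Store} {S : BlockPartition N} {D : V → P.Edge}

-- Arcs are treated from the root downwards. After `k` rounds array `8` is the indicator of the
-- matched hyperedges whose first arc is among the `k` highest.
open scoped Classical in
theorem ends_solve (hD : IsGreedy N D) (h : L.IsMarked S D (Fintype.card V) s)
    {x : Option P.Edge → ℝ} (hx : IsExtremePoint S.matA S.vecb (basisOf D) x) :
    Ends StableProgram.solve s
      (60 * (Fintype.card V * P.edges.card) + 200 * Fintype.card V + 200) fun s' =>
      s'.reg 2 = s.reg 2 ∧ (∀ a, a ≠ 8 → s'.arr a = s.arr a) ∧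
      ∀ e, s'.arr 8 (L.edge e) 0 = if x (some e) = 1 then 1 else 0 := by
  refine Ends.mono (Ends.assign_seq (Ends.loop (K := 60 * P.edges.card + 160) (fun k s' =>
    s'.reg 3 = k ∧ s'.reg 0 = s.reg 0 ∧ s'.reg 2 = s.reg 2 ∧ (∀ a, a ≠ 8 → s'.arr a = s.arr a) ∧
      ∀ e, s'.arr 8 (L.edge e) 0 =
        if Fintype.card V ≤ (S.σ (N.top e) : ℕ) + k ∧ x (some e) = 1 then 1 else 0)
    (Fintype.card V) ?_ ?_ ?_)) ?_ ?_
    (K' := 60 * (Fintype.card V * P.edges.card) + 200 * Fintype.card V + 200)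
  · rintro k s' - ⟨h3, h0, -⟩
    simp [Expr.eval, h3, h0, h.numVert]
  · rintro k s₁ hk ⟨h3, h0, h2, ha, h8⟩
    obtain ⟨i, hi⟩ : ∃ i, (S.σ i : ℕ) = Fintype.card V - 1 - k :=
      ⟨S.σ.symm ⟨Fintype.card V - 1 - k, by omega⟩, by simp⟩
    have hev : (StableProgram.at1 10 (.sub (.sub (.reg 0) (.const 1)) (.reg 3))).eval s₁ =
        L.vert i := by
      simp only [Expr.eval, h3, h0, h.numVert, ha 10 (by norm_num)]
      rw [← hi, h.order]
    refine Ends.mono (Ends.assign_seq (K := 30 * P.edges.card + 100) (Q := fun s' =>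
      s'.reg 3 = k + 1 ∧ s'.reg 0 = s.reg 0 ∧ s'.reg 2 = s.reg 2 ∧
      (∀ a, a ≠ 8 → s'.arr a = s.arr a) ∧ ∀ e, s'.arr 8 (L.edge e) 0 =
        if Fintype.card V ≤ (S.σ (N.top e) : ℕ) + (k + 1) ∧ x (some e) = 1 then 1 else 0) ?_)
      (by simp [Expr.cost]; omega) fun _ h => h
    rw [hev]
    have hG : L.Given (((s₁.setReg 5 (L.vert i)).setReg 6 0).setReg 4 0) :=
      ((h.toGiven.congr h0 fun a h => ha a (by omega)).setReg (by norm_num)).setReg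
        (by norm_num) |>.setReg (by norm_num)
    refine Ends.mono (Ends.assign_seq (Ends.assign_seq (Ends.seq (ends_addValues (i := i) hG
      (by simp [Store.setReg_reg]) (by simp [Store.setReg_reg, Expr.eval])
      (by simp [Store.setReg_reg, Expr.eval]))
      (Q' := fun s' =>
      s'.reg 3 = k + 1 ∧ s'.reg 0 = s.reg 0 ∧ s'.reg 2 = s.reg 2 ∧
      (∀ a, a ≠ 8 → s'.arr a = s.arr a) ∧ ∀ e, s'.arr 8 (L.edge e) 0 =
        if Fintype.card V ≤ (S.σ (N.top e) : ℕ) + (k + 1) ∧ x (some e) = 1 then 1 else 0)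
      (K₂ := 30) ?_))) (by simp [Expr.cost]; omega) fun _ h => h
    rintro s₂ ⟨hr, ha₂, h6⟩
    have hr' : ∀ r, r ≠ 4 → r ≠ 5 → r ≠ 6 → s₂.reg r = s₁.reg r := by
      intro r h4 h5 h6
      rw [hr r h4 h6]
      simp [Store.setReg_reg, h4, h5, h6]
    have ha₂' : s₂.arr = s₁.arr := ha₂
    have h5 : s₂.reg 5 = L.vert i := by
      rw [hr 5 (by norm_num) (by norm_num)]
      simp [Store.setReg_reg]
    -- At this moment the nonzero values belong to the matched hyperedges with first arc above `i`,
    -- which are those that decide the value of `D i`.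
    have h6' : s₂.reg 6 = 0 ↔ x (some (D i)) = 1 := by
      rw [h6, BlockPartition.eq_one_iff_of_isExtremePoint hD hx]
      refine forall₂_congr fun e _ => ?_
      rw [Store.setReg_arr, Store.setReg_arr, Store.setReg_arr, h8, Fin.lt_def]
      by_cases h1 : x (some e) = 1
      · simp only [h1, and_true, ite_eq_right_iff, one_ne_zero, ne_eq, not_true_eq_false]
        refine imp_congr_left ?_
        omega
      · simp [h1]
    have hsplit : ∀ e : P.Edge, x (some e) = 1 →
        (Fintype.card V ≤ (S.σ (N.top e) : ℕ) + (k + 1) ↔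
          Fintype.card V ≤ (S.σ (N.top e) : ℕ) + k ∨ e = D i) := by
      intro e he
      constructor
      · intro hle
        by_cases hle' : Fintype.card V ≤ (S.σ (N.top e) : ℕ) + k
        · exact Or.inl hle'
        · right
          have : N.top e = i := S.σ.injective (Fin.ext (by omega))
          rw [← this]
          exact BlockPartition.eq_of_ne_zero hD hx (by rw [he]; exact one_ne_zero)
      · rintro (hle | rfl)
        · omega
        · rw [hD.top]
          omega
    have hval : (StableProgram.at1 12 (.reg 5)).eval s₂ = L.edge (D i) := by
      simp only [Expr.eval, h5, ha₂', ha 12 (by norm_num)]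
      exact h.value i (S.σ i).2
    refine Ends.mono (Ends.seq (Ends.cond (K := 10) (fun hc => ?_) (fun hc => ?_)) (Q := fun s' =>
      s'.reg 3 = k ∧ s'.reg 0 = s.reg 0 ∧ s'.reg 2 = s.reg 2 ∧
      (∀ a, a ≠ 8 → s'.arr a = s.arr a) ∧ ∀ e, s'.arr 8 (L.edge e) 0 =
        if Fintype.card V ≤ (S.σ (N.top e) : ℕ) + (k + 1) ∧ x (some e) = 1 then 1 else 0)
      (fun s₃ hs₃ => Ends.assign ?_)) (by simp [Expr.cost]) fun _ h => h
    · refine (Ends.skip ⟨?_, ?_, ?_, fun a h => by rw [ha₂', ha a h], fun e => ?_⟩).mono (by norm_num)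
        fun _ h => h
      · rw [hr' 3 (by norm_num) (by norm_num) (by norm_num), h3]
      · rw [hr' 0 (by norm_num) (by norm_num) (by norm_num), h0]
      · rw [hr' 2 (by norm_num) (by norm_num) (by norm_num), h2]
      · rw [ha₂', h8]
        refine if_congr (and_congr_left fun he => ?_) rfl rfl
        rw [hsplit e he]
        refine (or_iff_left ?_).symm
        rintro rfl
        exact hc (h6'.2 he)
    · refine (Ends.put ⟨?_, ?_, ?_, fun a h => ?_, fun e => ?_⟩).mono (by simp [Expr.cost])
        fun _ h => h
      · rw [Store.setArr_reg, hr' 3 (by norm_num) (by norm_num) (by norm_num), h3]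
      · rw [Store.setArr_reg, hr' 0 (by norm_num) (by norm_num) (by norm_num), h0]
      · rw [Store.setArr_reg, hr' 2 (by norm_num) (by norm_num) (by norm_num), h2]
      · rw [setArr_arr_of_ne h, ha₂', ha a h]
      · have hDi := h6'.1 hc
        rw [Store.setArr_arr, hval, ha₂', h8]
        by_cases hei : e = D i
        · subst hei
          rw [if_pos ⟨rfl, rfl, rfl⟩, if_pos ⟨(hsplit _ hDi).2 (Or.inr rfl), hDi⟩]
          rfl
        · rw [if_neg fun h => hei (L.edge_inj.1 h.2.1)]
          refine if_congr (and_congr_left fun he => ?_) rfl rfl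
          rw [hsplit e he]
          exact (or_iff_left hei).symm
    · obtain ⟨h3, h0, h2, ha, h8⟩ := hs₃
      refine ⟨?_, ?_, ?_, ha, h8⟩
      · simp [Store.setReg_reg, Expr.eval, h3]
      · simp [Store.setReg_reg, h0]
      · simp [Store.setReg_reg, h2]
  · refine ⟨by simp [Store.setReg_reg, Expr.eval], by simp [Store.setReg_reg],
      by simp [Store.setReg_reg], fun _ _ => rfl, fun e => ?_⟩
    rw [Store.setReg_arr, h.zero, if_neg]
    have := (S.σ (N.top e)).2
    omega
  · simp only [Expr.cost]
    nlinarith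
  · rintro s' ⟨-, -, h2, ha, h8⟩
    refine ⟨h2, ha, fun e => ?_⟩
    rw [h8]
    simp

theorem exists_output [Nonempty V] (h : L.IsInput s) :
    ∃ (S : BlockPartition N) (D : V → P.Edge) (x : Option P.Edge → ℝ) (t : ℕ) (s' : Store),
      IsGreedy N D ∧ IsExtremePoint S.matA S.vecb (basisOf D) x ∧ Exec stableProgram s t s' ∧
      t ≤ 2000 * (Fintype.card V * P.edges.card) ∧
      L.IsOutput s' (S.runLength D) (S.runB D) (S.runO D) x := by
  classical
  obtain ⟨t₁, s₁, he₁, ht₁, hF₁, h9⟩ := ends_markHeads h.fresh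
    fun i j => h.arr_zero 9 i j (by norm_num)
  obtain ⟨t₂, s₂, he₂, ht₂, hF₂, σ, hσ, h10⟩ := ends_orderArcs hF₁ h9
  obtain ⟨S, rfl⟩ := exists_blockPartition σ hσ
  obtain ⟨D, hD⟩ := S.exists_isGreedy
  obtain ⟨x, hx⟩ := S.exists_isExtremePoint_basisOf hD.top
  obtain ⟨t₃, s₃, he₃, ht₃, hM, hR⟩ := ends_treatBlocks hD hF₂ h10
  obtain ⟨t₄, s₄, he₄, ht₄, h2, ha, h8⟩ := ends_solve hD
    (s := s₃.setArr 7 ((Expr.sub (.reg 2) (.const 1)).eval s₃) ((Expr.const 0).eval s₃)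
      ((Expr.const 0).eval s₃))
    (hM.congr rfl fun a _ h7 => setArr_arr_of_ne h7) hx
  refine ⟨S, D, x, _, s₄, hD, hx, he₁.seq (he₂.seq (he₃.seq ((Exec.put _ _ _ _ _).seq he₄))), ?_,
    ⟨?_, fun k hk => ?_, fun k hk => ?_, fun e => ?_⟩⟩
  -- Since `1 ≤ |V| ≤ |E|`, all of `|V|²`, `|V|` and the constants are at most `|V||E|`; the
  -- coefficients add up to less than 2000.
  · have h1 : 1 ≤ Fintype.card V := Fintype.card_pos
    have h2 : Fintype.card V ≤ P.edges.card := by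
      rw [← Fintype.card_coe P.edges]
      exact Fintype.card_le_of_injective P.single single_injective
    have h3 : Fintype.card V * Fintype.card V ≤ Fintype.card V * P.edges.card :=
      Nat.mul_le_mul_left _ h2
    have h4 : Fintype.card V * 1 ≤ Fintype.card V * P.edges.card :=
      Nat.mul_le_mul_left _ (h1.trans h2)
    simp only [Expr.cost]
    omega
  · rw [h2, Store.setArr_reg, hR.count]
    rfl
  · obtain ⟨i, hi, h6⟩ := hR.leaving k hk
    refine ⟨_, BlockPartition.runB_sdiff hD hk hi, ?_⟩
    rw [ha 6 (by norm_num), setArr_arr_of_ne (by norm_num), h6]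
    rfl
  · refine ⟨_, BlockPartition.runO_sdiff hD hk, ?_⟩
    rw [ha 7 (by norm_num), Store.setArr_arr]
    have hT : (Expr.sub (.reg 2) (.const 1)).eval s₃ = S.runLength D - 1 := by
      simp only [Expr.eval, hR.count]
      rfl
    rw [hT]
    -- The last entry comes from the separate assignment of 0, the name of column `none`; the others
    -- were recorded with the next active block.
    by_cases hk' : k + 1 = S.runLength D
    · rw [if_pos ⟨rfl, by omega, rfl⟩, hk', BlockPartition.runIndex_runLength,
        BlockPartition.columnAt, dif_neg (lt_irrefl _)]
      rfl
    · obtain ⟨i, hi, h7⟩ := hR.entering k (lt_of_le_of_ne hk hk')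
      rw [if_neg (by omega), h7, ← hi, BlockPartition.columnAt_σ]
      rfl
  · rw [h8]
    rcases S.eq_zero_or_one_of_isExtremePoint hx e with h | h <;> simp [h]

end Labeling

end ArborescenceNetwork

theorem theorem1 :
    -- every depth-first ordering, every choice of the block-partitioned matrices
    (∀ (V : Type*) (U : Type*) [Fintype V] [DecidableEq V] [Nonempty V]
        (P : HypergraphicPreferenceSystem V) (N : ArborescenceNetwork P U)
        (S : ArborescenceNetwork.BlockPartition N),
      ∃ ρ : Finset (Option P.Edge) → Option P.Edge → Option P.Edge,
        Scarf.IsPivotingRule S.matA S.vecb ρ ∧ S.IsFFLRule ρ ∧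
        (∃ T B O, Scarf.IsRun S.matC ρ S.initB S.initO T B O) ∧
        ∀ T B O, Scarf.IsRun S.matC ρ S.initB S.initO T B O →
          T ≤ Fintype.card V ∧
          Scarf.IsDominatingBasis S.matA S.vecb S.matC (B T) ∧
          ∀ x, Scarf.IsExtremePoint S.matA S.vecb (B T) x →
            P.IsStableMatching fun e => x (some e)) ∧
    -- one program and one constant for all instances
    (∃ (prog : RAM.Program) (K : ℕ),
      ∀ (V : Type*) (U : Type*) [Fintype V] [Fintype U] [DecidableEq V] [Nonempty V]
        (P : HypergraphicPreferenceSystem V) (N : ArborescenceNetwork P U)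
        (L : ArborescenceNetwork.Labeling N) (s : RAM.Store), L.IsInput s →
      ∃ (S : ArborescenceNetwork.BlockPartition N)
        (ρ : Finset (Option P.Edge) → Option P.Edge → Option P.Edge)
        (T : ℕ) (B O : ℕ → Finset (Option P.Edge)) (x : Option P.Edge → ℝ)
        (t : ℕ) (s' : RAM.Store),
        Scarf.IsPivotingRule S.matA S.vecb ρ ∧ S.IsFFLRule ρ ∧
        Scarf.IsRun S.matC ρ S.initB S.initO T B O ∧
        T ≤ Fintype.card V ∧
        Scarf.IsExtremePoint S.matA S.vecb (B T) x ∧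
        P.IsStableMatching (fun e => x (some e)) ∧
        RAM.Exec prog s t s' ∧
        t ≤ K * (Fintype.card V * P.edges.card) ∧
        L.IsOutput s' T B O x) := by
  constructor
  · intro V U _ _ _ P N S
    obtain ⟨D, hD⟩ := S.exists_isGreedy
    refine ⟨S.fflRule, S.isFFLRule_fflRule.isPivotingRule, S.isFFLRule_fflRule,
      ⟨_, _, _, ArborescenceNetwork.BlockPartition.isRun_run S.isFFLRule_fflRule hD⟩, ?_⟩
    intro T B O hrun
    obtain ⟨rfl, hB⟩ :=
      ArborescenceNetwork.BlockPartition.isRun_unique S.isFFLRule_fflRule hD hrun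
    have hdom : Scarf.IsDominatingBasis S.matA S.vecb S.matC (B (S.runLength D)) := by
      rw [hB, ArborescenceNetwork.BlockPartition.runB_runLength]
      exact S.isDominatingBasis_basisOf hD
    exact ⟨ArborescenceNetwork.BlockPartition.runLength_le, hdom, fun x hx =>
      ArborescenceNetwork.BlockPartition.isStableMatching_of_isDominatingBasis hdom hx⟩
  · refine ⟨ArborescenceNetwork.stableProgram, 2000, ?_⟩
    intro V U _ _ _ _ P N L s hs
    obtain ⟨S, D, x, t, s', hD, hx, hexec, ht, hout⟩ :=
      ArborescenceNetwork.Labeling.exists_output hs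
    refine ⟨S, S.fflRule, S.runLength D, S.runB D, S.runO D, x, t, s',
      S.isFFLRule_fflRule.isPivotingRule, S.isFFLRule_fflRule,
      ArborescenceNetwork.BlockPartition.isRun_run S.isFFLRule_fflRule hD,
      ArborescenceNetwork.BlockPartition.runLength_le, ?_, ?_, hexec, ht, hout⟩
    · rw [ArborescenceNetwork.BlockPartition.runB_runLength]
      exact hx
    · exact ArborescenceNetwork.BlockPartition.isStableMatching_of_isDominatingBasis
        (S.isDominatingBasis_basisOf hD) hx
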